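/- Let $\Bbbk$ be a field of characteristic $0$ and let $\Delta$ be a simplicial complex with vertices in $[n]=\{1,\dots,n\}$ (the empty set is a face; not every $j\in[n]$ need be a vertex). Put $S=\Bbbk[x_1,\dots,x_n]$ and $E=\bigwedge_{\Bbbk}(e_1,\dots,e_n)$. Let $\Bbbk[\Delta]=S/I_\Delta$ and $A^\bullet=\Bbbk\langle\Delta\rangle=E/J_\Delta$, where $I_\Delta$ and $J_\Delta$ are the ideals generated by the monomials $x_\sigma=\prod_{j\in\sigma}x_j$, respectively $e_\sigma=\bigwedge_{j\in\sigma}e_j$, for $\sigma\subseteq[n]$, $\sigma\notin\Delta$. Let $A_i=(A^i)^\vee$, and let $$W_i(\Delta)=H_i\bigl(A_\bullet\otimes_{\Bbbk}S,\partial\bigr)$$ be the Koszul modules, where $\partial\colon A_{i+1}\otimes S\to A_i\otimes S$ is the transpose of the $S$-linear map $A^i\otimes S\to A^{i+1}\otimes S$, $u\otimes s\mapsto\sum_{j=1}^n e_ju\otimes x_js$. All these objects are $\mathbb N^n$-graded: $x_j$, $e_j$ and the dual basis vector $v_j\in A_1$ of $e_j$ (when $j$ is a vertex) have as multidegree the $j$-th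 unit vector. The multigrading of $\operatorname{Tor}^S_q(\Bbbk,\Bbbk[\Delta])$ is the one obtained from a multigraded free resolution of $\Bbbk=S/(x_1,\dots,x_n)$; such resolutions exist, and the statement holds for each of them. For $q<0$ one puts $\operatorname{Tor}^S_q=0$. Then for every $i\ge 1$ and every square-free multidegree $\mathbf b\in\{0,1\}^n$, with $|\mathbf b|=\sum_j b_j$ and with $\Delta_{\mathbf b}=\{\sigma\in\Delta\mid\sigma\subseteq\operatorname{Supp}(\mathbf b)\}$, there are isomorphisms of $\Bbbk$-vector spaces $$[W_i(\Delta)]_{\mathbf b}\;\cong\;\bigl[\operatorname{Tor}^S_{|\mathbf b|-i}(\Bbbk,\Bbbk[\Delta])\bigr]_{\mathbf b}^\vee\;\cong\;\widetilde H^{i-1}(\Delta_{\mathbf b};\Bbbk)^\vee\;\cong\;\widetilde H_{i-1}(\Delta_{\mathbf b};\Bbbk),$$ each of them natural in $\Delta$ with respect to inclusions of subcomplexes $\Delta'\subseteq\Delta$ on $[n]$. -/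

import Mathlib

open scoped TensorProduct

universe u v

noncomputable section

namespace KoszulSC

/-! ### Homology and cohomology of sequences of modules indexed by `ℕ` -/

section Homology

variable {R : Type*} [CommRing R]
  {C : ℕ → Type*} [∀ m, AddCommGroup (C m)] [∀ m, Module R (C m)]
  {C' : ℕ → Type*} [∀ m, AddCommGroup (C' m)] [∀ m, Module R (C' m)]

/-- The cycles of `⋯ → C 2 → C 1 → C 0 → 0` in homological degree `i`. -/
def cycles (d : ∀ m, C (m + 1) →ₗ[R] C m) : ∀ i, Submodule R (C i)
  | 0 => ⊤
  | m + 1 => LinearMap.ker (d m)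

/-- The homology (cycles modulo boundaries) of `⋯ → C 2 → C 1 → C 0 → 0` in degree `i`. -/
abbrev Homology (d : ∀ m, C (m + 1) →ₗ[R] C m) (i : ℕ) : Type _ :=
  cycles d i ⧸ (LinearMap.range (d i)).submoduleOf (cycles d i)

lemma map_mem_cycles {d : ∀ m, C (m + 1) →ₗ[R] C m} {d' : ∀ m, C' (m + 1) →ₗ[R] C' m}
    (φ : ∀ m, C m →ₗ[R] C' m) (h : ∀ m x, φ m (d m x) = d' m (φ (m + 1) x)) (i : ℕ) :
    ∀ x ∈ cycles d i, φ i x ∈ cycles d' i := by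
  cases i with
  | zero => intro x _; exact Submodule.mem_top
  | succ m =>
    intro x hx
    have hx' : d m x = 0 := hx
    change d' m (φ (m + 1) x) = 0
    rw [← h, hx', map_zero]

/-- The map induced on homology by a chain map. -/
def homologyMap {d : ∀ m, C (m + 1) →ₗ[R] C m} {d' : ∀ m, C' (m + 1) →ₗ[R] C' m}
    (φ : ∀ m, C m →ₗ[R] C' m) (h : ∀ m x, φ m (d m x) = d' m (φ (m + 1) x)) (i : ℕ) :
    Homology d i →ₗ[R] Homology d' i :=
  Submodule.mapQ _ _ ((φ i).restrict (map_mem_cycles φ h i)) (by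
    rintro ⟨x, hx⟩ ⟨y, hy⟩
    exact ⟨φ (i + 1) y, by rw [← h, hy]; rfl⟩)

/-- The coboundaries of `0 → C 0 → C 1 → C 2 → ⋯` in cohomological degree `i`. -/
def coboundaries (δ : ∀ m, C m →ₗ[R] C (m + 1)) : ∀ i, Submodule R (C i)
  | 0 => ⊥
  | m + 1 => LinearMap.range (δ m)

/-- The cohomology (cocycles modulo coboundaries) of `0 → C 0 → C 1 → C 2 → ⋯` in degree `i`. -/
abbrev Cohomology (δ : ∀ m, C m →ₗ[R] C (m + 1)) (i : ℕ) : Type _ :=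
  LinearMap.ker (δ i) ⧸ (coboundaries δ i).submoduleOf (LinearMap.ker (δ i))

/-- The map induced on cohomology by a cochain map. -/
def cohomologyMap {δ : ∀ m, C m →ₗ[R] C (m + 1)} {δ' : ∀ m, C' m →ₗ[R] C' (m + 1)}
    (φ : ∀ m, C m →ₗ[R] C' m) (h : ∀ m x, φ (m + 1) (δ m x) = δ' m (φ m x)) (i : ℕ) :
    Cohomology δ i →ₗ[R] Cohomology δ' i :=
  Submodule.mapQ _ _ ((φ i).restrict (p := LinearMap.ker (δ i)) (q := LinearMap.ker (δ' i))
    (by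
      intro x hx
      have hx' : δ i x = 0 := hx
      change δ' i (φ i x) = 0
      rw [← h, hx', map_zero])) (by
    cases i with
    | zero =>
      rintro ⟨x, hx⟩ hxy
      have hx0 : x = 0 := hxy
      subst hx0
      change φ 0 0 = 0
      exact map_zero _
    | succ m =>
      rintro ⟨x, hx⟩ ⟨y, hy⟩
      exact ⟨φ m y, by rw [← h, hy]; rfl⟩)

variable (k : Type*) [CommRing k] [Algebra k R]
  [∀ m, Module k (C m)] [∀ m, IsScalarTower k R (C m)]
  [∀ m, Module k (C' m)] [∀ m, IsScalarTower k R (C' m)]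

/-- The part of the homology in degree `i` represented by cycles that lie in the `k`-subspace `G`
of `C i`. When `C` is a complex of graded modules and `G` is the graded component of `C i` of a
given degree, this is the graded component of that degree of the homology. -/
def homologyPiece (d : ∀ m, C (m + 1) →ₗ[R] C m) (i : ℕ) (G : Submodule k (C i)) :
    Submodule k (Homology d i) :=
  (G.comap ((cycles d i).subtype.restrictScalars k)).map
    ((Submodule.mkQ ((LinearMap.range (d i)).submoduleOf (cycles d i))).restrictScalars k)

/-- The map induced on graded components of the homology by a degree-preserving chain map. -/
def homologyPieceMap {d : ∀ m, C (m + 1) →ₗ[R] C m} {d' : ∀ m, C' (m + 1) →ₗ[R] C' m}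
    (φ : ∀ m, C m →ₗ[R] C' m) (h : ∀ m x, φ m (d m x) = d' m (φ (m + 1) x)) (i : ℕ)
    (G : Submodule k (C i)) (G' : Submodule k (C' i)) (hG : ∀ x ∈ G, φ i x ∈ G') :
    homologyPiece k d i G →ₗ[k] homologyPiece k d' i G' :=
  ((homologyMap φ h i).restrictScalars k).restrict (by
    rintro _ ⟨x, hx, rfl⟩
    exact ⟨⟨φ i x, map_mem_cycles φ h i _ x.2⟩, hG _ hx, rfl⟩)

end Homology

/-! ### Simplicial complexes, restriction, reduced (co)homology -/

section Simplicial

variable {n : ℕ}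

/-- The faces of a simplicial complex on `{0, …, n-1}`, the empty face included. -/
def IsFace (Δ : PreAbstractSimplicialComplex (Fin n)) (σ : Finset (Fin n)) : Prop :=
  σ = ∅ ∨ σ ∈ Δ

lemma IsFace.subset {Δ : PreAbstractSimplicialComplex (Fin n)} {σ τ : Finset (Fin n)}
    (h : IsFace Δ σ) (hτ : τ ⊆ σ) : IsFace Δ τ := by
  rcases τ.eq_empty_or_nonempty with h0 | h0
  · exact Or.inl h0
  · rcases h with rfl | h
    · exact Or.inl (Finset.subset_empty.mp hτ)
    · exact Or.inr ((Δ.isRelLowerSet_faces h).2 hτ h0)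

lemma IsFace.mono {Δ' Δ : PreAbstractSimplicialComplex (Fin n)} (h : Δ' ≤ Δ)
    {σ : Finset (Fin n)} (hσ : IsFace Δ' σ) : IsFace Δ σ :=
  hσ.imp id (fun h' => h h')

/-- The restriction of a simplicial complex to a set `U` of vertices. -/
def restrict (Δ : PreAbstractSimplicialComplex (Fin n)) (U : Finset (Fin n)) :
    PreAbstractSimplicialComplex (Fin n) where
  faces := {σ | σ ∈ Δ ∧ σ ⊆ U}
  isRelLowerSet_faces := by
    rintro σ ⟨h, hU⟩
    exact ⟨(Δ.isRelLowerSet_faces h).1,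
      fun τ hτ h0 => ⟨(Δ.isRelLowerSet_faces h).2 hτ h0, Finset.Subset.trans hτ hU⟩⟩

lemma restrict_mono {Δ' Δ : PreAbstractSimplicialComplex (Fin n)} (h : Δ' ≤ Δ)
    (U : Finset (Fin n)) : restrict Δ' U ≤ restrict Δ U :=
  fun _ hσ => ⟨h hσ.1, hσ.2⟩

variable (k : Type*) [Field k]

/-- The faces with exactly `m` vertices, i.e. of dimension `m - 1`. -/
abbrev FaceOfCard (Δ : PreAbstractSimplicialComplex (Fin n)) (m : ℕ) : Type :=
  {σ : Finset (Fin n) // IsFace Δ σ ∧ σ.card = m}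

/-- The augmented (reduced) simplicial chains: `Chains k Δ m` has the faces with `m` vertices
as a basis, so it is the group of chains of dimension `m - 1`, and `Chains k Δ 0 = k`. -/
abbrev Chains (Δ : PreAbstractSimplicialComplex (Fin n)) (m : ℕ) : Type _ :=
  FaceOfCard Δ m →₀ k

/-- The facet of `σ` opposite to the vertex `v`. -/
def facet {Δ : PreAbstractSimplicialComplex (Fin n)} {m : ℕ} (σ : FaceOfCard Δ (m + 1))
    (v : {v // v ∈ σ.1}) : FaceOfCard Δ m :=
  ⟨σ.1.erase v.1, σ.2.1.subset (Finset.erase_subset _ _), by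
    rw [Finset.card_erase_of_mem v.2, σ.2.2]; rfl⟩

/-- The simplicial boundary map
`∂ [v₀, …, v_m] = ∑ᵢ (-1)^i [v₀, …, v̂ᵢ, …, v_m]` for `v₀ < ⋯ < v_m`. -/
def boundary (Δ : PreAbstractSimplicialComplex (Fin n)) (m : ℕ) :
    Chains k Δ (m + 1) →ₗ[k] Chains k Δ m :=
  Finsupp.linearCombination k fun σ : FaceOfCard Δ (m + 1) =>
    ∑ v ∈ σ.1.attach,
      ((-1 : k) ^ (σ.1.filter (· < v.1)).card) • Finsupp.single (facet σ v) (1 : k)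

/-- The reduced simplicial homology of `Δ` in dimension `q ≥ 0` with coefficients in `k`. -/
abbrev ReducedHomology (Δ : PreAbstractSimplicialComplex (Fin n)) (q : ℕ) : Type _ :=
  Homology (boundary k Δ) (q + 1)

/-- The simplicial coboundary map, the transpose of the boundary map. -/
def coboundary (Δ : PreAbstractSimplicialComplex (Fin n)) (m : ℕ) :
    Module.Dual k (Chains k Δ m) →ₗ[k] Module.Dual k (Chains k Δ (m + 1)) :=
  (boundary k Δ m).dualMap

/-- The reduced simplicial cohomology of `Δ` in dimension `q ≥ 0` with coefficients in `k`. -/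
abbrev ReducedCohomology (Δ : PreAbstractSimplicialComplex (Fin n)) (q : ℕ) : Type _ :=
  Cohomology (coboundary k Δ) (q + 1)

variable {Δ' Δ : PreAbstractSimplicialComplex (Fin n)}

/-- The map on simplicial chains induced by the inclusion of a subcomplex. -/
def chainsMap (h : Δ' ≤ Δ) (m : ℕ) : Chains k Δ' m →ₗ[k] Chains k Δ m :=
  Finsupp.lmapDomain k k fun σ => ⟨σ.1, σ.2.1.mono h, σ.2.2⟩

lemma chainsMap_boundary (h : Δ' ≤ Δ) (m : ℕ) (x : Chains k Δ' (m + 1)) :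
    chainsMap k h m (boundary k Δ' m x) = boundary k Δ m (chainsMap k h (m + 1) x) := by
  induction x using Finsupp.induction_linear with
  | zero => simp
  | add x y hx hy => simp only [map_add, hx, hy]
  | single σ c =>
    simp [chainsMap, boundary, Finsupp.mapDomain_single, facet]

/-- The map on reduced homology induced by the inclusion of a subcomplex. -/
def reducedHomologyMap (h : Δ' ≤ Δ) (q : ℕ) :
    ReducedHomology k Δ' q →ₗ[k] ReducedHomology k Δ q :=
  homologyMap (chainsMap k h) (chainsMap_boundary k h) (q + 1)

/-- The map on reduced cohomology induced by the inclusion of a subcomplex. -/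
def reducedCohomologyMap (h : Δ' ≤ Δ) (q : ℕ) :
    ReducedCohomology k Δ q →ₗ[k] ReducedCohomology k Δ' q :=
  cohomologyMap (fun m => (chainsMap k h m).dualMap) (by
    intro m f
    refine LinearMap.ext fun x => ?_
    exact congrArg f (chainsMap_boundary k h m x).symm) (q + 1)

end Simplicial

/-! ### The exterior Stanley–Reisner ring and the Koszul modules -/

section Koszul

variable (k : Type*) [Field k] {n : ℕ}

/-- The exterior algebra `E` on `e_0, …, e_{n-1}`. -/
abbrev Ext (n : ℕ) : Type _ := ExteriorAlgebra k (Fin n → k)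

/-- The generator `e_j` of the exterior algebra. -/
def extGen (j : Fin n) : Ext k n := ExteriorAlgebra.ι k (Pi.single j 1)

/-- The exterior monomial `e_σ`, the product of the `e_j`, `j ∈ σ`, in increasing order. -/
def extMonomial (σ : Finset (Fin n)) : Ext k n :=
  ((σ.sort (· ≤ ·)).map (extGen k)).prod

/-- The ideal `J_Δ` of the exterior algebra: the two-sided ideal generated by the monomials
`e_σ` of the non-faces `σ`. -/
def extIdeal (Δ : PreAbstractSimplicialComplex (Fin n)) : Ideal (Ext k n) :=
  TwoSidedIdeal.asIdeal (TwoSidedIdeal.span {x | ∃ σ, ¬ IsFace Δ σ ∧ x = extMonomial k σ})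

/-- The exterior Stanley–Reisner ring `A = E / J_Δ`, as a left module over `E`. -/
abbrev ExtSR (Δ : PreAbstractSimplicialComplex (Fin n)) : Type _ := Ext k n ⧸ extIdeal k Δ

/-- The component `A^i` of degree `i` of the exterior Stanley–Reisner ring. -/
def extSRDegree (Δ : PreAbstractSimplicialComplex (Fin n)) (i : ℕ) : Submodule k (ExtSR k Δ) :=
  (⋀[k]^i (Fin n → k)).map ((extIdeal k Δ).mkQ.restrictScalars k)

/-- The square-free multidegree with support `σ`. -/
def sqfreeDegree (σ : Finset (Fin n)) : Fin n →₀ ℕ := ∑ j ∈ σ, Finsupp.single j 1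

/-- The component of multidegree `a` of the exterior Stanley–Reisner ring, where `e_j` has the
`j`-th unit vector as its multidegree. -/
def extSRMultidegree (Δ : PreAbstractSimplicialComplex (Fin n)) (a : Fin n →₀ ℕ) :
    Submodule k (ExtSR k Δ) :=
  Submodule.span k {x | ∃ σ, sqfreeDegree σ = a ∧ x = (extIdeal k Δ).mkQ (extMonomial k σ)}

lemma extGen_smul_mem (Δ : PreAbstractSimplicialComplex (Fin n)) (j : Fin n) (i : ℕ) :
    ∀ u ∈ extSRDegree k Δ i, extGen k j • u ∈ extSRDegree k Δ (i + 1) := by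
  rintro _ ⟨u, hu, rfl⟩
  refine ⟨extGen k j * u, ?_, rfl⟩
  have h1 : extGen k j ∈ LinearMap.range (ExteriorAlgebra.ι k (M := Fin n → k)) ^ 1 := by
    rw [pow_one]; exact ⟨_, rfl⟩
  have := Submodule.mul_mem_mul h1 hu
  rw [← pow_add, add_comm] at this
  exact this

/-- Left multiplication by `e_j` as a map `A^i → A^{i+1}`. -/
def extSRMul (Δ : PreAbstractSimplicialComplex (Fin n)) (j : Fin n) (i : ℕ) :
    extSRDegree k Δ i →ₗ[k] extSRDegree k Δ (i + 1) :=
  (Algebra.lsmul k k (ExtSR k Δ) (extGen k j)).restrict (extGen_smul_mem k Δ j i)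

/-- The polynomial ring `S = k[x_0, …, x_{n-1}]`. -/
abbrev Poly (n : ℕ) : Type _ := MvPolynomial (Fin n) k

/-- The `i`-th module `A_i ⊗ S` of the chain complex, where `A_i` is the dual of `A^i`; the factor
`S` is written on the left. -/
abbrev KoszulChains (Δ : PreAbstractSimplicialComplex (Fin n)) (i : ℕ) : Type _ :=
  Poly k n ⊗[k] Module.Dual k (extSRDegree k Δ i)

/-- The differential `A_{i+1} ⊗ S → A_i ⊗ S`, the transpose of
`u ⊗ s ↦ ∑ j, e_j u ⊗ x_j s`. -/
def koszulDiff (Δ : PreAbstractSimplicialComplex (Fin n)) (i : ℕ) :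
    KoszulChains k Δ (i + 1) →ₗ[Poly k n] KoszulChains k Δ i :=
  ∑ j : Fin n, (MvPolynomial.X j : Poly k n) •
    LinearMap.baseChange (Poly k n) (extSRMul k Δ j i).dualMap

/-- The Koszul module `W_i(Δ) = H_i(A_• ⊗ S)`, an `S`-module. -/
abbrev KoszulModule (Δ : PreAbstractSimplicialComplex (Fin n)) (i : ℕ) : Type _ :=
  Homology (koszulDiff k Δ) i

/-- The component of multidegree `a` of `A_i`: the functionals on `A^i` that vanish on all
components of `A^i` of other multidegrees. -/
def dualMultidegree (Δ : PreAbstractSimplicialComplex (Fin n)) (i : ℕ) (a : Fin n →₀ ℕ) :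
    Submodule k (Module.Dual k (extSRDegree k Δ i)) where
  carrier := {f | ∀ a', a' ≠ a → ∀ u : extSRDegree k Δ i,
    (u : ExtSR k Δ) ∈ extSRMultidegree k Δ a' → f u = 0}
  zero_mem' := fun _ _ _ _ => rfl
  add_mem' := fun hf hg a' ha u hu => by
    rw [LinearMap.add_apply, hf a' ha u hu, hg a' ha u hu, add_zero]
  smul_mem' := fun c f hf a' ha u hu => by
    rw [LinearMap.smul_apply, hf a' ha u hu, smul_zero]

/-- The component of multidegree `b` of `A_i ⊗ S`: the span of the `f ⊗ x^c` with `f` of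
multidegree `a` and `c + a = b`. -/
def koszulChainsMultidegree (Δ : PreAbstractSimplicialComplex (Fin n)) (i : ℕ)
    (b : Fin n →₀ ℕ) : Submodule k (KoszulChains k Δ i) :=
  Submodule.span k {x | ∃ (c a : Fin n →₀ ℕ) (f : Module.Dual k (extSRDegree k Δ i)),
    c + a = b ∧ f ∈ dualMultidegree k Δ i a ∧ x = MvPolynomial.monomial c (1 : k) ⊗ₜ[k] f}

/-- The component `[W_i(Δ)]_b` of multidegree `b` of the Koszul module. -/
def koszulModulePiece (Δ : PreAbstractSimplicialComplex (Fin n)) (i : ℕ) (b : Fin n →₀ ℕ) :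
    Submodule k (KoszulModule k Δ i) :=
  homologyPiece k (koszulDiff k Δ) i (koszulChainsMultidegree k Δ i b)

variable {Δ' Δ : PreAbstractSimplicialComplex (Fin n)}

lemma extIdeal_anti (h : Δ' ≤ Δ) : extIdeal k Δ ≤ extIdeal k Δ' := by
  apply TwoSidedIdeal.asIdeal.monotone
  apply TwoSidedIdeal.span_mono
  rintro _ ⟨σ, hσ, rfl⟩
  exact ⟨σ, fun hf => hσ (hf.mono h), rfl⟩

/-- The quotient map `A(Δ) → A(Δ')` for a subcomplex `Δ'` of `Δ`. -/
def extSRProj (h : Δ' ≤ Δ) : ExtSR k Δ →ₗ[Ext k n] ExtSR k Δ' :=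
  Submodule.factor (extIdeal_anti k h)

/-- The quotient map in degree `i`, `A^i(Δ) → A^i(Δ')`. -/
def extSRDegreeProj (h : Δ' ≤ Δ) (i : ℕ) : extSRDegree k Δ i →ₗ[k] extSRDegree k Δ' i :=
  ((extSRProj k h).restrictScalars k).restrict (by
    rintro _ ⟨u, hu, rfl⟩
    exact ⟨u, hu, rfl⟩)

/-- The chain map `A_i(Δ') ⊗ S → A_i(Δ) ⊗ S` for a subcomplex `Δ'` of `Δ`. -/
def koszulChainsMap (h : Δ' ≤ Δ) (i : ℕ) : KoszulChains k Δ' i →ₗ[Poly k n] KoszulChains k Δ i :=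
  LinearMap.baseChange (Poly k n) (extSRDegreeProj k h i).dualMap

lemma koszulChainsMap_diff (h : Δ' ≤ Δ) (i : ℕ) (x : KoszulChains k Δ' (i + 1)) :
    koszulChainsMap k h i (koszulDiff k Δ' i x) =
      koszulDiff k Δ i (koszulChainsMap k h (i + 1) x) := by
  induction x using TensorProduct.induction_on with
  | zero => simp
  | add x y hx hy => simp only [map_add, hx, hy]
  | tmul s f =>
    simp only [koszulChainsMap, koszulDiff, LinearMap.sum_apply, LinearMap.smul_apply,
      LinearMap.baseChange_tmul, map_sum, map_smul]
    refine Finset.sum_congr rfl fun j _ => ?_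
    congr 2
    ext u
    exact congrArg f (Subtype.ext ((extSRProj k h).map_smul (extGen k j) u.1).symm)

lemma koszulChainsMap_mem (h : Δ' ≤ Δ) (i : ℕ) (b : Fin n →₀ ℕ) :
    ∀ x ∈ koszulChainsMultidegree k Δ' i b,
      koszulChainsMap k h i x ∈ koszulChainsMultidegree k Δ i b := by
  intro x hx
  induction hx using Submodule.span_induction with
  | zero => rw [map_zero]; exact Submodule.zero_mem _
  | add x y _ _ hx hy => rw [map_add]; exact Submodule.add_mem _ hx hy
  | smul c x _ hx =>
    have : koszulChainsMap k h i (c • x) = c • koszulChainsMap k h i x :=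
      ((koszulChainsMap k h i).restrictScalars k).map_smul c x
    rw [this]; exact Submodule.smul_mem _ _ hx
  | mem x hx =>
    obtain ⟨c, a, f, hab, hf, rfl⟩ := hx
    refine Submodule.subset_span ⟨c, a, (extSRDegreeProj k h i).dualMap f, hab, ?_, rfl⟩
    intro a' ha u hu
    refine hf a' ha _ ?_
    change extSRProj k h u.1 ∈ _
    refine Submodule.span_induction (p := fun y _ => extSRProj k h y ∈ extSRMultidegree k Δ' a')
      ?_ ?_ ?_ ?_ hu
    · rintro _ ⟨σ, hσ, rfl⟩
      exact Submodule.subset_span ⟨σ, hσ, rfl⟩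
    · rw [map_zero]; exact Submodule.zero_mem _
    · intro y z _ _ hy hz
      rw [map_add]; exact Submodule.add_mem _ hy hz
    · intro c y _ hy
      have : extSRProj k h (c • y) = c • extSRProj k h y :=
        ((extSRProj k h).restrictScalars k).map_smul c y
      rw [this]; exact Submodule.smul_mem _ _ hy

/-- The map `[W_i(Δ')]_b → [W_i(Δ)]_b` for a subcomplex `Δ'` of `Δ`. -/
def koszulModulePieceMap (h : Δ' ≤ Δ) (i : ℕ) (b : Fin n →₀ ℕ) :
    koszulModulePiece k Δ' i b →ₗ[k] koszulModulePiece k Δ i b :=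
  homologyPieceMap k (koszulChainsMap k h) (koszulChainsMap_diff k h) i _ _
    (koszulChainsMap_mem k h i b)

end Koszul

/-! ### The Stanley–Reisner ring and multigraded Tor -/

section Tor

/-- The component of multidegree `b` of the multigraded free `S`-module with basis `ι`, where the
basis element `e` has multidegree `deg e`. -/
def freeMultidegree (k : Type*) [Field k] {n : ℕ} {ι : Type*} (deg : ι → Fin n →₀ ℕ)
    (b : Fin n →₀ ℕ) : Submodule k (ι →₀ Poly k n) where
  carrier := {f | ∀ e, ∀ m ∈ (f e).support, m + deg e = b}
  zero_mem' := by intro e m hm; simp at hm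
  add_mem' := by
    classical
    intro f g hf hg e m hm
    rcases Finset.mem_union.mp (MvPolynomial.support_add hm) with h | h
    · exact hf e m h
    · exact hg e m h
  smul_mem' := by
    intro c f hf e m hm
    exact hf e m (MvPolynomial.support_smul hm)

/-- A resolution `⋯ → F_1 → F_0 → k → 0` of `k = S / (x_0, …, x_{n-1})` by multigraded free
`S`-modules with homogeneous bases, whose maps are `S`-linear and preserve multidegrees. The
augmentation is semilinear over `S → k`, `x_j ↦ 0`, i.e. it is `S`-linear for the action of `S`
on `k` in which the variables act as zero; `k` sits in multidegree `0`. -/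
structure MultigradedFreeResolution (k : Type u) [Field k] (n : ℕ) where
  /-- The basis of `F_p`. -/
  basis : ℕ → Type v
  /-- The multidegrees of the basis elements. -/
  deg : ∀ p, basis p → Fin n →₀ ℕ
  /-- The differentials. -/
  d : ∀ p, (basis (p + 1) →₀ Poly k n) →ₗ[Poly k n] (basis p →₀ Poly k n)
  /-- The augmentation. -/
  aug : (basis 0 →₀ Poly k n) →ₛₗ[(MvPolynomial.constantCoeff : Poly k n →+* k)] k
  d_homogeneous : ∀ p b, ∀ f ∈ freeMultidegree k (deg (p + 1)) b,
    d p f ∈ freeMultidegree k (deg p) b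
  aug_homogeneous : ∀ b, b ≠ 0 → ∀ f ∈ freeMultidegree k (deg 0) b, aug f = 0
  aug_surjective : Function.Surjective aug
  exact_zero : Function.Exact (d 0) aug
  exact_succ : ∀ p, Function.Exact (d (p + 1)) (d p)

variable (k : Type u) [Field k] {n : ℕ}

/-- The ideal `I_Δ` of `S` generated by the monomials `∏_{j ∈ σ} x_j` of the non-faces `σ`. -/
def srIdeal (Δ : PreAbstractSimplicialComplex (Fin n)) : Ideal (Poly k n) :=
  Ideal.span {f | ∃ σ, ¬ IsFace Δ σ ∧ f = ∏ j ∈ σ, MvPolynomial.X j}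

/-- The Stanley–Reisner ring `k[Δ] = S / I_Δ`. -/
abbrev SR (Δ : PreAbstractSimplicialComplex (Fin n)) : Type _ := Poly k n ⧸ srIdeal k Δ

/-- The component of multidegree `c` of the Stanley–Reisner ring. -/
def srMultidegree (Δ : PreAbstractSimplicialComplex (Fin n)) (c : Fin n →₀ ℕ) :
    Submodule k (SR k Δ) :=
  Submodule.span k {Ideal.Quotient.mk (srIdeal k Δ) (MvPolynomial.monomial c (1 : k))}

variable {k} (F : MultigradedFreeResolution.{u, v} k n)

/-- The module `F_p ⊗_S k[Δ]`. -/
def TorChains (Δ : PreAbstractSimplicialComplex (Fin n)) (p : ℕ) : Type (max u v) :=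
  (F.basis p →₀ Poly k n) ⊗[Poly k n] SR k Δ

instance (Δ : PreAbstractSimplicialComplex (Fin n)) (p : ℕ) : AddCommGroup (TorChains F Δ p) :=
  inferInstanceAs (AddCommGroup ((F.basis p →₀ Poly k n) ⊗[Poly k n] SR k Δ))

instance (Δ : PreAbstractSimplicialComplex (Fin n)) (p : ℕ) :
    Module (Poly k n) (TorChains F Δ p) :=
  inferInstanceAs (Module (Poly k n) ((F.basis p →₀ Poly k n) ⊗[Poly k n] SR k Δ))

instance (Δ : PreAbstractSimplicialComplex (Fin n)) (p : ℕ) : Module k (TorChains F Δ p) :=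
  inferInstanceAs (Module k ((F.basis p →₀ Poly k n) ⊗[Poly k n] SR k Δ))

instance (Δ : PreAbstractSimplicialComplex (Fin n)) (p : ℕ) :
    IsScalarTower k (Poly k n) (TorChains F Δ p) :=
  inferInstanceAs (IsScalarTower k (Poly k n) ((F.basis p →₀ Poly k n) ⊗[Poly k n] SR k Δ))

/-- The pure tensor `f ⊗ s` in `F_p ⊗_S k[Δ]`. -/
def torTmul (Δ : PreAbstractSimplicialComplex (Fin n)) (p : ℕ) (f : F.basis p →₀ Poly k n)
    (s : SR k Δ) : TorChains F Δ p :=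
  f ⊗ₜ[Poly k n] s

/-- The differential of `F ⊗_S k[Δ]`. -/
def torDiff (Δ : PreAbstractSimplicialComplex (Fin n)) (p : ℕ) :
    TorChains F Δ (p + 1) →ₗ[Poly k n] TorChains F Δ p :=
  (F.d p).rTensor (SR k Δ)

/-- The component of multidegree `b` of `F_p ⊗_S k[Δ]`. -/
def torChainsMultidegree (Δ : PreAbstractSimplicialComplex (Fin n)) (p : ℕ)
    (b : Fin n →₀ ℕ) : Submodule k (TorChains F Δ p) :=
  Submodule.span k {x | ∃ (a c : Fin n →₀ ℕ) (f : F.basis p →₀ Poly k n) (s : SR k Δ),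
    a + c = b ∧ f ∈ freeMultidegree k (F.deg p) a ∧ s ∈ srMultidegree k Δ c ∧
      x = torTmul F Δ p f s}

/-- `Tor^S_p(k, k[Δ])` for `p : ℕ`, computed with the resolution `F` of `k`. -/
abbrev TorModule (Δ : PreAbstractSimplicialComplex (Fin n)) (p : ℕ) : Type _ :=
  Homology (C := TorChains F Δ) (torDiff F Δ) p

/-- The component `[Tor^S_q(k, k[Δ])]_b` of multidegree `b`, for every integer `q`; it is zero
for `q < 0`. -/
def torPiece (Δ : PreAbstractSimplicialComplex (Fin n)) (q : ℤ) (b : Fin n →₀ ℕ) :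
    Submodule k (TorModule F Δ q.toNat) :=
  if 0 ≤ q then homologyPiece (C := TorChains F Δ) k (torDiff F Δ) q.toNat (torChainsMultidegree F Δ q.toNat b) else ⊥

variable {Δ' Δ : PreAbstractSimplicialComplex (Fin n)}

lemma srIdeal_anti (h : Δ' ≤ Δ) : srIdeal k Δ ≤ srIdeal k Δ' := by
  apply Ideal.span_mono
  rintro _ ⟨σ, hσ, rfl⟩
  exact ⟨σ, fun hf => hσ (hf.mono h), rfl⟩

/-- The quotient map `k[Δ] → k[Δ']` for a subcomplex `Δ'` of `Δ`. -/
def srProj (h : Δ' ≤ Δ) : SR k Δ →ₗ[Poly k n] SR k Δ' :=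
  Submodule.factor (srIdeal_anti h)

/-- The chain map `F ⊗_S k[Δ] → F ⊗_S k[Δ']` for a subcomplex `Δ'` of `Δ`. -/
def torChainsMap (h : Δ' ≤ Δ) (p : ℕ) : TorChains F Δ p →ₗ[Poly k n] TorChains F Δ' p :=
  (srProj h).lTensor (F.basis p →₀ Poly k n)

lemma torChainsMap_diff (h : Δ' ≤ Δ) (p : ℕ) (x : TorChains F Δ (p + 1)) :
    torChainsMap F h p (torDiff F Δ p x) = torDiff F Δ' p (torChainsMap F h (p + 1) x) := by
  have := LinearMap.lTensor_comp_rTensor (F.basis (p + 1) →₀ Poly k n) (F.d p) (srProj (k := k) h)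
  rw [← LinearMap.rTensor_comp_lTensor] at this
  exact congrArg (fun g => g x) this

lemma torChainsMap_mem (h : Δ' ≤ Δ) (p : ℕ) (b : Fin n →₀ ℕ) :
    ∀ x ∈ torChainsMultidegree F Δ p b,
      torChainsMap F h p x ∈ torChainsMultidegree F Δ' p b := by
  intro x hx
  induction hx using Submodule.span_induction with
  | zero => rw [map_zero]; exact Submodule.zero_mem _
  | add x y _ _ hx hy => rw [map_add]; exact Submodule.add_mem _ hx hy
  | smul c x _ hx =>
    have : torChainsMap F h p (c • x) = c • torChainsMap F h p x :=
      ((torChainsMap F h p).restrictScalars k).map_smul c x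
    rw [this]; exact Submodule.smul_mem _ _ hx
  | mem x hx =>
    obtain ⟨a, c, f, s, hab, hf, hs, rfl⟩ := hx
    refine Submodule.subset_span ⟨a, c, f, srProj h s, hab, hf, ?_, rfl⟩
    obtain ⟨r, rfl⟩ := Submodule.mem_span_singleton.mp hs
    have : srProj h (r • Ideal.Quotient.mk (srIdeal k Δ) (MvPolynomial.monomial c (1 : k))) =
        r • srProj h (Ideal.Quotient.mk (srIdeal k Δ) (MvPolynomial.monomial c (1 : k))) :=
      ((srProj h).restrictScalars k).map_smul r _
    rw [this]
    exact Submodule.smul_mem _ _ (Submodule.subset_span rfl)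

/-- The map `[Tor^S_q(k, k[Δ])]_b → [Tor^S_q(k, k[Δ'])]_b` for a subcomplex `Δ'` of `Δ`. -/
def torPieceMap (h : Δ' ≤ Δ) (q : ℤ) (b : Fin n →₀ ℕ) :
    torPiece F Δ q b →ₗ[k] torPiece F Δ' q b :=
  ((homologyMap (C := TorChains F Δ) (C' := TorChains F Δ') (torChainsMap F h) (torChainsMap_diff F h) q.toNat).restrictScalars k).restrict (by
    intro x hx
    unfold torPiece at hx ⊢
    split_ifs at hx ⊢ with hq
    · exact (homologyPieceMap (C := TorChains F Δ) (C' := TorChains F Δ') k (torChainsMap F h) (torChainsMap_diff F h) q.toNat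
        (torChainsMultidegree F Δ q.toNat b) (torChainsMultidegree F Δ' q.toNat b)
        (torChainsMap_mem F h q.toNat b) ⟨x, hx⟩).2
    · rw [Submodule.mem_bot] at hx ⊢
      rw [hx, map_zero])

end Tor

end KoszulSC

end

/-! In a square-free multidegree b with support U, both algebraic complexes collapse to simplicial
complexes of vector spaces attached to the restriction of Δ to U, and every isomorphism comes from
comparing bases.

Koszul side: since U is square-free, the component of degree b of A_i ⊗ S has as a basis the
elements x^{U∖σ} ⊗ e_σ^*, where σ ⊆ U is a face with i vertices (`koszulChainsMultidegree_eq_span`,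
`koszulToChains_injOn`). The differential removes a vertex j from σ and multiplies the monomial by
x_j, with exactly the sign of the simplicial boundary (`koszulToChains_koszulDiff`). Hence [W_i]_b
is reduced homology in dimension i - 1 (`koszulModulePieceEquiv`).

Tor side: for the Koszul resolution K, the component of degree b of K_p ⊗ k[Δ] has as a basis the
elements e_{U∖σ} ⊗ x_σ, where σ ⊆ U is a face with #U - p vertices. The differential moves a vertex
from U∖σ into σ, so it is the coboundary up to signs, which `complementSign` repairs
(`torToCochain_torDiff`). This is Hochster's formula (`koszulTorEquiv`); if #U < i, both sides
vanish. An arbitrary multigraded resolution is compared with K through homogeneous lifts and a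
homotopy (`exists_comparison`, `exists_homotopy`, `exists_torNatPieceEquiv`). That K is a resolution
follows from an explicit contraction, which divides by the smallest variable of each monomial
(`setDiff_contraction_insert`).

Finally, over a field the evaluation pairing identifies homology with the dual of cohomology
(`homologyEval_bijective`), which links the two sides. Naturality holds already on chains: all
comparison maps read off coefficients, and inclusions of subcomplexes preserve these. The Koszul
differential of K and the simplicial boundary are both instances of one signed operator, `setDiff`,
with weights x_j and 1 respectively. -/

noncomputable section

namespace KoszulSC

/-! ### Comparison of graded pieces of subquotients -/

section Subquotient

variable {R : Type*} [CommRing R] {k : Type*} [CommRing k] [Algebra k R]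
  {C : Type*} [AddCommGroup C] [Module R C] [Module k C] [IsScalarTower k R C]
  {B : Type*} [AddCommGroup B] [Module k B]

/-- The part of the subquotient `Z / N` represented by elements of `G`. -/
abbrev subquotientPiece (k : Type*) [CommRing k] [Algebra k R] [Module k C] [IsScalarTower k R C]
    (Z N : Submodule R C) (G : Submodule k C) : Submodule k (Z ⧸ N.submoduleOf Z) :=
  (G.comap (Z.subtype.restrictScalars k)).map
    ((Submodule.mkQ (N.submoduleOf Z)).restrictScalars k)

/-- The map of subquotients induced by a `k`-linear map. -/
def subquotientMap (Z N : Submodule R C) (Z' N' : Submodule k B) (r : C →ₗ[k] B)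
    (hZ : ∀ x ∈ Z, r x ∈ Z') (hN : ∀ x ∈ N, r x ∈ N') :
    (Z ⧸ N.submoduleOf Z) →ₗ[k] (Z' ⧸ N'.submoduleOf Z') :=
  (Submodule.mapQ ((N.submoduleOf Z).restrictScalars k) (N'.submoduleOf Z')
    (r.restrict (p := Z.restrictScalars k) (q := Z') hZ) (fun x hx => hN x.1 hx)).comp
    (Submodule.Quotient.restrictScalarsEquiv k (N.submoduleOf Z)).symm.toLinearMap

/-- A `k`-linear map that is an isomorphism from a graded piece of a subquotient. -/
def subquotientPieceEquiv (Z N : Submodule R C) (G : Submodule k C) (Z' N' : Submodule k B)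
    (r : C →ₗ[k] B) (hZ : ∀ x ∈ Z, r x ∈ Z') (hN : ∀ x ∈ N, r x ∈ N')
    (hG : ∀ x ∈ G, r x ∈ N' → x ∈ N) (hsurj : ∀ z ∈ Z', ∃ x ∈ G, x ∈ Z ∧ r x = z) :
    subquotientPiece k Z N G ≃ₗ[k] (Z' ⧸ N'.submoduleOf Z') :=
  LinearEquiv.ofBijective
    ((subquotientMap Z N Z' N' r hZ hN).comp (subquotientPiece k Z N G).subtype) (by
    constructor
    · rw [← LinearMap.ker_eq_bot, LinearMap.ker_eq_bot']
      rintro ⟨_, x, hx, rfl⟩ h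
      have h1 : (Submodule.Quotient.mk ⟨r x, hZ x x.2⟩ : Z' ⧸ N'.submoduleOf Z') = 0 := h
      rw [Submodule.Quotient.mk_eq_zero] at h1
      have h2 : x.1 ∈ N := hG x.1 hx h1
      refine Subtype.ext ?_
      exact (Submodule.Quotient.mk_eq_zero _).mpr h2
    · intro z
      obtain ⟨z, rfl⟩ := Submodule.Quotient.mk_surjective _ z
      obtain ⟨x, hx, hxZ, hxz⟩ := hsurj z.1 z.2
      refine ⟨⟨_, ⟨x, hxZ⟩, hx, rfl⟩, ?_⟩
      exact congrArg Submodule.Quotient.mk (Subtype.ext hxz))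

end Subquotient

/-! ### The universal coefficient theorem over a field -/

section UniversalCoefficients

variable {k : Type*} [Field k] {C : ℕ → Type*} [∀ m, AddCommGroup (C m)] [∀ m, Module k (C m)]

/-- Evaluation of cocycles on cycles. -/
def homologyEval (d : ∀ m, C (m + 1) →ₗ[k] C m) (m : ℕ) :
    Homology d (m + 1) →ₗ[k]
      Module.Dual k (Cohomology (C := fun m => Module.Dual k (C m))
        (fun m => (d m).dualMap) (m + 1)) :=
  Submodule.liftQ _
    (LinearMap.flip (Submodule.liftQ _
      (((Module.Dual.eval k (C (m + 1))).comp (cycles d (m + 1)).subtype).flip.comp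
        (Submodule.subtype _)) (by
        rintro ⟨f, hf⟩ ⟨g, hg⟩
        refine LinearMap.ext fun z => ?_
        change f z.1 = 0
        have hg' : g.comp (d m) = f := hg
        have hz : d m z.1 = 0 := z.2
        rw [← hg', LinearMap.comp_apply, hz, map_zero]))) (by
    rintro ⟨z, hz⟩ ⟨y, hy⟩
    refine LinearMap.ext fun f => ?_
    obtain ⟨f, rfl⟩ := Submodule.Quotient.mk_surjective _ f
    change f.1 z = 0
    have hf : f.1.comp (d (m + 1)) = 0 := f.2
    have hy' : d (m + 1) y = z := hy
    rw [← hy', ← LinearMap.comp_apply, hf, LinearMap.zero_apply])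

/-- Injectivity separates a non-boundary from the boundaries by a functional; surjectivity uses that
a finite-dimensional space is its own bidual. -/
lemma homologyEval_bijective [∀ m, FiniteDimensional k (C m)] (d : ∀ m, C (m + 1) →ₗ[k] C m)
    (m : ℕ) (hd : ∀ y, d m (d (m + 1) y) = 0) : Function.Bijective (homologyEval d m) := by
  constructor
  · rw [← LinearMap.ker_eq_bot, LinearMap.ker_eq_bot']
    intro z h
    obtain ⟨z, rfl⟩ := Submodule.Quotient.mk_surjective _ z
    rw [Submodule.Quotient.mk_eq_zero]
    by_contra hz
    -- A functional vanishing on the boundaries but not at `z` is a cocycle, and it pairs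
    -- nontrivially with `z`.
    obtain ⟨f, hf1, hf2⟩ := Submodule.exists_le_ker_of_notMem (p := LinearMap.range (d (m + 1)))
      (v := z.1) hz
    refine hf1 ?_
    have hf : f ∈ LinearMap.ker (d (m + 1)).dualMap := by
      rw [LinearMap.mem_ker]
      ext y
      exact hf2 ⟨y, rfl⟩
    have := congrArg (fun g => g (Submodule.Quotient.mk ⟨f, hf⟩)) h
    exact this
  · intro φ
    -- Extend the functional from cocycles to all cochains; by reflexivity the extension is
    -- evaluation at a chain `z`.
    obtain ⟨ψ, hψ⟩ := LinearMap.exists_extend (φ.comp (Submodule.mkQ _))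
    obtain ⟨z, rfl⟩ := (Module.evalEquiv k (C (m + 1))).surjective ψ
    -- For every `g`, the value `g (d m z)` is `φ` at the class of the coboundary `g ∘ d m`, hence
    -- zero; so `d m z = 0`.
    have hz : z ∈ cycles d (m + 1) := by
      change d m z = 0
      rw [← Module.forall_dual_apply_eq_zero_iff k]
      intro g
      have hh : (g.comp (d m)) ∈ LinearMap.ker (d (m + 1)).dualMap := by
        refine LinearMap.ext fun y => ?_
        change g (d m (d (m + 1) y)) = 0
        rw [hd, map_zero]
      have := congrArg (fun q => q ⟨_, hh⟩) hψ
      change g (d m z) = φ (Submodule.Quotient.mk ⟨g.comp (d m), hh⟩) at this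
      rw [this, (Submodule.Quotient.mk_eq_zero _).mpr, map_zero]
      exact ⟨g, rfl⟩
    refine ⟨Submodule.Quotient.mk ⟨z, hz⟩, ?_⟩
    refine LinearMap.ext fun f => ?_
    obtain ⟨f, rfl⟩ := Submodule.Quotient.mk_surjective _ f
    exact congrArg (fun q => q f) hψ

end UniversalCoefficients

/-! ### The Koszul differential on families indexed by finite sets -/

section SetDifferential

variable {n : ℕ}

/-- The sign with which `j` is moved past the smaller elements of `τ`. -/
def insertSign (S : Type*) [CommRing S] (j : Fin n) (τ : Finset (Fin n)) : S :=
  (-1) ^ (τ.filter (· < j)).card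

variable {S : Type*} [CommRing S]

lemma insertSign_mul_self (j : Fin n) (τ : Finset (Fin n)) :
    insertSign S j τ * insertSign S j τ = 1 := by
  rw [insertSign, ← mul_pow]; simp

lemma insertSign_insert_of_lt {j l : Fin n} {τ : Finset (Fin n)} (hl : l ∉ τ) (h : l < j) :
    insertSign S j (insert l τ) = - insertSign S j τ := by
  rw [insertSign, insertSign, Finset.filter_insert, if_pos h,
    Finset.card_insert_of_notMem (by simp [hl]), pow_succ]
  ring

lemma insertSign_insert_of_le {j l : Fin n} {τ : Finset (Fin n)} (h : j ≤ l) :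
    insertSign S j (insert l τ) = insertSign S j τ := by
  rw [insertSign, insertSign, Finset.filter_insert, if_neg (not_lt.mpr h)]

lemma insertSign_eq_one {j : Fin n} {τ : Finset (Fin n)} (h : ∀ l ∈ τ, j ≤ l) :
    insertSign S j τ = 1 := by
  rw [insertSign, Finset.filter_eq_empty_iff.mpr (fun l hl => not_lt.mpr (h l hl))]
  simp

/-- Inserting the smaller of the two indices shifts the position of the larger one, but not
conversely, so exactly one sign flips. This is the reason why the differentials below square to
zero. -/
lemma insertSign_swap {j l : Fin n} {τ : Finset (Fin n)} (hj : j ∉ τ) (hl : l ∉ τ) (h : j ≠ l) :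
    insertSign S j τ * insertSign S l (insert j τ) =
      - (insertSign S l τ * insertSign S j (insert l τ)) := by
  rcases lt_or_gt_of_ne h with h | h
  · rw [insertSign_insert_of_lt hj h, insertSign_insert_of_le h.le]; ring
  · rw [insertSign_insert_of_lt hl h, insertSign_insert_of_le h.le]; ring

variable {M : Type*} [AddCommGroup M] [Module S M]

/-- The operator `(g τ)_τ ↦ (∑_{j ∉ τ} ± w_j g (τ ∪ {j}))_τ`. -/
def setDiff (M : Type*) [AddCommGroup M] [Module S M] (w : Fin n → S) :
    (Finset (Fin n) → M) →ₗ[S] (Finset (Fin n) → M) :=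
  LinearMap.pi fun τ => ∑ j ∈ τᶜ, (insertSign S j τ * w j) • LinearMap.proj (insert j τ)

lemma setDiff_apply (w : Fin n → S) (g : Finset (Fin n) → M) (τ : Finset (Fin n)) :
    setDiff M w g τ = ∑ j ∈ τᶜ, (insertSign S j τ * w j) • g (insert j τ) := by
  simp [setDiff]

/-- The terms indexed by (j, l) and (l, j) carry the same weight and the same set τ ∪ {j, l}, and
cancel by `insertSign_swap`. -/
lemma setDiff_setDiff (w : Fin n → S) (g : Finset (Fin n) → M) :
    setDiff M w (setDiff M w g) = 0 := by
  funext τ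
  simp only [setDiff_apply, Finset.smul_sum, smul_smul, Pi.zero_apply]
  rw [Finset.sum_sigma']
  refine Finset.sum_involution (fun x _ => ⟨x.2, x.1⟩) ?_ ?_ ?_ ?_
  · rintro ⟨j, l⟩ h
    simp only [Finset.mem_sigma, Finset.mem_compl, Finset.mem_insert, not_or] at h
    obtain ⟨hj, hlj, hl⟩ := h
    rw [Finset.insert_comm j l, ← add_smul]
    convert zero_smul S _
    linear_combination (w j * w l) * insertSign_swap (S := S) hj hl (Ne.symm hlj)
  · rintro ⟨j, l⟩ h _ he
    simp only [Finset.mem_sigma, Finset.mem_compl, Finset.mem_insert, not_or] at h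
    exact h.2.1 (congrArg Sigma.fst he)
  · rintro ⟨j, l⟩ h
    simp only [Finset.mem_sigma, Finset.mem_compl, Finset.mem_insert, not_or] at h ⊢
    exact ⟨h.2.2, fun e => h.2.1 e.symm, h.1⟩
  · rintro ⟨j, l⟩ h
    rfl

end SetDifferential

/-! ### Division by the smallest variable and the contraction -/

section Contraction

variable (k : Type u) [Field k] {n : ℕ}

/-- The `k`-linear operator that divides by `x_v` the monomials whose smallest variable is `x_v`
and kills all other monomials. -/
def divLeast (v : Fin n) : Poly k n →ₗ[k] Poly k n :=
  (MvPolynomial.basisMonomials (Fin n) k).constr k fun c =>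
    if c v ≠ 0 ∧ ∀ l < v, c l = 0 then MvPolynomial.monomial (c - Finsupp.single v (1 : ℕ)) 1 else 0

variable {k}

lemma divLeast_monomial (v : Fin n) (c : Fin n →₀ ℕ) :
    divLeast k v (MvPolynomial.monomial c 1) =
      if c v ≠ 0 ∧ ∀ l < v, c l = 0 then MvPolynomial.monomial (c - Finsupp.single v (1 : ℕ)) 1
      else 0 := by
  have := (MvPolynomial.basisMonomials (Fin n) k).constr_basis k (fun c =>
    if c v ≠ 0 ∧ ∀ l < v, c l = 0 then
      (MvPolynomial.monomial (c - Finsupp.single v (1 : ℕ)) 1 : Poly k n) else 0) c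
  simpa [divLeast] using this

lemma X_mul_monomial (j : Fin n) (c : Fin n →₀ ℕ) :
    (MvPolynomial.X j * MvPolynomial.monomial c 1 : Poly k n) =
      MvPolynomial.monomial (c + Finsupp.single j (1 : ℕ)) 1 := by
  rw [mul_comm, MvPolynomial.X, MvPolynomial.monomial_mul, mul_one]

/-- Two `k`-linear maps on polynomials that agree on monomials are equal. -/
lemma poly_induction {M : Type*} [AddCommGroup M] [Module k M] {φ ψ : Poly k n →ₗ[k] M}
    (h : ∀ c, φ (MvPolynomial.monomial c 1) = ψ (MvPolynomial.monomial c 1)) (s : Poly k n) :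
    φ s = ψ s := by
  refine LinearMap.congr_fun ((MvPolynomial.basisMonomials (Fin n) k).ext fun c => ?_) s
  simpa using h c

/-- After multiplication by x_j the smallest variable has index at most j, hence is not x_v. -/
lemma divLeast_X_mul_of_lt {j v : Fin n} (h : j < v) (s : Poly k n) :
    divLeast k v (MvPolynomial.X j * s) = 0 := by
  refine poly_induction (φ := (divLeast k v).comp (LinearMap.mulLeft k (MvPolynomial.X j)))
    (ψ := 0) (fun c => ?_) s
  simp only [LinearMap.comp_apply, LinearMap.mulLeft_apply, X_mul_monomial, divLeast_monomial,
    LinearMap.zero_apply]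
  rw [if_neg]
  rintro ⟨_, h2⟩
  have := h2 j h
  simp at this

/-- Multiplication by x_j with j > v changes neither the exponent of x_v nor those of smaller
variables, so the test in `divLeast` has the same outcome. -/
lemma divLeast_X_mul_of_gt {j v : Fin n} (h : v < j) (s : Poly k n) :
    divLeast k v (MvPolynomial.X j * s) = MvPolynomial.X j * divLeast k v s := by
  refine poly_induction (φ := (divLeast k v).comp (LinearMap.mulLeft k (MvPolynomial.X j)))
    (ψ := (LinearMap.mulLeft k (MvPolynomial.X j)).comp (divLeast k v)) (fun c => ?_) s
  simp only [LinearMap.comp_apply, LinearMap.mulLeft_apply, X_mul_monomial, divLeast_monomial]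
  have h1 : (c + Finsupp.single j (1 : ℕ)) v = c v := by simp [h.ne']
  have h2 : (∀ l < v, (c + Finsupp.single j (1 : ℕ)) l = 0) ↔ ∀ l < v, c l = 0 := by
    refine forall₂_congr fun l hl => ?_
    simp [(hl.trans h).ne']
  simp only [h1, h2]
  split_ifs with hc
  · rw [X_mul_monomial]
    refine congrArg (fun e => MvPolynomial.monomial e (1 : k)) (Finsupp.ext fun l => ?_)
    rw [Finsupp.tsub_apply, Finsupp.add_apply, Finsupp.add_apply, Finsupp.tsub_apply]
    by_cases hlv : l = v
    · subst hlv; simp [h.ne']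
    · simp [Ne.symm hlv]
  · simp

lemma X_mul_divLeast_monomial (v : Fin n) (c : Fin n →₀ ℕ) :
    MvPolynomial.X v * divLeast k v (MvPolynomial.monomial c 1) =
      if c v ≠ 0 ∧ ∀ l < v, c l = 0 then (MvPolynomial.monomial c 1 : Poly k n) else 0 := by
  rw [divLeast_monomial]
  split_ifs with h
  · rw [X_mul_monomial, tsub_add_cancel_of_le]
    rw [Finsupp.single_le_iff]; omega
  · simp

/-- Once x_v has been multiplied in, only the absence of smaller variables remains to be tested; the
composite is the projection to polynomials in the x_l with l ≥ v. -/
lemma divLeast_X_mul_monomial (v : Fin n) (c : Fin n →₀ ℕ) :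
    divLeast k v (MvPolynomial.X v * MvPolynomial.monomial c 1) =
      if ∀ l < v, c l = 0 then (MvPolynomial.monomial c 1 : Poly k n) else 0 := by
  rw [X_mul_monomial, divLeast_monomial]
  have h2 : ((c + Finsupp.single v (1 : ℕ)) v ≠ 0 ∧ ∀ l < v, (c + Finsupp.single v (1 : ℕ)) l = 0) ↔
      ∀ l < v, c l = 0 := by
    simp only [Finsupp.add_apply, Finsupp.single_eq_same]
    refine (and_iff_right (by omega)).trans (forall₂_congr fun l hl => ?_)
    simp [hl.ne']
  simp only [h2, add_tsub_cancel_right]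

/-- At most one variable is the smallest one of a monomial. -/
lemma sum_least {M : Type*} [AddCommMonoid M] (c : Fin n →₀ ℕ) (A : Finset (Fin n)) (x : M) :
    (∑ j ∈ A, if c j ≠ 0 ∧ ∀ l < j, c l = 0 then x else 0) =
      if ∃ j ∈ A, c j ≠ 0 ∧ ∀ l < j, c l = 0 then x else 0 := by
  split_ifs with h
  · obtain ⟨j, hj, hj1, hj2⟩ := h
    rw [Finset.sum_eq_single_of_mem j hj, if_pos ⟨hj1, hj2⟩]
    intro l _ hl
    rw [if_neg]
    rintro ⟨h1, h2⟩
    rcases lt_or_gt_of_ne hl with h | h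
    · exact h1 (hj2 l h)
    · exact hj1 (h2 j h)
  · exact Finset.sum_eq_zero fun j hj => if_neg fun hh => h ⟨j, hj, hh⟩

lemma exists_least {c : Fin n →₀ ℕ} {v : Fin n} (h : c v ≠ 0) :
    ∃ j ≤ v, c j ≠ 0 ∧ ∀ l < j, c l = 0 := by
  induction v using WellFoundedLT.induction with
  | ind v ih =>
    by_cases h' : ∀ l < v, c l = 0
    · exact ⟨v, le_rfl, h, h'⟩
    · push Not at h'
      obtain ⟨l, hl, hcl⟩ := h'
      obtain ⟨j, hj, hj'⟩ := ih l hl hcl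
      exact ⟨j, hj.trans hl.le, hj'⟩

/-- A monomial involves some variable below x_v, and then exactly one summand returns it, or it
involves none, and then the last term does. -/
lemma sum_X_mul_divLeast_add (v : Fin n) (s : Poly k n) :
    (∑ j ∈ Finset.univ.filter (· < v), MvPolynomial.X j * divLeast k j s) +
      divLeast k v (MvPolynomial.X v * s) = s := by
  have key := poly_induction (φ := (∑ j ∈ Finset.univ.filter (· < v),
    (LinearMap.mulLeft k (MvPolynomial.X j)).comp (divLeast k j)) +
      (divLeast k v).comp (LinearMap.mulLeft k (MvPolynomial.X v))) (ψ := LinearMap.id)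
      (fun c => ?_) s
  · simpa only [LinearMap.add_apply, LinearMap.sum_apply, LinearMap.comp_apply,
      LinearMap.mulLeft_apply, LinearMap.id_apply] using key
  simp only [LinearMap.add_apply, LinearMap.sum_apply, LinearMap.comp_apply,
    LinearMap.mulLeft_apply, LinearMap.id_apply, X_mul_divLeast_monomial,
    divLeast_X_mul_monomial, sum_least]
  by_cases h : ∀ l < v, c l = 0
  · rw [if_pos h, if_neg, zero_add]
    rintro ⟨j, hj, hj1, _⟩
    exact hj1 (h j (by simpa using hj))
  · rw [if_neg h, if_pos, add_zero]
    push Not at h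
    obtain ⟨l, hl, hcl⟩ := h
    obtain ⟨j, hj, hj'⟩ := exists_least hcl
    exact ⟨j, by simpa using hj.trans_lt hl, hj'⟩

/-- Every nonconstant monomial has exactly one smallest variable; the constant one has none and is
restored separately. -/
lemma sum_X_mul_divLeast (s : Poly k n) :
    (∑ j, MvPolynomial.X j * divLeast k j s) + MvPolynomial.C (MvPolynomial.constantCoeff s) =
      s := by
  have key := poly_induction (φ := (∑ j,
    (LinearMap.mulLeft k (MvPolynomial.X j)).comp (divLeast k j)) +
      (MvPolynomial.monomial 0).comp (MvPolynomial.lcoeff k 0)) (ψ := LinearMap.id)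
      (fun c => ?_) s
  · simpa only [LinearMap.add_apply, LinearMap.sum_apply, LinearMap.comp_apply,
      LinearMap.mulLeft_apply, LinearMap.id_apply, MvPolynomial.lcoeff_apply, MvPolynomial.constantCoeff_eq,
      MvPolynomial.C_apply] using key
  simp only [LinearMap.add_apply, LinearMap.sum_apply, LinearMap.comp_apply,
    LinearMap.mulLeft_apply, LinearMap.id_apply, X_mul_divLeast_monomial, sum_least,
    MvPolynomial.lcoeff_apply, MvPolynomial.coeff_monomial]
  by_cases h : c = 0
  · subst h; simp
  · rw [if_neg h, if_pos, map_zero, add_zero]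
    obtain ⟨l, hl⟩ := DFunLike.ne_iff.mp h
    obtain ⟨j, hj, hj'⟩ := exists_least hl
    exact ⟨j, Finset.mem_univ _, hj'⟩

lemma insertSign_mul_smul (j : Fin n) (τ : Finset (Fin n)) (p q : Poly k n) :
    (insertSign (Poly k n) j τ * p) • q = insertSign k j τ • (p * q) := by
  rw [MvPolynomial.smul_eq_C_mul, smul_eq_mul, mul_assoc]
  simp [insertSign]

/-- The contracting homotopy of the Koszul complex. -/
def contraction (g : Finset (Fin n) → Poly k n) (τ : Finset (Fin n)) : Poly k n :=
  if h : τ.Nonempty then divLeast k (τ.min' h) (g (τ.erase (τ.min' h))) else 0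

lemma contraction_insert_min (g : Finset (Fin n) → Poly k n) {v : Fin n} {τ : Finset (Fin n)}
    (h : ∀ l ∈ τ, v < l) : contraction g (insert v τ) = divLeast k v (g τ) := by
  have hmin : (insert v τ).min' (Finset.insert_nonempty v τ) = v := by
    refine le_antisymm (Finset.min'_le _ _ (Finset.mem_insert_self _ _)) ?_
    refine Finset.le_min' _ _ _ fun y hy => ?_
    rcases Finset.mem_insert.mp hy with rfl | hy
    · exact le_rfl
    · exact (h y hy).le
  rw [contraction, dif_pos (Finset.insert_nonempty v τ), hmin,
    Finset.erase_insert fun hv => lt_irrefl _ (h v hv)]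

lemma setDiff_contraction_empty (g : Finset (Fin n) → Poly k n) :
    setDiff (Poly k n) (MvPolynomial.X (R := k)) (contraction g) ∅ +
      MvPolynomial.C (MvPolynomial.constantCoeff (g ∅)) = g ∅ := by
  rw [setDiff_apply]
  conv_rhs => rw [← sum_X_mul_divLeast (g ∅)]
  refine congrArg₂ (· + ·) (Finset.sum_congr Finset.compl_empty fun j _ => ?_) rfl
  have h : ∀ l ∈ (∅ : Finset (Fin n)), j < l := fun l hl => absurd hl (Finset.notMem_empty l)
  rw [contraction_insert_min g h, insertSign_eq_one fun l hl => (h l hl).le, one_mul, smul_eq_mul]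

/-- The homotopy identity ∂h + h∂ = id at a nonempty set with minimum v. The indices below v
contribute only through ∂h, the index v only through h∂, and the indices above v cancel; what is
left is `sum_X_mul_divLeast_add`. -/
lemma setDiff_contraction_insert (g : Finset (Fin n) → Poly k n) {v : Fin n}
    {τ : Finset (Fin n)} (h : ∀ l ∈ τ, v < l) :
    setDiff (Poly k n) (MvPolynomial.X (R := k)) (contraction g) (insert v τ) +
      contraction (setDiff (Poly k n) (MvPolynomial.X (R := k)) g) (insert v τ) =
        g (insert v τ) := by
  have hv : v ∉ τ := fun hv => lt_irrefl _ (h v hv)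
  obtain ⟨B, hB⟩ : ∃ B, B = (τᶜ).filter (v < ·) := ⟨_, rfl⟩
  have hsplit : (insert v τ)ᶜ = Finset.univ.filter (· < v) ∪ B := by
    ext l
    simp only [Finset.mem_compl, Finset.mem_insert, Finset.mem_union, hB, Finset.mem_filter,
      Finset.mem_univ, true_and, not_or]
    constructor
    · rintro ⟨h1, h2⟩
      rcases lt_or_gt_of_ne h1 with h3 | h3
      · exact Or.inl h3
      · exact Or.inr ⟨h2, h3⟩
    · rintro (h1 | ⟨h1, h2⟩)
      · exact ⟨h1.ne, fun h3 => lt_asymm h1 (h l h3)⟩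
      · exact ⟨h2.ne', h1⟩
  have hsplit' : τᶜ = insert v (Finset.univ.filter (· < v) ∪ B) := by
    rw [← hsplit, Finset.compl_insert, Finset.insert_erase (by simpa using hv)]
  have hnotMem : v ∉ Finset.univ.filter (· < v) ∪ B := by simp [hB]
  have hdisj : Disjoint (Finset.univ.filter (· < v)) (B) := by
    rw [Finset.disjoint_left]
    intro l h1 h2
    exact lt_asymm (Finset.mem_filter.mp h1).2 (Finset.mem_filter.mp (hB ▸ h2)).2
  rw [contraction_insert_min _ h, setDiff_apply, setDiff_apply, hsplit, hsplit', map_sum,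
    Finset.sum_insert hnotMem, Finset.sum_union hdisj, Finset.sum_union hdisj]
  simp only [insertSign_mul_smul, map_smul]
  -- An index j < v becomes the new minimum, so the contraction divides by x_j and the sign is 1.
  have e1 : (∑ j ∈ Finset.univ.filter (· < v), insertSign k j (insert v τ) •
      (MvPolynomial.X j * contraction g (insert j (insert v τ)))) =
      ∑ j ∈ Finset.univ.filter (· < v), MvPolynomial.X j * divLeast k j (g (insert v τ)) := by
    refine Finset.sum_congr rfl fun j hj => ?_
    have hj' : j < v := (Finset.mem_filter.mp hj).2
    have hlt : ∀ l ∈ insert v τ, j < l := by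
      intro l hl
      rcases Finset.mem_insert.mp hl with rfl | hl
      · exact hj'
      · exact hj'.trans (h l hl)
    rw [contraction_insert_min g hlt, insertSign_eq_one fun l hl => (hlt l hl).le, one_smul]
  have e2 : (∑ j ∈ Finset.univ.filter (· < v), insertSign k j τ •
      divLeast k v (MvPolynomial.X j * g (insert j τ))) = 0 :=
    Finset.sum_eq_zero fun j hj => by
      rw [divLeast_X_mul_of_lt (Finset.mem_filter.mp hj).2, smul_zero]
  -- For j > v the minimum remains v and multiplication by x_j commutes with `divLeast`; the
  -- presence of v below j accounts for the opposite sign.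
  have e3 : (∑ j ∈ B, insertSign k j (insert v τ) •
      (MvPolynomial.X j * contraction g (insert j (insert v τ)))) =
      - ∑ j ∈ B, insertSign k j τ •
      divLeast k v (MvPolynomial.X j * g (insert j τ)) := by
    rw [← Finset.sum_neg_distrib]
    refine Finset.sum_congr rfl fun j hj => ?_
    have hj' : v < j := (Finset.mem_filter.mp (hB ▸ hj)).2
    rw [Finset.insert_comm, contraction_insert_min g, divLeast_X_mul_of_gt hj',
      insertSign_insert_of_lt hv hj', neg_smul]
    intro l hl
    rcases Finset.mem_insert.mp hl with rfl | hl
    · exact hj'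
    · exact h l hl
  rw [e1, e2, e3, insertSign_eq_one fun l hl => (h l hl).le, one_smul]
  conv_rhs => rw [← sum_X_mul_divLeast_add v (g (insert v τ))]
  abel

end Contraction

/-! ### Multigraded pieces of free modules -/

section FreeMultidegree

variable {k : Type u} [Field k] {n : ℕ} {ι : Type*} (deg : ι → Fin n →₀ ℕ)

lemma single_monomial_mem_freeMultidegree (e : ι) (m : Fin n →₀ ℕ) (r : k) :
    Finsupp.single e (MvPolynomial.monomial m r) ∈ freeMultidegree k deg (m + deg e) := by
  classical
  intro e' m' hm'
  by_cases h : e = e'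
  · subst h
    rw [Finsupp.single_eq_same] at hm'
    rw [Finset.mem_singleton.mp (MvPolynomial.support_monomial_subset hm')]
  · rw [Finsupp.single_eq_of_ne' h] at hm'
    simp at hm'

lemma freeMultidegree_eq_span (a : Fin n →₀ ℕ) :
    freeMultidegree k deg a = Submodule.span k
      {f | ∃ e m, m + deg e = a ∧ f = Finsupp.single e (MvPolynomial.monomial m (1 : k))} := by
  apply le_antisymm
  · intro f hf
    rw [← Finsupp.sum_single f]
    refine Submodule.sum_mem _ fun e _ => ?_
    have : Finsupp.single e (f e) = ∑ m ∈ (f e).support, (f e).coeff m •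
        Finsupp.single e (MvPolynomial.monomial m (1 : k)) := by
      conv_lhs => rw [MvPolynomial.as_sum (f e)]
      rw [← Finsupp.singleAddHom_apply, map_sum]
      refine Finset.sum_congr rfl fun m _ => ?_
      rw [Finsupp.singleAddHom_apply, Finsupp.smul_single, MvPolynomial.smul_monomial, smul_eq_mul,
        mul_one]
    rw [this]
    refine Submodule.sum_mem _ fun m hm => Submodule.smul_mem _ _ (Submodule.subset_span ?_)
    exact ⟨e, m, hf e m hm, rfl⟩
  · rw [Submodule.span_le]
    rintro _ ⟨e, m, rfl, rfl⟩
    exact single_monomial_mem_freeMultidegree deg e m 1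

/-- The projection of a multigraded free module onto a component. -/
def freeProj (a : Fin n →₀ ℕ) : (ι →₀ Poly k n) →ₗ[k] (ι →₀ Poly k n) :=
  Finsupp.lsum k fun e => (MvPolynomial.basisMonomials (Fin n) k).constr k fun m =>
    if m + deg e = a then Finsupp.single e (MvPolynomial.monomial m (1 : k)) else 0

lemma freeProj_single_monomial (a : Fin n →₀ ℕ) (e : ι) (m : Fin n →₀ ℕ) :
    freeProj (k := k) deg a (Finsupp.single e (MvPolynomial.monomial m 1)) =
      if m + deg e = a then Finsupp.single e (MvPolynomial.monomial m (1 : k)) else 0 := by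
  have := (MvPolynomial.basisMonomials (Fin n) k).constr_basis k (fun m =>
    if m + deg e = a then Finsupp.single e (MvPolynomial.monomial m (1 : k)) else 0) m
  rw [MvPolynomial.coe_basisMonomials] at this
  rw [freeProj, Finsupp.lsum_single]
  exact this

lemma freeProj_of_mem {a a' : Fin n →₀ ℕ} {f : ι →₀ Poly k n}
    (hf : f ∈ freeMultidegree k deg a') : freeProj deg a f = if a' = a then f else 0 := by
  rw [freeMultidegree_eq_span] at hf
  induction hf using Submodule.span_induction with
  | mem x hx =>
    obtain ⟨e, m, rfl, rfl⟩ := hx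
    exact freeProj_single_monomial deg a e m
  | zero => simp
  | add x y _ _ hx hy => rw [map_add, hx, hy]; split_ifs <;> simp
  | smul c x _ hx => rw [map_smul, hx]; split_ifs <;> simp

lemma free_linearMap_ext {M : Type*} [AddCommGroup M] [Module k M]
    {φ ψ : (ι →₀ Poly k n) →ₗ[k] M}
    (h : ∀ e m, φ (Finsupp.single e (MvPolynomial.monomial m 1)) =
      ψ (Finsupp.single e (MvPolynomial.monomial m 1))) : φ = ψ := by
  refine Finsupp.lhom_ext' fun e => LinearMap.ext fun s => ?_
  exact poly_induction (φ := φ.comp (Finsupp.lsingle e)) (ψ := ψ.comp (Finsupp.lsingle e)) (h e) s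

lemma freeProj_mem (a : Fin n →₀ ℕ) (f : ι →₀ Poly k n) :
    freeProj deg a f ∈ freeMultidegree k deg a := by
  -- Membership is phrased as the vanishing of a linear map, which can be tested on monomials.
  have : (freeMultidegree k deg a).mkQ.comp (freeProj deg a) = 0 := by
    refine free_linearMap_ext fun e m => ?_
    rw [LinearMap.comp_apply, LinearMap.zero_apply, freeProj_single_monomial,
      Submodule.mkQ_apply, Submodule.Quotient.mk_eq_zero]
    split_ifs with h
    · rw [← h]; exact single_monomial_mem_freeMultidegree deg e m 1
    · exact Submodule.zero_mem _
  have := LinearMap.congr_fun this f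
  rwa [LinearMap.comp_apply, LinearMap.zero_apply, Submodule.mkQ_apply,
    Submodule.Quotient.mk_eq_zero] at this

/-- On a monomial multiple of a basis element both sides equal its image under `d`, or both are
zero, according to whether its degree is `a`. -/
lemma freeProj_comm {ι' : Type*} (deg' : ι' → Fin n →₀ ℕ)
    (d : (ι →₀ Poly k n) →ₗ[k] (ι' →₀ Poly k n))
    (hd : ∀ b, ∀ f ∈ freeMultidegree k deg b, d f ∈ freeMultidegree k deg' b)
    (a : Fin n →₀ ℕ) (f : ι →₀ Poly k n) : freeProj deg' a (d f) = d (freeProj deg a f) := by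
  refine LinearMap.congr_fun (f := (freeProj deg' a).comp d) (g := d.comp (freeProj deg a))
    (free_linearMap_ext fun e m => ?_) f
  rw [LinearMap.comp_apply, LinearMap.comp_apply,
    freeProj_of_mem deg' (hd _ _ (single_monomial_mem_freeMultidegree deg e m 1)),
    freeProj_single_monomial]
  split_ifs <;> simp

/-- An `S`-linear map sending basis elements to elements of their multidegree is homogeneous. -/
lemma homogeneous_of_basis {ι' : Type*} (deg' : ι' → Fin n →₀ ℕ)
    (φ : (ι →₀ Poly k n) →ₗ[Poly k n] (ι' →₀ Poly k n))
    (h : ∀ e, φ (Finsupp.single e 1) ∈ freeMultidegree k deg' (deg e)) (b : Fin n →₀ ℕ) :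
    ∀ f ∈ freeMultidegree k deg b, φ f ∈ freeMultidegree k deg' b := by
  classical
  intro f hf
  rw [freeMultidegree_eq_span] at hf
  induction hf using Submodule.span_induction with
  | zero => rw [map_zero]; exact Submodule.zero_mem _
  | add x y _ _ hx hy => rw [map_add]; exact Submodule.add_mem _ hx hy
  | smul c x _ hx =>
    have : φ (c • x) = c • φ x := (φ.restrictScalars k).map_smul c x
    rw [this]; exact Submodule.smul_mem _ _ hx
  | mem x hx =>
    obtain ⟨e, m, rfl, rfl⟩ := hx
    have : Finsupp.single e (MvPolynomial.monomial m (1 : k)) =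
        (MvPolynomial.monomial m (1 : k)) • Finsupp.single e (1 : Poly k n) := by
      rw [Finsupp.smul_single, smul_eq_mul, mul_one]
    rw [this, map_smul]
    intro e' m' hm'
    rw [Finsupp.smul_apply, smul_eq_mul] at hm'
    obtain ⟨m1, h1, m2, h2, rfl⟩ := Finset.mem_add.mp (MvPolynomial.support_mul _ _ hm')
    rw [Finset.mem_singleton.mp (MvPolynomial.support_monomial_subset h1), add_assoc,
      h e e' m2 h2]

end FreeMultidegree

/-! ### Comparison of multigraded resolutions -/

namespace MultigradedFreeResolution

variable {k : Type u} [Field k] {n : ℕ}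

/-- The kernel of the augmentation or of the differential, as a set. -/
def IsCycle (F : MultigradedFreeResolution.{u, v} k n) :
    ∀ p, (F.basis p →₀ Poly k n) → Prop
  | 0, x => F.aug x = 0
  | p + 1, x => F.d p x = 0

variable (F G : MultigradedFreeResolution.{u, v} k n)

lemma isCycle_iff (p : ℕ) (x : F.basis p →₀ Poly k n) : F.IsCycle p x ↔ ∃ y, F.d p y = x := by
  cases p with
  | zero => exact F.exact_zero x
  | succ p => exact F.exact_succ p x

lemma isCycle_d (p : ℕ) (y : F.basis (p + 1) →₀ Poly k n) : F.IsCycle p (F.d p y) :=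
  (F.isCycle_iff p _).mpr ⟨y, rfl⟩

/-- A homogeneous cycle is the boundary of a homogeneous element. -/
lemma exists_homogeneous (p : ℕ) (a : Fin n →₀ ℕ) (x : F.basis p →₀ Poly k n)
    (hx : x ∈ freeMultidegree k (F.deg p) a) (h : F.IsCycle p x) :
    ∃ y ∈ freeMultidegree k (F.deg (p + 1)) a, F.d p y = x := by
  obtain ⟨y, rfl⟩ := (F.isCycle_iff p x).mp h
  -- The component of degree `a` of any preimage is still a preimage, because the differential
  -- commutes with the projections.
  refine ⟨freeProj (F.deg (p + 1)) a y, freeProj_mem _ a y, ?_⟩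
  have := freeProj_comm (F.deg (p + 1)) (F.deg p) ((F.d p).restrictScalars k)
    (F.d_homogeneous p) a y
  rw [LinearMap.restrictScalars_apply, LinearMap.restrictScalars_apply] at this
  rw [← this, freeProj_of_mem _ hx, if_pos rfl]

/-- A multigraded map that maps cycles to cycles. -/
def IsLift (p : ℕ) (φ : (F.basis p →₀ Poly k n) →ₗ[Poly k n] (G.basis p →₀ Poly k n)) : Prop :=
  (∀ b, ∀ f ∈ freeMultidegree k (F.deg p) b, φ f ∈ freeMultidegree k (G.deg p) b) ∧
    ∀ x, F.IsCycle p x → G.IsCycle p (φ x)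

lemma single_one_mem (p : ℕ) (e : F.basis p) :
    Finsupp.single e (1 : Poly k n) ∈ freeMultidegree k (F.deg p) (F.deg p e) := by
  simpa using single_monomial_mem_freeMultidegree (F.deg p) e 0 (1 : k)

/-- The target k lives in degree 0: a basis element of nonzero degree augments to zero and may be
sent to 0, while for degree 0 the degree 0 component of any preimage serves. -/
lemma exists_lift_zero : ∃ φ : (F.basis 0 →₀ Poly k n) →ₗ[Poly k n] (G.basis 0 →₀ Poly k n),
    F.IsLift G 0 φ ∧ ∀ x, G.aug (φ x) = F.aug x := by
  have h : ∀ e : F.basis 0, ∃ y ∈ freeMultidegree k (G.deg 0) (F.deg 0 e),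
      G.aug y = F.aug (Finsupp.single e 1) := by
    intro e
    by_cases he : F.deg 0 e = 0
    · obtain ⟨y, hy⟩ := G.aug_surjective (F.aug (Finsupp.single e 1))
      refine ⟨freeProj (G.deg 0) (F.deg 0 e) y, freeProj_mem _ _ y, ?_⟩
      rw [← hy, he]
      -- Viewed as a k-linear map, the augmentation can be compared on monomials with its composite
      -- with the projection to degree 0.
      let augk : (G.basis 0 →₀ Poly k n) →ₗ[k] k :=
        { toFun := G.aug
          map_add' := map_add G.aug
          map_smul' := fun c x => by
            rw [← algebraMap_smul (Poly k n) c x, G.aug.map_smulₛₗ]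
            simp [MvPolynomial.algebraMap_eq] }
      refine LinearMap.congr_fun (f := augk.comp (freeProj (G.deg 0) 0)) (g := augk)
        (free_linearMap_ext fun e m => ?_) y
      rw [LinearMap.comp_apply, freeProj_single_monomial]
      split_ifs with hm
      · rfl
      · rw [map_zero]
        exact (G.aug_homogeneous _ hm _
          (single_monomial_mem_freeMultidegree (G.deg 0) e m 1)).symm
    · exact ⟨0, Submodule.zero_mem _, by
        rw [map_zero, F.aug_homogeneous _ he _ (F.single_one_mem 0 e)]⟩
  choose y hy1 hy2 using h
  have haug : ∀ x, G.aug (Finsupp.linearCombination (Poly k n) y x) = F.aug x := by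
    intro x
    induction x using Finsupp.induction_linear with
    | zero => simp
    | add x x' hx hx' => rw [map_add, map_add, map_add, hx, hx']
    | single e s =>
      rw [Finsupp.linearCombination_single, G.aug.map_smulₛₗ, hy2, ← F.aug.map_smulₛₗ,
        Finsupp.smul_single, smul_eq_mul, mul_one]
  refine ⟨Finsupp.linearCombination (Poly k n) y, ⟨homogeneous_of_basis _ _ _ fun e => ?_, ?_⟩,
    haug⟩
  · rw [Finsupp.linearCombination_single, one_smul]; exact hy1 e
  · intro x hx
    exact (haug x).trans hx

/-- The element φ(d e) is a homogeneous cycle, hence by exactness the boundary of a homogeneous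
element, which is taken as the image of e. -/
lemma exists_lift_succ (p : ℕ) (φ) (hφ : F.IsLift G p φ) :
    ∃ φ' : (F.basis (p + 1) →₀ Poly k n) →ₗ[Poly k n] (G.basis (p + 1) →₀ Poly k n),
    F.IsLift G (p + 1) φ' ∧ ∀ x, G.d p (φ' x) = φ (F.d p x) := by
  have h : ∀ e, ∃ y ∈ freeMultidegree k (G.deg (p + 1)) (F.deg (p + 1) e),
      G.d p y = φ (F.d p (Finsupp.single e 1)) := fun e =>
    G.exists_homogeneous p _ _
      (hφ.1 _ _ (F.d_homogeneous p _ _ (F.single_one_mem (p + 1) e)))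
      (hφ.2 _ (F.isCycle_d p _))
  choose y hy1 hy2 using h
  have hcomm : (G.d p).comp (Finsupp.linearCombination (Poly k n) y) = φ.comp (F.d p) := by
    refine Finsupp.lhom_ext' fun e => LinearMap.ext_ring ?_
    simp [hy2]
  refine ⟨Finsupp.linearCombination (Poly k n) y, ⟨homogeneous_of_basis _ _ _ fun e => ?_, ?_⟩,
    LinearMap.congr_fun hcomm⟩
  · rw [Finsupp.linearCombination_single, one_smul]; exact hy1 e
  · intro x hx
    have hx' : F.d p x = 0 := hx
    change G.d p _ = 0
    rw [← LinearMap.comp_apply, hcomm, LinearMap.comp_apply, hx', map_zero]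

/-- Multigraded resolutions admit multigraded comparison maps. -/
theorem exists_comparison :
    ∃ φ : ∀ p, (F.basis p →₀ Poly k n) →ₗ[Poly k n] (G.basis p →₀ Poly k n),
      (∀ p b, ∀ f ∈ freeMultidegree k (F.deg p) b, φ p f ∈ freeMultidegree k (G.deg p) b) ∧
      (∀ x, G.aug (φ 0 x) = F.aug x) ∧
      ∀ p x, φ p (F.d p x) = G.d p (φ (p + 1) x) := by
  obtain ⟨φ0, h0, haug⟩ := F.exists_lift_zero G
  -- The recursion carries along homogeneity and preservation of cycles, which are what the next
  -- lift requires.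
  let Φ : ∀ p, {φ // F.IsLift G p φ} := fun p =>
    Nat.rec ⟨φ0, h0⟩ (fun p φ => ⟨(F.exists_lift_succ G p φ.1 φ.2).choose,
      (F.exists_lift_succ G p φ.1 φ.2).choose_spec.1⟩) p
  exact ⟨fun p => (Φ p).1, fun p => (Φ p).2.1, haug, fun p x =>
    ((F.exists_lift_succ G p (Φ p).1 (Φ p).2).choose_spec.2 x).symm⟩

/-- A chain map that is zero on the augmentations is null-homotopic. -/
theorem exists_homotopy
    (χ : ∀ p, (F.basis p →₀ Poly k n) →ₗ[Poly k n] (G.basis p →₀ Poly k n))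
    (haug : ∀ x, G.aug (χ 0 x) = 0)
    (hχ : ∀ p x, χ p (F.d p x) = G.d p (χ (p + 1) x)) :
    ∃ h : ∀ p, (F.basis p →₀ Poly k n) →ₗ[Poly k n] (G.basis (p + 1) →₀ Poly k n),
      (χ 0 = (G.d 0).comp (h 0)) ∧
        ∀ p, χ (p + 1) = (G.d (p + 1)).comp (h (p + 1)) + (h p).comp (F.d p) := by
  -- No multidegrees are tracked for the homotopy: equality in a graded piece of homology is tested
  -- in the whole homology, where an arbitrary boundary suffices.
  have hzero : ∃ h : (F.basis 0 →₀ Poly k n) →ₗ[Poly k n] (G.basis 1 →₀ Poly k n),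
      χ 0 = (G.d 0).comp h := by
    have h : ∀ e, ∃ y, G.d 0 y = χ 0 (Finsupp.single e 1) := fun e =>
      (G.isCycle_iff 0 _).mp (haug _)
    choose y hy using h
    refine ⟨Finsupp.linearCombination (Poly k n) y, Finsupp.lhom_ext' fun e =>
      LinearMap.ext_ring ?_⟩
    simp [hy]
  -- On each basis element e the difference χ(e) - h(d e) is a cycle, so exactness supplies its
  -- preimage.
  have hsucc : ∀ p (h : (F.basis p →₀ Poly k n) →ₗ[Poly k n] (G.basis (p + 1) →₀ Poly k n)),
      (∀ x, F.IsCycle p x → G.d p (h x) = χ p x) →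
      ∃ h' : (F.basis (p + 1) →₀ Poly k n) →ₗ[Poly k n] (G.basis (p + 1 + 1) →₀ Poly k n),
        χ (p + 1) = (G.d (p + 1)).comp h' + h.comp (F.d p) := by
    intro p h hh
    have h : ∀ e, ∃ y, G.d (p + 1) y =
        χ (p + 1) (Finsupp.single e 1) - h (F.d p (Finsupp.single e 1)) := fun e => by
      refine (G.isCycle_iff (p + 1) _).mp ?_
      change G.d p _ = 0
      rw [map_sub, ← hχ, hh _ (F.isCycle_d p _), sub_self]
    choose y hy using h
    refine ⟨Finsupp.linearCombination (Poly k n) y, Finsupp.lhom_ext' fun e =>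
      LinearMap.ext_ring ?_⟩
    simp [hy]
  -- On cycles the term h ∘ d vanishes; this restores the hypothesis of `hsucc` one degree higher.
  have hcyc : ∀ p (h : (F.basis p →₀ Poly k n) →ₗ[Poly k n] (G.basis (p + 1) →₀ Poly k n))
      (h' : (F.basis (p + 1) →₀ Poly k n) →ₗ[Poly k n] (G.basis (p + 1 + 1) →₀ Poly k n)),
      χ (p + 1) = (G.d (p + 1)).comp h' + h.comp (F.d p) →
      ∀ x, F.IsCycle (p + 1) x → G.d (p + 1) (h' x) = χ (p + 1) x := by
    intro p h h' hh x hx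
    have hx' : F.d p x = 0 := hx
    rw [hh, LinearMap.add_apply, LinearMap.comp_apply, LinearMap.comp_apply, hx', map_zero,
      add_zero]
  obtain ⟨h0, hh0⟩ := hzero
  let H : ∀ p, {h : (F.basis p →₀ Poly k n) →ₗ[Poly k n] (G.basis (p + 1) →₀ Poly k n) //
      ∀ x, F.IsCycle p x → G.d p (h x) = χ p x} := fun p =>
    Nat.rec ⟨h0, fun x _ => by rw [hh0]; rfl⟩ (fun p h => ⟨(hsucc p h.1 h.2).choose,
      hcyc p _ _ (hsucc p h.1 h.2).choose_spec⟩) p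
  exact ⟨fun p => (H p).1, hh0, fun p => (hsucc p (H p).1 (H p).2).choose_spec⟩

end MultigradedFreeResolution

/-! ### Independence of `Tor` from the resolution -/

section TorComparison

variable {k : Type u} [Field k] {n : ℕ} (F G : MultigradedFreeResolution.{u, v} k n)

/-- The map `φ ⊗ k[Δ]`. -/
def torLift (Δ : PreAbstractSimplicialComplex (Fin n)) (p : ℕ)
    (φ : (F.basis p →₀ Poly k n) →ₗ[Poly k n] (G.basis p →₀ Poly k n)) :
    TorChains F Δ p →ₗ[Poly k n] TorChains G Δ p :=
  φ.rTensor (SR k Δ)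

lemma torLift_comp (H : MultigradedFreeResolution.{u, v} k n)
    (Δ : PreAbstractSimplicialComplex (Fin n)) (p : ℕ)
    (ψ : (G.basis p →₀ Poly k n) →ₗ[Poly k n] (H.basis p →₀ Poly k n))
    (φ : (F.basis p →₀ Poly k n) →ₗ[Poly k n] (G.basis p →₀ Poly k n)) (x : TorChains F Δ p) :
    torLift F H Δ p (ψ.comp φ) x = torLift G H Δ p ψ (torLift F G Δ p φ x) :=
  LinearMap.congr_fun (LinearMap.rTensor_comp (SR k Δ) ψ φ) x

lemma torLift_diff (Δ : PreAbstractSimplicialComplex (Fin n))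
    (φ : ∀ p, (F.basis p →₀ Poly k n) →ₗ[Poly k n] (G.basis p →₀ Poly k n))
    (h : ∀ p x, φ p (F.d p x) = G.d p (φ (p + 1) x)) (p : ℕ) (x : TorChains F Δ (p + 1)) :
    torLift F G Δ p (φ p) (torDiff F Δ p x) = torDiff G Δ p (torLift F G Δ (p + 1) (φ (p + 1)) x) := by
  have h' : (φ p).comp (F.d p) = (G.d p).comp (φ (p + 1)) := LinearMap.ext (h p)
  have := congrArg (LinearMap.rTensor (SR k Δ)) h'
  rw [LinearMap.rTensor_comp, LinearMap.rTensor_comp] at this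
  exact LinearMap.congr_fun this x

lemma torLift_mem (Δ : PreAbstractSimplicialComplex (Fin n)) (p : ℕ)
    (φ : (F.basis p →₀ Poly k n) →ₗ[Poly k n] (G.basis p →₀ Poly k n))
    (hφ : ∀ b, ∀ f ∈ freeMultidegree k (F.deg p) b, φ f ∈ freeMultidegree k (G.deg p) b)
    (b : Fin n →₀ ℕ) : ∀ x ∈ torChainsMultidegree F Δ p b,
      torLift F G Δ p φ x ∈ torChainsMultidegree G Δ p b := by
  intro x hx
  induction hx using Submodule.span_induction with
  | zero => rw [map_zero]; exact Submodule.zero_mem _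
  | add x y _ _ hx hy => rw [map_add]; exact Submodule.add_mem _ hx hy
  | smul c x _ hx =>
    have : torLift F G Δ p φ (c • x) = c • torLift F G Δ p φ x :=
      ((torLift F G Δ p φ).restrictScalars k).map_smul c x
    rw [this]; exact Submodule.smul_mem _ _ hx
  | mem x hx =>
    obtain ⟨a, c, f, s, hab, hf, hs, rfl⟩ := hx
    exact Submodule.subset_span ⟨a, c, φ f, s, hab, hφ a f hf, hs, rfl⟩

lemma torLift_torChainsMap {Δ' Δ : PreAbstractSimplicialComplex (Fin n)} (h : Δ' ≤ Δ) (p : ℕ)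
    (φ : (F.basis p →₀ Poly k n) →ₗ[Poly k n] (G.basis p →₀ Poly k n)) (x : TorChains F Δ p) :
    torLift F G Δ' p φ (torChainsMap F h p x) = torChainsMap G h p (torLift F G Δ p φ x) := by
  have := LinearMap.lTensor_comp_rTensor (F.basis p →₀ Poly k n) φ (srProj (k := k) h)
  rw [← LinearMap.rTensor_comp_lTensor] at this
  exact (LinearMap.congr_fun this x).symm

/-- A comparison map of a resolution with itself induces the identity on `Tor`. -/
lemma homologyMap_torLift_self (Δ : PreAbstractSimplicialComplex (Fin n))
    (φ : ∀ p, (F.basis p →₀ Poly k n) →ₗ[Poly k n] (F.basis p →₀ Poly k n))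
    (haug : ∀ x, F.aug (φ 0 x) = F.aug x)
    (h : ∀ p x, φ p (F.d p x) = F.d p (φ (p + 1) x)) (p : ℕ)
    (x : cycles (C := TorChains F Δ) (torDiff F Δ) p) :
    torLift F F Δ p (φ p) x.1 - x.1 ∈ LinearMap.range (torDiff F Δ p) := by
  -- The difference φ - id augments to zero, so it is null-homotopic, and tensoring with k[Δ]
  -- preserves the homotopy.
  obtain ⟨η, h0, hs⟩ := F.exists_homotopy F (fun p => φ p - LinearMap.id)
    (fun x => by simp [haug]) (fun p x => by simp [h])
  have hx : torLift F F Δ p (φ p) x.1 - x.1 = (φ p - LinearMap.id).rTensor (SR k Δ) x.1 := by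
    rw [LinearMap.rTensor_sub, LinearMap.rTensor_id]; rfl
  rw [hx]
  cases p with
  | zero =>
    rw [h0, LinearMap.rTensor_comp]
    exact ⟨(η 0).rTensor (SR k Δ) x.1, rfl⟩
  | succ p =>
    have key : ∀ y : (F.basis (p + 1) →₀ Poly k n) ⊗[Poly k n] SR k Δ,
        (F.d p).rTensor (SR k Δ) y = 0 →
        (F.d (p + 1)).rTensor (SR k Δ) ((η (p + 1)).rTensor (SR k Δ) y) =
          (φ (p + 1) - LinearMap.id).rTensor (SR k Δ) y := by
      intro y hy
      rw [hs, LinearMap.rTensor_add, LinearMap.rTensor_comp, LinearMap.rTensor_comp,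
        LinearMap.add_apply, LinearMap.comp_apply, LinearMap.comp_apply, hy, map_zero, add_zero]
    exact ⟨(η (p + 1)).rTensor (SR k Δ) x.1, key x.1 x.2⟩

/-- The component of multidegree `b` of `Tor_p`, `p` a natural number. -/
abbrev torNatPiece (Δ : PreAbstractSimplicialComplex (Fin n)) (p : ℕ) (b : Fin n →₀ ℕ) :
    Submodule k (TorModule F Δ p) :=
  homologyPiece (C := TorChains F Δ) k (torDiff F Δ) p (torChainsMultidegree F Δ p b)

/-- The map between components of `Tor_p` for an inclusion of complexes. -/
abbrev torNatPieceMap {Δ' Δ : PreAbstractSimplicialComplex (Fin n)} (h : Δ' ≤ Δ) (p : ℕ)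
    (b : Fin n →₀ ℕ) : torNatPiece F Δ p b →ₗ[k] torNatPiece F Δ' p b :=
  homologyPieceMap (C := TorChains F Δ) (C' := TorChains F Δ') k (torChainsMap F h)
    (torChainsMap_diff F h) p (torChainsMultidegree F Δ p b) (torChainsMultidegree F Δ' p b)
    (torChainsMap_mem F h p b)

/-- The components of `Tor` do not depend on the resolution, naturally in the complex. -/
theorem exists_torNatPieceEquiv (p : ℕ) (b : Fin n →₀ ℕ) :
    ∃ τ : ∀ Δ : PreAbstractSimplicialComplex (Fin n),
        torNatPiece F Δ p b ≃ₗ[k] torNatPiece G Δ p b,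
      ∀ (Δ' Δ : PreAbstractSimplicialComplex (Fin n)) (h : Δ' ≤ Δ) (t : torNatPiece F Δ p b),
        τ Δ' (torNatPieceMap F h p b t) = torNatPieceMap G h p b (τ Δ t) := by
  obtain ⟨φ, hφ, φaug, φd⟩ := F.exists_comparison G
  obtain ⟨ψ, hψ, ψaug, ψd⟩ := G.exists_comparison F
  let Φ := fun Δ => homologyPieceMap (C := TorChains F Δ) (C' := TorChains G Δ) k
    (fun p => torLift F G Δ p (φ p)) (torLift_diff F G Δ φ φd) p
    (torChainsMultidegree F Δ p b) (torChainsMultidegree G Δ p b)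
    (torLift_mem F G Δ p (φ p) (hφ p) b)
  let Ψ := fun Δ => homologyPieceMap (C := TorChains G Δ) (C' := TorChains F Δ) k
    (fun p => torLift G F Δ p (ψ p)) (torLift_diff G F Δ ψ ψd) p
    (torChainsMultidegree G Δ p b) (torChainsMultidegree F Δ p b)
    (torLift_mem G F Δ p (ψ p) (hψ p) b)
  -- The maps are mutually inverse because each composite comes from a comparison map of one
  -- resolution with itself.
  refine ⟨fun Δ => LinearEquiv.ofLinearMap (Φ Δ) (Ψ Δ) ?_ ?_, ?_⟩
  · refine LinearMap.ext ?_
    rintro ⟨_, x, hx, rfl⟩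
    refine Subtype.ext ((Submodule.Quotient.eq _).mpr ?_)
    have := homologyMap_torLift_self G Δ (fun p => (φ p).comp (ψ p))
      (fun x => by simp [φaug, ψaug]) (fun p x => by simp [φd, ψd]) p x
    rw [torLift_comp G F G] at this
    exact this
  · refine LinearMap.ext ?_
    rintro ⟨_, x, hx, rfl⟩
    refine Subtype.ext ((Submodule.Quotient.eq _).mpr ?_)
    have := homologyMap_torLift_self F Δ (fun p => (ψ p).comp (φ p))
      (fun x => by simp [φaug, ψaug]) (fun p x => by simp [φd, ψd]) p x
    rw [torLift_comp F G F] at this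
    exact this
  · rintro Δ' Δ h ⟨_, x, hx, rfl⟩
    refine Subtype.ext (congrArg Submodule.Quotient.mk (Subtype.ext ?_))
    exact torLift_torChainsMap F G h p (φ p) x.1

end TorComparison

/-! ### The Koszul resolution -/

section KoszulResolution

variable (k : Type u) [Field k] {n : ℕ}

/-- The sets with `p` elements, in a prescribed universe. -/
abbrev SetOfCard (n p : ℕ) : Type v := ULift.{v} {τ : Finset (Fin n) // τ.card = p}

/-- Extension by zero to all sets. -/
def extendByZero (p : ℕ) :
    (SetOfCard.{v} n p →₀ Poly k n) →ₗ[Poly k n] (Finset (Fin n) → Poly k n) :=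
  LinearMap.pi fun τ => if h : τ.card = p then Finsupp.lapply ⟨⟨τ, h⟩⟩ else 0

/-- Restriction to the sets with `p` elements. -/
def restrictToCard (p : ℕ) :
    (Finset (Fin n) → Poly k n) →ₗ[Poly k n] (SetOfCard.{v} n p →₀ Poly k n) :=
  (Finsupp.linearEquivFunOnFinite (Poly k n) (Poly k n) (SetOfCard.{v} n p)).symm.toLinearMap.comp
    (LinearMap.pi fun τ => LinearMap.proj τ.down.1)

variable {k}

lemma extendByZero_of_card {p : ℕ} (f : SetOfCard.{v} n p →₀ Poly k n) {τ : Finset (Fin n)}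
    (h : τ.card = p) : extendByZero k p f τ = f ⟨⟨τ, h⟩⟩ := by
  simp [extendByZero, h]

lemma extendByZero_of_card_ne {p : ℕ} (f : SetOfCard.{v} n p →₀ Poly k n) {τ : Finset (Fin n)}
    (h : τ.card ≠ p) : extendByZero k p f τ = 0 := by
  simp [extendByZero, h]

lemma restrictToCard_apply (p : ℕ) (g : Finset (Fin n) → Poly k n) (τ : SetOfCard.{v} n p) :
    restrictToCard k p g τ = g τ.down.1 := rfl

lemma extendByZero_restrictToCard {p : ℕ} {g : Finset (Fin n) → Poly k n}
    (hg : ∀ τ, τ.card ≠ p → g τ = 0) : extendByZero k p (restrictToCard.{u, v} k p g) = g := by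
  funext τ
  by_cases h : τ.card = p
  · rw [extendByZero_of_card _ h, restrictToCard_apply]
  · rw [extendByZero_of_card_ne _ h, hg τ h]

lemma extendByZero_injective (p : ℕ) :
    Function.Injective (extendByZero.{u, v} (n := n) k p) := by
  intro f g h
  ext1 τ
  rw [← extendByZero_of_card f τ.down.2, h, extendByZero_of_card]

variable (k)

/-- The differential of the Koszul complex of the variables. -/
def koszulResDiff (p : ℕ) :
    (SetOfCard.{v} n (p + 1) →₀ Poly k n) →ₗ[Poly k n] (SetOfCard.{v} n p →₀ Poly k n) :=
  (restrictToCard k p).comp ((setDiff (Poly k n) (MvPolynomial.X (R := k))).comp (extendByZero k (p + 1)))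

variable {k}

lemma setDiff_of_card_ne {p : ℕ} {g : Finset (Fin n) → Poly k n}
    (hg : ∀ τ, τ.card ≠ p + 1 → g τ = 0) (τ : Finset (Fin n)) (hτ : τ.card ≠ p) :
    setDiff (Poly k n) (MvPolynomial.X (R := k)) g τ = 0 := by
  rw [setDiff_apply]
  refine Finset.sum_eq_zero fun j hj => ?_
  rw [hg, smul_zero]
  rw [Finset.card_insert_of_notMem (by simpa using hj)]
  omega

lemma extendByZero_koszulResDiff (p : ℕ) (f : SetOfCard.{v} n (p + 1) →₀ Poly k n) :
    extendByZero k p (koszulResDiff k p f) =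
      setDiff (Poly k n) (MvPolynomial.X (R := k)) (extendByZero k (p + 1) f) := by
  exact extendByZero_restrictToCard
    (setDiff_of_card_ne fun τ hτ => extendByZero_of_card_ne f hτ)

lemma contraction_of_card_ne {p : ℕ} {g : Finset (Fin n) → Poly k n}
    (hg : ∀ τ, τ.card ≠ p → g τ = 0) (τ : Finset (Fin n)) (hτ : τ.card ≠ p + 1) :
    contraction g τ = 0 := by
  rw [contraction]
  split_ifs with h
  · rw [hg, map_zero]
    rw [Finset.card_erase_of_mem (Finset.min'_mem _ _)]
    have := h.card_pos
    omega
  · rfl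

lemma contraction_zero : contraction (0 : Finset (Fin n) → Poly k n) = 0 := by
  funext τ
  simp [contraction]

/-- If g is a cycle, the homotopy identity becomes ∂(hg) = g, so the contraction provides the
preimage. -/
lemma koszulRes_exact_succ (p : ℕ) : Function.Exact (koszulResDiff.{u, v} (n := n) k (p + 1))
    (koszulResDiff.{u, v} (n := n) k p) := by
  intro f
  constructor
  · intro hf
    have hg : setDiff (Poly k n) (MvPolynomial.X (R := k)) (extendByZero k (p + 1) f) = 0 := by
      rw [← extendByZero_koszulResDiff, hf, map_zero]
    refine ⟨restrictToCard k (p + 1 + 1) (contraction (extendByZero k (p + 1) f)), ?_⟩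
    apply extendByZero_injective
    rw [extendByZero_koszulResDiff, extendByZero_restrictToCard
      (contraction_of_card_ne fun τ hτ => extendByZero_of_card_ne f hτ)]
    funext τ
    -- The identity at ∅ has an extra constant term; here it vanishes because the family is
    -- supported on sets with p + 1 ≥ 1 elements.
    rcases τ.eq_empty_or_nonempty with rfl | h
    · have := setDiff_contraction_empty (extendByZero k (p + 1) f)
      rwa [extendByZero_of_card_ne f (τ := ∅) (by simp), map_zero, map_zero, add_zero] at this
    · have := setDiff_contraction_insert (extendByZero k (p + 1) f) (v := τ.min' h)
        (τ := τ.erase (τ.min' h)) (fun l hl => Finset.min'_lt_of_mem_erase_min' τ h hl)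
      rwa [hg, contraction_zero, Finset.insert_erase (Finset.min'_mem _ _), Pi.zero_apply,
        add_zero] at this
  · rintro ⟨g, rfl⟩
    apply extendByZero_injective
    rw [extendByZero_koszulResDiff, extendByZero_koszulResDiff, setDiff_setDiff, map_zero]

variable (k n)

/-- The augmentation of the Koszul complex. -/
def koszulResAug : (SetOfCard.{v} n 0 →₀ Poly k n)
    →ₛₗ[(MvPolynomial.constantCoeff : Poly k n →+* k)] k where
  toFun f := MvPolynomial.constantCoeff (f ⟨⟨∅, rfl⟩⟩)
  map_add' f g := by simp
  map_smul' c f := by simp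

variable {k n}

/-- At ∅ the contraction recovers g(∅) up to its constant term, which is the augmentation.
Conversely, every summand of a boundary at ∅ is divisible by a variable. -/
lemma koszulRes_exact_zero :
    Function.Exact (koszulResDiff.{u, v} (n := n) k 0) (koszulResAug.{u, v} k n) := by
  intro f
  constructor
  · intro hf
    have hf' : MvPolynomial.constantCoeff (extendByZero k 0 f ∅) = 0 := hf
    refine ⟨restrictToCard k 1 (contraction (extendByZero k 0 f)), ?_⟩
    apply extendByZero_injective
    rw [extendByZero_koszulResDiff, extendByZero_restrictToCard
      (contraction_of_card_ne fun τ hτ => extendByZero_of_card_ne f hτ)]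
    funext τ
    rcases τ.eq_empty_or_nonempty with rfl | h
    · have := setDiff_contraction_empty (extendByZero k 0 f)
      rwa [hf', map_zero, add_zero] at this
    · rw [setDiff_of_card_ne (contraction_of_card_ne fun τ hτ => extendByZero_of_card_ne f hτ) τ
        h.card_pos.ne', extendByZero_of_card_ne _ h.card_pos.ne']
  · rintro ⟨g, rfl⟩
    change MvPolynomial.constantCoeff (setDiff (Poly k n) (MvPolynomial.X (R := k)) (extendByZero k 1 g) ∅) = 0
    rw [setDiff_apply, map_sum]
    exact Finset.sum_eq_zero fun j _ => by simp

lemma sqfreeDegree_insert {j : Fin n} {τ : Finset (Fin n)} (h : j ∉ τ) :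
    sqfreeDegree (insert j τ) = Finsupp.single j 1 + sqfreeDegree τ := by
  rw [sqfreeDegree, Finset.sum_insert h]; rfl

lemma koszulResDiff_homogeneous (p : ℕ) (b : Fin n →₀ ℕ) :
    ∀ f ∈ freeMultidegree k (fun τ : SetOfCard.{v} n (p + 1) => sqfreeDegree τ.down.1) b,
      koszulResDiff k p f ∈
        freeMultidegree k (fun τ : SetOfCard.{v} n p => sqfreeDegree τ.down.1) b := by
  classical
  intro f hf τ m hm
  change m ∈ (setDiff (Poly k n) (MvPolynomial.X (R := k)) (extendByZero k (p + 1) f) τ.down.1).support at hm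
  rw [setDiff_apply] at hm
  obtain ⟨j, hj, hm⟩ := Finset.mem_biUnion.mp (MvPolynomial.support_sum hm)
  have hj' : j ∉ τ.down.1 := by simpa using hj
  have hcard : (insert j τ.down.1).card = p + 1 := by
    rw [Finset.card_insert_of_notMem hj', τ.down.2]
  rw [insertSign_mul_smul, extendByZero_of_card f hcard] at hm
  have hm' := MvPolynomial.support_smul hm
  rw [MvPolynomial.support_X_mul] at hm'
  obtain ⟨m, h, rfl⟩ := Finset.mem_map.mp hm'
  have := hf _ m h
  rw [← this]
  change Finsupp.single j 1 + m + sqfreeDegree τ.down.1 = m + sqfreeDegree (insert j τ.down.1)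
  rw [sqfreeDegree_insert hj']
  abel

variable (k n)

/-- The Koszul complex as a multigraded free resolution of `k`. -/
abbrev koszulResolution : MultigradedFreeResolution.{u, v} k n where
  basis p := SetOfCard.{v} n p
  deg _ τ := sqfreeDegree τ.down.1
  d p := koszulResDiff k p
  aug := koszulResAug k n
  d_homogeneous p b := koszulResDiff_homogeneous p b
  aug_homogeneous b hb f hf := by
    -- A nonzero constant term puts the exponent 0 in the support at the basis element ∅, which has
    -- degree 0; this forces b = 0.
    by_contra h
    have h0 : (0 : Fin n →₀ ℕ) ∈ (f ⟨⟨∅, rfl⟩⟩).support := by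
      rw [MvPolynomial.mem_support_iff, ← MvPolynomial.constantCoeff_eq]
      exact h
    have := hf _ _ h0
    exact hb (by rw [← this]; simp [sqfreeDegree])
  aug_surjective c := ⟨Finsupp.single ⟨⟨∅, rfl⟩⟩ (MvPolynomial.C c), by simp [koszulResAug]⟩
  exact_zero := koszulRes_exact_zero
  exact_succ p := koszulRes_exact_succ p

end KoszulResolution

/-! ### Graded pieces of homology under a chain map that is bijective on graded terms -/

section GradedPiece

variable {R : Type*} [CommRing R] {k : Type*} [CommRing k] [Algebra k R]
  {C₁ C₀ : Type*} [AddCommGroup C₁] [Module R C₁] [Module k C₁] [IsScalarTower k R C₁]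
  [AddCommGroup C₀] [Module R C₀] [Module k C₀] [IsScalarTower k R C₀]
  {B₁ B₀ : Type*} [AddCommGroup B₁] [Module k B₁] [AddCommGroup B₀] [Module k B₀]

/-- A graded piece of `Z / im d` is computed by a chain map that is an isomorphism on the graded
pieces of the terms. -/
def gradedPieceEquiv (d : C₁ →ₗ[R] C₀) (Z : Submodule R C₀) (G₁ : Submodule k C₁)
    (G₀ : Submodule k C₀) (δ : B₁ →ₗ[k] B₀) (Z' : Submodule k B₀) (r₁ : C₁ →ₗ[k] B₁)
    (r₀ : C₀ →ₗ[k] B₀) (hr : ∀ y, r₀ (d y) = δ (r₁ y)) (hd : ∀ y ∈ G₁, d y ∈ G₀)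
    (hinj : ∀ x ∈ G₀, r₀ x = 0 → x = 0) (hsurj₁ : ∀ z, ∃ y ∈ G₁, r₁ y = z)
    (hsurj₀ : ∀ z, ∃ x ∈ G₀, r₀ x = z) (hZ : ∀ x ∈ Z, r₀ x ∈ Z')
    (hZ' : ∀ x ∈ G₀, r₀ x ∈ Z' → x ∈ Z) :
    subquotientPiece k Z (LinearMap.range d) G₀ ≃ₗ[k]
      (Z' ⧸ (LinearMap.range δ).submoduleOf Z') :=
  subquotientPieceEquiv Z (LinearMap.range d) G₀ Z' (LinearMap.range δ) r₀ hZ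
    (by rintro _ ⟨y, rfl⟩; exact ⟨r₁ y, (hr y).symm⟩)
    (by
      rintro x hx ⟨z, hz⟩
      -- Lifting the bounding element to `y` in `G₁` makes `x - d y` a graded element with zero
      -- image, so `x = d y`.
      obtain ⟨y, hy, rfl⟩ := hsurj₁ z
      refine ⟨y, ?_⟩
      rw [← sub_eq_zero, ← neg_sub, neg_eq_zero]
      exact hinj _ (Submodule.sub_mem _ hx (hd y hy)) (by rw [map_sub, hr, hz, sub_self]))
    (fun z hz => by
      obtain ⟨x, hx, rfl⟩ := hsurj₀ z
      exact ⟨x, hx, hZ' x hx hz, rfl⟩)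

end GradedPiece

/-! ### Simplicial chains as families indexed by finite sets -/

section Simplicial

variable {n : ℕ} (k : Type u) [Field k]

instance (Δ : PreAbstractSimplicialComplex (Fin n)) (m : ℕ) : Fintype (FaceOfCard Δ m) :=
  Fintype.ofFinite _

lemma isFace_restrict_iff {Δ : PreAbstractSimplicialComplex (Fin n)} {U σ : Finset (Fin n)} :
    IsFace (restrict Δ U) σ ↔ IsFace Δ σ ∧ σ ⊆ U := by
  constructor
  · rintro (rfl | ⟨h, hU⟩)
    · exact ⟨Or.inl rfl, Finset.empty_subset _⟩
    · exact ⟨Or.inr h, hU⟩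
  · rintro ⟨rfl | h, hU⟩
    · exact Or.inl rfl
    · exact Or.inr ⟨h, hU⟩

/-- Deleting v does not change the number of vertices below v, so the boundary sign is the sign of
inserting v into the opposite facet, as in `setDiff`. -/
lemma boundary_single (Δ : PreAbstractSimplicialComplex (Fin n)) (m : ℕ)
    (σ : FaceOfCard Δ (m + 1)) : boundary k Δ m (Finsupp.single σ 1) =
      ∑ v ∈ σ.1.attach, insertSign k v.1 (σ.1.erase v.1) •
        Finsupp.single (facet σ v) (1 : k) := by
  rw [boundary, Finsupp.linearCombination_single, one_smul]
  refine Finset.sum_congr rfl fun v _ => ?_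
  rw [insertSign, Finset.filter_erase, Finset.erase_eq_of_notMem (by simp)]

/-- Extension of a simplicial chain by zero to all sets. -/
def chainExtend (Δ : PreAbstractSimplicialComplex (Fin n)) (m : ℕ) :
    Chains k Δ m →ₗ[k] (Finset (Fin n) → k) :=
  Finsupp.lsum k fun σ => LinearMap.single k (fun _ : Finset (Fin n) => k) σ.1

variable {k}

lemma chainExtend_single (Δ : PreAbstractSimplicialComplex (Fin n)) (m : ℕ)
    (σ : FaceOfCard Δ m) (c : k) :
    chainExtend k Δ m (Finsupp.single σ c) = Pi.single σ.1 c := by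
  simp [chainExtend]

lemma chainExtend_apply {Δ : PreAbstractSimplicialComplex (Fin n)} {m : ℕ} (x : Chains k Δ m)
    (σ : FaceOfCard Δ m) : chainExtend k Δ m x σ.1 = x σ := by
  induction x using Finsupp.induction_linear with
  | zero => simp
  | add x y hx hy => simp [hx, hy]
  | single τ c =>
    rw [chainExtend_single, Pi.single_apply, Finsupp.single_apply]
    simp only [← Subtype.ext_iff, eq_comm]

lemma chainExtend_injective (Δ : PreAbstractSimplicialComplex (Fin n)) (m : ℕ) :
    Function.Injective (chainExtend k Δ m) := by
  intro x y h
  ext σ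
  rw [← chainExtend_apply, h, chainExtend_apply]

/-- Facets and insertions are inverse: τ = σ ∖ {j} with j ∈ σ means the same as τ ∪ {j} = σ with j ∉
τ. -/
lemma chainExtend_boundary (Δ : PreAbstractSimplicialComplex (Fin n)) (m : ℕ)
    (x : Chains k Δ (m + 1)) :
    chainExtend k Δ m (boundary k Δ m x) =
      setDiff k (fun _ => (1 : k)) (chainExtend k Δ (m + 1) x) := by
  refine LinearMap.congr_fun (f := (chainExtend k Δ m).comp (boundary k Δ m))
    (g := (setDiff k (fun _ => (1 : k))).comp (chainExtend k Δ (m + 1)))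
    (Finsupp.lhom_ext' fun σ => LinearMap.ext_ring ?_) x
  rw [LinearMap.comp_apply, LinearMap.comp_apply, LinearMap.comp_apply, LinearMap.comp_apply,
    Finsupp.lsingle_apply, boundary_single, map_sum, chainExtend_single]
  funext τ
  rw [setDiff_apply, Finset.sum_apply]
  simp only [map_smul, chainExtend_single, Pi.smul_apply, Pi.single_apply, mul_one, facet,
    smul_eq_mul, mul_ite, mul_zero]
  rw [Finset.sum_attach σ.1 fun v => if τ = σ.1.erase v then insertSign k v (σ.1.erase v) else 0,
    ← Finset.sum_filter, ← Finset.sum_filter]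
  refine Finset.sum_congr ?_ ?_
  · ext j
    simp only [Finset.mem_filter, Finset.mem_compl]
    constructor
    · rintro ⟨h, rfl⟩
      exact ⟨Finset.notMem_erase _ _, Finset.insert_erase h⟩
    · rintro ⟨h, h'⟩
      rw [← h', Finset.erase_insert h]
      exact ⟨Finset.mem_insert_self _ _, rfl⟩
  · intro j hj
    rw [Finset.mem_filter, Finset.mem_compl] at hj
    rw [← hj.2, Finset.erase_insert hj.1]

lemma boundary_boundary (Δ : PreAbstractSimplicialComplex (Fin n)) (m : ℕ)
    (x : Chains k Δ (m + 1 + 1)) : boundary k Δ m (boundary k Δ (m + 1) x) = 0 := by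
  apply chainExtend_injective
  rw [chainExtend_boundary, chainExtend_boundary, setDiff_setDiff, map_zero]

lemma coboundary_single (Δ : PreAbstractSimplicialComplex (Fin n)) (m : ℕ)
    (f : Module.Dual k (Chains k Δ m)) (σ : FaceOfCard Δ (m + 1)) :
    coboundary k Δ m f (Finsupp.single σ 1) =
      ∑ v ∈ σ.1.attach, insertSign k v.1 (σ.1.erase v.1) *
        f (Finsupp.single (facet σ v) (1 : k)) := by
  change f (boundary k Δ m (Finsupp.single σ 1)) = _
  rw [boundary_single, map_sum]
  exact Finset.sum_congr rfl fun v _ => map_smul f _ _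

end Simplicial

/-! ### Coordinates on `F ⊗ k[Δ]` -/

section TorCoordinates

variable {k : Type u} [Field k] {n : ℕ}

lemma sqfreeDegree_apply (σ : Finset (Fin n)) (j : Fin n) :
    sqfreeDegree σ j = if j ∈ σ then 1 else 0 := by
  classical
  simp [sqfreeDegree, Finsupp.finsetSum_apply, Finsupp.single_apply]

lemma sqfreeDegree_injective : Function.Injective (sqfreeDegree (n := n)) := by
  intro σ τ h
  ext j
  have := DFunLike.congr_fun h j
  rw [sqfreeDegree_apply, sqfreeDegree_apply] at this
  split_ifs at this <;> simp_all

lemma prod_X_eq_monomial (σ : Finset (Fin n)) :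
    (∏ j ∈ σ, MvPolynomial.X j : Poly k n) = MvPolynomial.monomial (sqfreeDegree σ) 1 := by
  rw [sqfreeDegree, MvPolynomial.monomial_sum_one]; rfl

lemma eq_sqfreeDegree_of_le {c : Fin n →₀ ℕ} {σ : Finset (Fin n)} (h : c ≤ sqfreeDegree σ) :
    c = sqfreeDegree c.support ∧ c.support ⊆ σ := by
  have h' : ∀ j, c j ≤ if j ∈ σ then 1 else 0 := fun j => by
    rw [← sqfreeDegree_apply]; exact h j
  constructor
  · ext j
    rw [sqfreeDegree_apply]
    have := h' j
    split_ifs at this ⊢ with h1 h2 h2 <;> simp_all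
    omega
  · intro j hj
    by_contra hσ
    have := h' j
    rw [if_neg hσ] at this
    exact (Finsupp.mem_support_iff.mp hj) (by omega)

/-- A multiple of a generator could contribute to x_σ only through divisors of x_σ. These are
square-free with support inside σ, hence again on faces, which is why σ is generalized in the
induction. -/
lemma coeff_eq_zero_of_mem_srIdeal {Δ : PreAbstractSimplicialComplex (Fin n)}
    {σ : Finset (Fin n)} (h : IsFace Δ σ) {s : Poly k n} (hs : s ∈ srIdeal k Δ) :
    MvPolynomial.coeff (sqfreeDegree σ) s = 0 := by
  rw [srIdeal] at hs
  induction hs using Submodule.span_induction generalizing σ with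
  | zero => simp
  | add x y _ _ hx hy => simp [hx h, hy h]
  | mem x hx =>
    obtain ⟨ρ, hρ, rfl⟩ := hx
    rw [prod_X_eq_monomial, MvPolynomial.coeff_monomial, if_neg]
    intro he
    exact hρ (sqfreeDegree_injective he ▸ h)
  | smul c x _ hx =>
    classical
    rw [smul_eq_mul, MvPolynomial.coeff_mul]
    refine Finset.sum_eq_zero fun q hq => ?_
    have hle : q.2 ≤ sqfreeDegree σ := by
      rw [← Finset.HasAntidiagonal.mem_antidiagonal.mp hq]; exact le_add_self
    obtain ⟨h1, h2⟩ := eq_sqfreeDegree_of_le hle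
    rw [h1, hx (h.subset h2), mul_zero]

variable (k)

/-- The coefficient of the square-free monomial `x_σ` on `k[Δ]`; zero if `σ` is not a face. -/
def srCoeff (Δ : PreAbstractSimplicialComplex (Fin n)) (σ : Finset (Fin n)) : SR k Δ →ₗ[k] k :=
  open Classical in
  if h : IsFace Δ σ then
    (Submodule.liftQ ((srIdeal k Δ).restrictScalars k) (MvPolynomial.lcoeff k (sqfreeDegree σ))
      fun _ hs => coeff_eq_zero_of_mem_srIdeal h hs).comp
      (Submodule.Quotient.restrictScalarsEquiv k (srIdeal k Δ)).symm.toLinearMap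
  else 0

variable {k}

lemma srCoeff_mk {Δ : PreAbstractSimplicialComplex (Fin n)} {σ : Finset (Fin n)}
    (h : IsFace Δ σ) (s : Poly k n) :
    srCoeff k Δ σ (Ideal.Quotient.mk _ s) = MvPolynomial.coeff (sqfreeDegree σ) s := by
  rw [srCoeff, dif_pos h]; rfl

/-- The variable x_j divides x_σ exactly when j ∈ σ, and the quotient is the monomial of a set that
is again a face. -/
lemma srCoeff_X_smul {Δ : PreAbstractSimplicialComplex (Fin n)} {σ : Finset (Fin n)}
    (h : IsFace Δ σ) (j : Fin n) (s : SR k Δ) :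
    srCoeff k Δ σ ((MvPolynomial.X j : Poly k n) • s) =
      if j ∈ σ then srCoeff k Δ (σ.erase j) s else 0 := by
  classical
  obtain ⟨s, rfl⟩ := Ideal.Quotient.mk_surjective s
  have : (MvPolynomial.X j : Poly k n) • Ideal.Quotient.mk (srIdeal k Δ) s =
      Ideal.Quotient.mk _ (MvPolynomial.X j * s) := rfl
  rw [this, srCoeff_mk h, srCoeff_mk (h.subset (Finset.erase_subset _ _)),
    MvPolynomial.coeff_X_mul']
  have hsupp : j ∈ (sqfreeDegree σ).support ↔ j ∈ σ := by
    rw [Finsupp.mem_support_iff, sqfreeDegree_apply]; simp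
  simp only [hsupp]
  split_ifs with hj
  · congr 1
    conv_lhs => rw [← Finset.insert_erase hj, sqfreeDegree_insert (Finset.notMem_erase _ _)]
    exact add_tsub_cancel_left _ _
  · rfl

lemma srCoeff_srProj {Δ' Δ : PreAbstractSimplicialComplex (Fin n)} (h : Δ' ≤ Δ)
    {σ : Finset (Fin n)} (hσ : IsFace Δ' σ) (s : SR k Δ) :
    srCoeff k Δ' σ (srProj h s) = srCoeff k Δ σ s := by
  obtain ⟨s, rfl⟩ := Ideal.Quotient.mk_surjective s
  rw [srCoeff_mk (hσ.mono h)]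
  exact srCoeff_mk hσ s

/-- The coordinate of an element of `F_p ⊗ k[Δ]` at a basis element. -/
def torCoord (F : MultigradedFreeResolution.{u, v} k n)
    (Δ : PreAbstractSimplicialComplex (Fin n)) (p : ℕ) (e : F.basis p) :
    TorChains F Δ p →ₗ[Poly k n] SR k Δ :=
  (TensorProduct.lid (Poly k n) (SR k Δ)).toLinearMap.comp
    (LinearMap.rTensor (SR k Δ) (Finsupp.lapply e))

lemma torChains_induction (F : MultigradedFreeResolution.{u, v} k n)
    (Δ : PreAbstractSimplicialComplex (Fin n)) (p : ℕ) {P : TorChains F Δ p → Prop}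
    (x : TorChains F Δ p) (hzero : P 0) (htmul : ∀ f s, P (torTmul F Δ p f s))
    (hadd : ∀ x y, P x → P y → P (x + y)) : P x :=
  TensorProduct.induction_on (motive := P) x hzero htmul hadd

/-- The coordinates of an element of `K_p ⊗ k[Δ]`, for the Koszul resolution `K`. -/
def koszulTorCoord (Δ : PreAbstractSimplicialComplex (Fin n)) (p : ℕ) :
    TorChains (koszulResolution.{u, v} k n) Δ p →ₗ[Poly k n] (Finset (Fin n) → SR k Δ) :=
  LinearMap.pi fun τ => if h : τ.card = p then
    torCoord (koszulResolution.{u, v} k n) Δ p ⟨⟨τ, h⟩⟩ else 0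

lemma koszulTorCoord_torTmul (Δ : PreAbstractSimplicialComplex (Fin n)) (p : ℕ) (f s)
    (τ : Finset (Fin n)) :
    koszulTorCoord Δ p (torTmul (koszulResolution.{u, v} k n) Δ p f s) τ =
      extendByZero.{u, v} k p f τ • s := by
  rw [koszulTorCoord, LinearMap.pi_apply, extendByZero, LinearMap.pi_apply]
  split_ifs
  · rfl
  · simp

lemma koszulTorCoord_torDiff (Δ : PreAbstractSimplicialComplex (Fin n)) (p : ℕ)
    (x : TorChains (koszulResolution.{u, v} k n) Δ (p + 1)) :
    koszulTorCoord Δ p (torDiff _ Δ p x) =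
      setDiff (SR k Δ) (MvPolynomial.X (R := k)) (koszulTorCoord Δ (p + 1) x) := by
  induction x using torChains_induction with
  | hzero => simp
  | hadd x y hx hy => simp only [map_add, hx, hy]
  | htmul f s =>
    funext τ
    change koszulTorCoord Δ p (torTmul _ Δ p (koszulResDiff k p f) s) τ = _
    rw [koszulTorCoord_torTmul, extendByZero_koszulResDiff, setDiff_apply, setDiff_apply,
      Finset.sum_smul]
    refine Finset.sum_congr rfl fun j _ => ?_
    rw [koszulTorCoord_torTmul, smul_assoc]

lemma koszulTorCoord_torChainsMap {Δ' Δ : PreAbstractSimplicialComplex (Fin n)} (h : Δ' ≤ Δ)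
    (p : ℕ) (x : TorChains (koszulResolution.{u, v} k n) Δ p) (τ : Finset (Fin n)) :
    koszulTorCoord Δ' p (torChainsMap _ h p x) τ = srProj h (koszulTorCoord Δ p x τ) := by
  induction x using torChains_induction with
  | hzero => simp
  | hadd x y hx hy => simp only [map_add, Pi.add_apply, hx, hy]
  | htmul f s =>
    change koszulTorCoord Δ' p (torTmul _ Δ' p f (srProj h s)) τ = _
    rw [koszulTorCoord_torTmul, koszulTorCoord_torTmul, map_smul]

lemma torDiff_mem (F : MultigradedFreeResolution.{u, v} k n)
    (Δ : PreAbstractSimplicialComplex (Fin n)) (p : ℕ) (b : Fin n →₀ ℕ) :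
    ∀ x ∈ torChainsMultidegree F Δ (p + 1) b, torDiff F Δ p x ∈ torChainsMultidegree F Δ p b := by
  intro x hx
  induction hx using Submodule.span_induction with
  | zero => rw [map_zero]; exact Submodule.zero_mem _
  | add x y _ _ hx hy => rw [map_add]; exact Submodule.add_mem _ hx hy
  | smul c x _ hx =>
    have : torDiff F Δ p (c • x) = c • torDiff F Δ p x :=
      ((torDiff F Δ p).restrictScalars k).map_smul c x
    rw [this]; exact Submodule.smul_mem _ _ hx
  | mem x hx =>
    obtain ⟨a, c, f, s, hab, hf, hs, rfl⟩ := hx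
    exact Submodule.subset_span ⟨a, c, F.d p f, s, hab, F.d_homogeneous p a f hf, hs, rfl⟩

end TorCoordinates

/-! ### `Tor` of the Koszul resolution and reduced cohomology -/

section Hochster

variable {k : Type u} [Field k] {n : ℕ}

/-- The sign relating the Koszul complex in degree `U` and the simplicial cochains. -/
def complementSign (k : Type u) [Field k] (U σ : Finset (Fin n)) : k :=
  ∏ j ∈ σ, insertSign k j U

lemma complementSign_mul_self (U σ : Finset (Fin n)) :
    complementSign k U σ * complementSign k U σ = 1 := by
  rw [complementSign, ← Finset.prod_mul_distrib]
  exact Finset.prod_eq_one fun j _ => insertSign_mul_self j U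

/-- The elements of U below j split into those outside σ and those in σ. -/
lemma insertSign_sdiff_mul {U σ : Finset (Fin n)} (h : σ ⊆ U) (j : Fin n) :
    insertSign k j (U \ σ) * insertSign k j σ = insertSign k j U := by
  rw [insertSign, insertSign, insertSign, ← pow_add]
  congr 1
  rw [← Finset.card_union_of_disjoint
    (Finset.disjoint_filter_filter Finset.sdiff_disjoint), ← Finset.filter_union,
    Finset.sdiff_union_of_subset h]

lemma insertSign_erase_self (j : Fin n) (σ : Finset (Fin n)) :
    insertSign k j (σ.erase j) = insertSign k j σ := by
  rw [insertSign, insertSign, Finset.filter_erase, Finset.erase_eq_of_notMem (by simp)]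

/-- The Koszul differential inserts j into U ∖ σ, while the coboundary inserts j into σ ∖ {j}. The
two signs differ by the factor `insertSign k j U`, which is precisely the factor of `complementSign`
belonging to j. -/
lemma complementSign_mul_insertSign {U σ : Finset (Fin n)} (h : σ ⊆ U) {j : Fin n}
    (hj : j ∈ σ) : complementSign k U σ * insertSign k j (U \ σ) =
      insertSign k j (σ.erase j) * complementSign k U (σ.erase j) := by
  rw [complementSign, ← Finset.mul_prod_erase σ _ hj, ← insertSign_sdiff_mul h j,
    insertSign_erase_self, complementSign]
  linear_combination (insertSign k j σ * ∏ l ∈ σ.erase j, insertSign k l U) *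
    insertSign_mul_self (S := k) j (U \ σ)

/-- The comparison of `K_p ⊗ k[Δ]` with the simplicial cochains of the restriction of `Δ` to `U`
on the faces with `m` vertices; meaningful for `p + m = #U`. -/
def torToCochain (Δ : PreAbstractSimplicialComplex (Fin n)) (U : Finset (Fin n)) (p m : ℕ) :
    TorChains (koszulResolution.{u, v} k n) Δ p →ₗ[k]
      Module.Dual k (Chains k (restrict Δ U) m) :=
  (Finsupp.llift k k k (FaceOfCard (restrict Δ U) m)).toLinearMap.comp
    (LinearMap.pi fun σ => complementSign k U σ.1 •
      ((srCoeff k Δ σ.1).comp (((LinearMap.proj (U \ σ.1)).comp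
        (koszulTorCoord Δ p)).restrictScalars k)))

lemma torToCochain_single (Δ : PreAbstractSimplicialComplex (Fin n)) (U : Finset (Fin n))
    (p m : ℕ) (x : TorChains (koszulResolution.{u, v} k n) Δ p)
    (σ : FaceOfCard (restrict Δ U) m) :
    torToCochain Δ U p m x (Finsupp.single σ 1) =
      complementSign k U σ.1 * srCoeff k Δ σ.1 (koszulTorCoord Δ p x (U \ σ.1)) := by
  simp [torToCochain]

lemma dual_ext {Δ : PreAbstractSimplicialComplex (Fin n)} {m : ℕ}
    {f g : Module.Dual k (Chains k Δ m)}
    (h : ∀ σ, f (Finsupp.single σ 1) = g (Finsupp.single σ 1)) : f = g :=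
  Finsupp.lhom_ext' fun σ => LinearMap.ext_ring (h σ)

/-- The coefficient of x_σ in x_j s is zero unless j ∈ σ, so at U ∖ σ the Koszul differential only
sees the facets of σ; `complementSign_mul_insertSign` matches the signs. -/
lemma torToCochain_torDiff (Δ : PreAbstractSimplicialComplex (Fin n)) (U : Finset (Fin n))
    (p m : ℕ) (x : TorChains (koszulResolution.{u, v} k n) Δ (p + 1)) :
    torToCochain Δ U p (m + 1) (torDiff _ Δ p x) =
      coboundary k (restrict Δ U) m (torToCochain Δ U (p + 1) m x) := by
  refine dual_ext fun σ => ?_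
  obtain ⟨hσ, hσU⟩ := isFace_restrict_iff.mp σ.2.1
  rw [torToCochain_single, koszulTorCoord_torDiff, coboundary_single, setDiff_apply, map_sum]
  have hterm : ∀ j, srCoeff k Δ σ.1 ((insertSign (Poly k n) j (U \ σ.1) * MvPolynomial.X j) •
      koszulTorCoord Δ (p + 1) x (insert j (U \ σ.1))) = insertSign k j (U \ σ.1) *
        if j ∈ σ.1 then srCoeff k Δ (σ.1.erase j)
          (koszulTorCoord Δ (p + 1) x (insert j (U \ σ.1))) else 0 := by
    intro j
    have h1 : ∀ s : SR k Δ, (insertSign (Poly k n) j (U \ σ.1) * MvPolynomial.X j) • s =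
        insertSign k j (U \ σ.1) • (MvPolynomial.X j : Poly k n) • s := by
      intro s
      rw [mul_smul, ← algebraMap_smul (Poly k n) (insertSign k j (U \ σ.1))]
      simp [insertSign]
    rw [h1, map_smul, srCoeff_X_smul hσ, smul_eq_mul]
  simp only [hterm, mul_ite, mul_zero]
  rw [← Finset.sum_filter, Finset.mul_sum]
  simp only [torToCochain_single, facet]
  rw [Finset.sum_attach σ.1 fun j => insertSign k j (σ.1.erase j) *
    (complementSign k U (σ.1.erase j) * srCoeff k Δ (σ.1.erase j)
      (koszulTorCoord Δ (p + 1) x (U \ (σ.1.erase j))))]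
  -- The indices outside U ∖ σ that lie in σ are just the elements of σ.
  refine Finset.sum_congr ?_ fun j hj => ?_
  · ext j
    simp only [Finset.mem_filter, Finset.mem_compl, Finset.mem_sdiff, not_and, not_not]
    exact ⟨fun h => h.2, fun h => ⟨fun _ => h, h⟩⟩
  · rw [Finset.sdiff_erase (hσU hj), ← mul_assoc, ← mul_assoc,
      complementSign_mul_insertSign hσU hj]

lemma torToCochain_torChainsMap {Δ' Δ : PreAbstractSimplicialComplex (Fin n)} (h : Δ' ≤ Δ)
    (U : Finset (Fin n)) (p m : ℕ) (x : TorChains (koszulResolution.{u, v} k n) Δ p) :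
    torToCochain Δ' U p m (torChainsMap _ h p x) =
      (chainsMap k (restrict_mono h U) m).dualMap (torToCochain Δ U p m x) := by
  refine dual_ext fun σ => ?_
  rw [LinearMap.dualMap_apply, chainsMap, Finsupp.lmapDomain_apply, Finsupp.mapDomain_single,
    torToCochain_single, torToCochain_single, koszulTorCoord_torChainsMap,
    srCoeff_srProj h (isFace_restrict_iff.mp σ.2.1).1]

/-- The generator `e_{U ∖ σ} ⊗ x_σ` of the component of degree `U` of `K_p ⊗ k[Δ]`. -/
def torGen (Δ : PreAbstractSimplicialComplex (Fin n)) {U : Finset (Fin n)} {p m : ℕ}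
    (hpm : p + m = U.card) (σ : FaceOfCard (restrict Δ U) m) :
    TorChains (koszulResolution.{u, v} k n) Δ p :=
  torTmul (koszulResolution.{u, v} k n) Δ p
    (Finsupp.single ⟨⟨U \ σ.1, by
      rw [Finset.card_sdiff_of_subset (isFace_restrict_iff.mp σ.2.1).2, σ.2.2]; omega⟩⟩ 1)
    (Ideal.Quotient.mk _ (MvPolynomial.monomial (sqfreeDegree σ.1) 1))

lemma sqfreeDegree_sdiff_add {U σ : Finset (Fin n)} (h : σ ⊆ U) :
    sqfreeDegree (U \ σ) + sqfreeDegree σ = sqfreeDegree U :=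
  Finset.sum_sdiff h

lemma torGen_mem (Δ : PreAbstractSimplicialComplex (Fin n)) {U : Finset (Fin n)} {p m : ℕ}
    (hpm : p + m = U.card) (σ : FaceOfCard (restrict Δ U) m) :
    torGen.{u, v} (k := k) Δ hpm σ ∈ torChainsMultidegree _ Δ p (sqfreeDegree U) :=
  Submodule.subset_span ⟨sqfreeDegree (U \ σ.1), sqfreeDegree σ.1, _, _,
    sqfreeDegree_sdiff_add (isFace_restrict_iff.mp σ.2.1).2,
    (koszulResolution.{u, v} k n).single_one_mem p _, Submodule.mem_span_singleton_self _, rfl⟩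

lemma torToCochain_torGen (Δ : PreAbstractSimplicialComplex (Fin n)) {U : Finset (Fin n)}
    {p m : ℕ} (hpm : p + m = U.card) (σ τ : FaceOfCard (restrict Δ U) m) :
    torToCochain Δ U p m (torGen.{u, v} (k := k) Δ hpm σ) (Finsupp.single τ 1) =
      if σ = τ then complementSign k U τ.1 else 0 := by
  classical
  have hcard : (U \ τ.1).card = p := by
    rw [Finset.card_sdiff_of_subset (isFace_restrict_iff.mp τ.2.1).2, τ.2.2]; omega
  rw [torToCochain_single, torGen, koszulTorCoord_torTmul, extendByZero_of_card _ hcard,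
    Finsupp.single_apply]
  split_ifs with h1 h2 h2
  · subst h2
    rw [one_smul, srCoeff_mk (isFace_restrict_iff.mp σ.2.1).1, MvPolynomial.coeff_monomial,
      if_pos rfl, mul_one]
  · refine absurd ?_ h2
    have h3 : U \ σ.1 = U \ τ.1 := congrArg (fun e => e.down.1) h1
    refine Subtype.ext ?_
    rw [← Finset.sdiff_sdiff_eq_self (isFace_restrict_iff.mp σ.2.1).2, h3,
      Finset.sdiff_sdiff_eq_self (isFace_restrict_iff.mp τ.2.1).2]
  · subst h2
    exact absurd rfl h1
  · rw [zero_smul, map_zero, mul_zero]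

/-- All polynomial coefficients of e_τ can be moved to the factor k[Δ], where the degree forces the
monomial x_{U∖τ}; it vanishes there when U ∖ τ is not a face. -/
lemma torChainsMultidegree_le_span (Δ : PreAbstractSimplicialComplex (Fin n))
    {U : Finset (Fin n)} {p m : ℕ} (hpm : p + m = U.card) :
    torChainsMultidegree (koszulResolution.{u, v} k n) Δ p (sqfreeDegree U) ≤
      Submodule.span k (Set.range (torGen.{u, v} (k := k) Δ hpm)) := by
  rw [torChainsMultidegree, Submodule.span_le]
  rintro _ ⟨a, c, f, s, hab, hf, hs, rfl⟩
  obtain ⟨r, rfl⟩ := Submodule.mem_span_singleton.mp hs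
  rw [freeMultidegree_eq_span] at hf
  let T : (SetOfCard.{v} n p →₀ Poly k n) →ₗ[k] TorChains (koszulResolution.{u, v} k n) Δ p :=
    ((TensorProduct.mk (Poly k n) (SetOfCard.{v} n p →₀ Poly k n) (SR k Δ)).flip
      (r • Ideal.Quotient.mk (srIdeal k Δ) (MvPolynomial.monomial c 1))).restrictScalars k
  change T f ∈ _
  induction hf using Submodule.span_induction with
  | zero => rw [map_zero]; exact Submodule.zero_mem _
  | add x y _ _ hx hy => rw [map_add]; exact Submodule.add_mem _ hx hy
  | smul c x _ hx => rw [map_smul]; exact Submodule.smul_mem _ _ hx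
  | mem x hx =>
    obtain ⟨τ, l, hl, rfl⟩ := hx
    change l + sqfreeDegree τ.down.1 = a at hl
    have hle : sqfreeDegree τ.down.1 ≤ sqfreeDegree U := by
      rw [← hab, ← hl, add_assoc, add_comm, add_assoc]; exact le_self_add
    have hτU : τ.down.1 ⊆ U := by
      intro j hj
      have := hle j
      rw [sqfreeDegree_apply, sqfreeDegree_apply, if_pos hj] at this
      by_contra hU
      rw [if_neg hU] at this
      omega
    -- The exponents l and c from the two tensor factors together fill the complement of τ in U.
    have hlc : l + c = sqfreeDegree (U \ τ.down.1) := by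
      have h1 := sqfreeDegree_sdiff_add hτU
      rw [← hab, ← hl] at h1
      apply add_right_cancel (b := sqfreeDegree τ.down.1)
      rw [h1]; abel
    have hT : T (Finsupp.single τ (MvPolynomial.monomial l 1)) =
        r • torTmul (koszulResolution.{u, v} k n) Δ p (Finsupp.single τ 1)
          (Ideal.Quotient.mk _ (MvPolynomial.monomial (sqfreeDegree (U \ τ.down.1)) 1)) := by
      have h1 : Finsupp.single τ (MvPolynomial.monomial l (1 : k)) =
        (MvPolynomial.monomial l (1 : k)) • Finsupp.single τ (1 : Poly k n) := by
        rw [Finsupp.smul_single, smul_eq_mul, mul_one]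
      have h2 : (MvPolynomial.monomial l (1 : k)) •
          (r • Ideal.Quotient.mk (srIdeal k Δ) (MvPolynomial.monomial c 1)) =
          r • Ideal.Quotient.mk _ (MvPolynomial.monomial (sqfreeDegree (U \ τ.down.1)) 1) := by
        rw [smul_comm, ← hlc]
        refine congrArg (r • ·) ?_
        change Ideal.Quotient.mk _ (MvPolynomial.monomial l 1 * MvPolynomial.monomial c 1) = _
        rw [MvPolynomial.monomial_mul, mul_one]
      change Finsupp.single τ (MvPolynomial.monomial l 1) ⊗ₜ[Poly k n] _ = _
      rw [h1, TensorProduct.smul_tmul, h2]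
      exact TensorProduct.tmul_smul r _ _
    rw [hT]
    refine Submodule.smul_mem _ _ ?_
    by_cases hface : IsFace Δ (U \ τ.down.1)
    -- The generator belongs to the face σ = U ∖ τ, and taking the complement again gives back τ.
    · refine Submodule.subset_span ⟨⟨U \ τ.down.1,
        isFace_restrict_iff.mpr ⟨hface, Finset.sdiff_subset⟩, ?_⟩, ?_⟩
      · rw [Finset.card_sdiff_of_subset hτU, τ.down.2]; omega
      · have : (⟨⟨U \ (U \ τ.down.1), by
            rw [Finset.sdiff_sdiff_eq_self hτU, τ.down.2]⟩⟩ : SetOfCard.{v} n p) = τ :=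
          ULift.ext _ _ (Subtype.ext (Finset.sdiff_sdiff_eq_self hτU))
        exact congrArg (fun e : SetOfCard.{v} n p =>
          torTmul (koszulResolution.{u, v} k n) Δ p (Finsupp.single e 1)
            (Ideal.Quotient.mk _ (MvPolynomial.monomial (sqfreeDegree (U \ τ.down.1)) 1))) this
    · have : Ideal.Quotient.mk (srIdeal k Δ)
          (MvPolynomial.monomial (sqfreeDegree (U \ τ.down.1)) 1) = 0 := by
        rw [Ideal.Quotient.eq_zero_iff_mem, ← prod_X_eq_monomial]
        exact Ideal.subset_span ⟨_, hface, rfl⟩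
      rw [this]
      convert Submodule.zero_mem _
      exact TensorProduct.tmul_zero _ _

lemma torToCochain_sum (Δ : PreAbstractSimplicialComplex (Fin n)) {U : Finset (Fin n)}
    {p m : ℕ} (hpm : p + m = U.card) (a : FaceOfCard (restrict Δ U) m → k)
    (τ : FaceOfCard (restrict Δ U) m) :
    torToCochain Δ U p m (∑ σ, a σ • torGen.{u, v} (k := k) Δ hpm σ) (Finsupp.single τ 1) =
      a τ * complementSign k U τ.1 := by
  rw [map_sum, LinearMap.sum_apply]
  simp only [map_smul, LinearMap.smul_apply, torToCochain_torGen, smul_eq_mul, mul_ite, mul_zero]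
  rw [Finset.sum_ite_eq' Finset.univ τ, if_pos (Finset.mem_univ τ)]

lemma torToCochain_injOn (Δ : PreAbstractSimplicialComplex (Fin n)) {U : Finset (Fin n)}
    {p m : ℕ} (hpm : p + m = U.card) (x : TorChains (koszulResolution.{u, v} k n) Δ p)
    (hx : x ∈ torChainsMultidegree _ Δ p (sqfreeDegree U)) (h : torToCochain Δ U p m x = 0) :
    x = 0 := by
  obtain ⟨a, rfl⟩ := (Submodule.mem_span_range_iff_exists_fun k).mp
    (torChainsMultidegree_le_span Δ hpm hx)
  refine Finset.sum_eq_zero fun σ _ => ?_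
  have h1 := torToCochain_sum Δ hpm a σ
  rw [h, LinearMap.zero_apply] at h1
  have h2 : a σ = 0 := by
    rw [← mul_one (a σ), ← complementSign_mul_self U σ.1, ← mul_assoc, ← h1, zero_mul]
  rw [h2, zero_smul]

lemma exists_torToCochain_eq (Δ : PreAbstractSimplicialComplex (Fin n)) {U : Finset (Fin n)}
    {p m : ℕ} (hpm : p + m = U.card) (f : Module.Dual k (Chains k (restrict Δ U) m)) :
    ∃ x ∈ torChainsMultidegree (koszulResolution.{u, v} k n) Δ p (sqfreeDegree U),
      torToCochain Δ U p m x = f := by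
  -- On the generators the comparison is diagonal with entries `complementSign`, each of which is
  -- its own inverse.
  refine ⟨∑ σ, (f (Finsupp.single σ 1) * complementSign k U σ.1) • torGen Δ hpm σ,
    Submodule.sum_mem _ fun σ _ => Submodule.smul_mem _ _ (torGen_mem Δ hpm σ),
    dual_ext fun τ => ?_⟩
  rw [torToCochain_sum, mul_assoc, complementSign_mul_self, mul_one]

lemma subsingleton_cochains (Δ : PreAbstractSimplicialComplex (Fin n)) {U : Finset (Fin n)}
    {m : ℕ} (h : U.card < m) : Subsingleton (Module.Dual k (Chains k (restrict Δ U) m)) := by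
  refine ⟨fun f g => dual_ext fun σ => ?_⟩
  have h1 := Finset.card_le_card (isFace_restrict_iff.mp σ.2.1).2
  rw [σ.2.2] at h1
  omega

/-- Hochster's formula for the Koszul resolution. -/
def koszulTorEquiv (Δ : PreAbstractSimplicialComplex (Fin n)) {U : Finset (Fin n)} {p m : ℕ}
    (hpm : p + (m + 1) = U.card) :
    torNatPiece (koszulResolution.{u, v} k n) Δ p (sqfreeDegree U) ≃ₗ[k]
      ReducedCohomology k (restrict Δ U) m :=
  gradedPieceEquiv (torDiff (koszulResolution.{u, v} k n) Δ p)
    (cycles (C := TorChains (koszulResolution.{u, v} k n) Δ) (torDiff _ Δ) p)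
    (torChainsMultidegree _ Δ (p + 1) (sqfreeDegree U))
    (torChainsMultidegree _ Δ p (sqfreeDegree U))
    (coboundary k (restrict Δ U) m) (LinearMap.ker (coboundary k (restrict Δ U) (m + 1)))
    (torToCochain Δ U (p + 1) m) (torToCochain Δ U p (m + 1))
    (torToCochain_torDiff Δ U p m) (torDiff_mem _ Δ p _) (torToCochain_injOn Δ hpm)
    (exists_torToCochain_eq Δ (by omega)) (exists_torToCochain_eq Δ hpm)
    (by
      intro x hx
      rw [LinearMap.mem_ker]
      -- For p = 0 every chain is a cycle; correspondingly #U = m + 1, so no face within U has m + 2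
      -- vertices and every cochain is a cocycle.
      cases p with
      | zero =>
        have := subsingleton_cochains (k := k) Δ (U := U) (m := m + 1 + 1) (by omega)
        exact Subsingleton.elim _ _
      | succ p =>
        have hx' : torDiff _ Δ p x = 0 := hx
        rw [← torToCochain_torDiff, hx', map_zero])
    (by
      intro x hx hrx
      -- For p > 0 the comparison is injective on the graded piece one degree lower, so it reflects
      -- the cycle condition.
      cases p with
      | zero => exact Submodule.mem_top
      | succ p =>
        refine torToCochain_injOn Δ (m := m + 1 + 1) (by omega) _ (torDiff_mem _ Δ p _ x hx) ?_
        rw [torToCochain_torDiff]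
        exact hrx)

lemma koszulTorEquiv_naturality {Δ' Δ : PreAbstractSimplicialComplex (Fin n)} (h : Δ' ≤ Δ)
    {U : Finset (Fin n)} {p m : ℕ} (hpm : p + (m + 1) = U.card)
    (t : torNatPiece (koszulResolution.{u, v} k n) Δ p (sqfreeDegree U)) :
    koszulTorEquiv Δ' hpm (torNatPieceMap _ h p _ t) =
      reducedCohomologyMap k (restrict_mono h U) m (koszulTorEquiv Δ hpm t) := by
  obtain ⟨_, x, hx, rfl⟩ := t
  exact congrArg Submodule.Quotient.mk (Subtype.ext
    (torToCochain_torChainsMap h U p (m + 1) x.1))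

end Hochster

/-! ### Monomials in the exterior algebra -/

section Exterior

variable (k : Type u) [Field k] {n : ℕ}

/-- The exterior monomials as a basis. -/
def extBasis (n : ℕ) : Module.Basis (Finset (Fin n)) k (Ext k n) :=
  (Pi.basisFun k (Fin n)).ExteriorAlgebra

lemma extBasis_apply (σ : Finset (Fin n)) : extBasis k n σ = extMonomial k σ := by
  rw [extBasis, ExteriorAlgebra.basis_apply_ofCard _ rfl]
  change ExteriorAlgebra.ιMulti k σ.card (fun i => Pi.basisFun k (Fin n) (σ.orderEmbOfFin rfl i)) = _
  rw [ExteriorAlgebra.ιMulti_apply, extMonomial]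
  congr 1
  apply List.ext_getElem
  · simp
  · intro i h1 h2
    simp [extGen, Finset.orderEmbOfFin_apply]

lemma extMonomial_mem (σ : Finset (Fin n)) : extMonomial k σ ∈ ⋀[k]^σ.card (Fin n → k) := by
  rw [← extBasis_apply, extBasis, ExteriorAlgebra.basis_apply_ofCard _ rfl]
  exact Subtype.property (exteriorPower.ιMulti_family k σ.card (Pi.basisFun k (Fin n))
    (Set.powersetCard.ofCard rfl))

lemma span_extMonomial_eq_top : Submodule.span k (Set.range (extMonomial k (n := n))) = ⊤ := by
  rw [← (extBasis k n).span_eq]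
  congr 1
  exact congrArg Set.range (funext fun σ => (extBasis_apply k σ).symm)

lemma extMonomial_insert_min {a : Fin n} {τ : Finset (Fin n)} (h : ∀ l ∈ τ, a < l) :
    extMonomial k (insert a τ) = extGen k a * extMonomial k τ := by
  rw [extMonomial, Finset.sort_insert _ (fun l hl => (h l hl).le)
    (fun ha => lt_irrefl _ (h a ha)), List.map_cons, List.prod_cons, extMonomial]

lemma extGen_mul_self (j : Fin n) : extGen k j * extGen k j = 0 :=
  ExteriorAlgebra.ι_sq_zero _

lemma extGen_mul_swap (j l : Fin n) : extGen k j * extGen k l = - (extGen k l * extGen k j) :=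
  eq_neg_of_add_eq_zero_left (ExteriorAlgebra.ι_add_mul_swap _ _)

/-- Induction on the least element a of the set: e_j already stands in front if j < a, meets itself
if j = a, and otherwise passes e_a at the cost of one sign, which `insertSign` counts. -/
lemma extGen_mul_extMonomial (j : Fin n) (τ : Finset (Fin n)) :
    extGen k j * extMonomial k τ =
      if j ∈ τ then 0 else insertSign k j τ • extMonomial k (insert j τ) := by
  induction τ using Finset.induction_on_min with
  | empty =>
    rw [if_neg (Finset.notMem_empty j), insertSign_eq_one (by simp), one_smul,
      extMonomial_insert_min k (by simp)]
  | insert a τ h ih =>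
    have ha : a ∉ τ := fun ha => lt_irrefl _ (h a ha)
    rcases lt_trichotomy j a with hj | rfl | hj
    · have hlt : ∀ l ∈ insert a τ, j < l := by
        intro l hl
        rcases Finset.mem_insert.mp hl with rfl | hl
        · exact hj
        · exact hj.trans (h l hl)
      rw [if_neg fun hh => lt_irrefl _ (hlt j hh), insertSign_eq_one fun l hl => (hlt l hl).le,
        one_smul, extMonomial_insert_min k hlt]
    · rw [if_pos (Finset.mem_insert_self _ _), extMonomial_insert_min k h, ← mul_assoc,
        extGen_mul_self, zero_mul]
    · rw [extMonomial_insert_min k h, ← mul_assoc, extGen_mul_swap, neg_mul, mul_assoc, ih]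
      have hmem : j ∈ insert a τ ↔ j ∈ τ := by simp [hj.ne']
      simp only [hmem]
      split_ifs with hjτ
      · rw [mul_zero, neg_zero]
      · rw [insertSign_insert_of_lt ha hj, neg_smul, Finset.insert_comm,
          extMonomial_insert_min k (a := a), mul_smul_comm]
        intro l hl
        rcases Finset.mem_insert.mp hl with rfl | hl
        · exact hj
        · exact h l hl

variable {k}

/-- The product is ± the monomial of the union for disjoint sets and zero otherwise; the sign is
irrelevant for computing the ideal. -/
lemma extMonomial_mul_mem (σ τ : Finset (Fin n)) :
    extMonomial k σ * extMonomial k τ ∈ Submodule.span k {extMonomial k (σ ∪ τ)} := by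
  rw [← extBasis_apply, ← extBasis_apply, ← extBasis_apply]
  let s : Set.powersetCard (Fin n) σ.card := Set.powersetCard.ofCard rfl
  let t : Set.powersetCard (Fin n) τ.card := Set.powersetCard.ofCard rfl
  by_cases h : Disjoint s.val t.val
  · have h1 := ExteriorAlgebra.basis_mul_of_disjoint (Pi.basisFun k (Fin n)) s t h
    change (extBasis k n σ) * (extBasis k n τ) = _ • (extBasis k n _) at h1
    rw [h1, Units.smul_def, Set.powersetCard.coe_disjUnion, Finset.disjUnion_eq_union]
    exact zsmul_mem (Submodule.mem_span_singleton_self _) _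
  · have h1 := ExteriorAlgebra.basis_mul_of_not_disjoint (Pi.basisFun k (Fin n)) s t h
    change (extBasis k n σ) * (extBasis k n τ) = 0 at h1
    rw [h1]
    exact Submodule.zero_mem _

variable (k) in
/-- The span of the exterior monomials of the non-faces. -/
def nonfaceSpan (Δ : PreAbstractSimplicialComplex (Fin n)) : Submodule k (Ext k n) :=
  Submodule.span k {x | ∃ σ, ¬ IsFace Δ σ ∧ x = extMonomial k σ}

lemma extMonomial_mul_mem_nonfaceSpan {Δ : PreAbstractSimplicialComplex (Fin n)}
    {σ τ : Finset (Fin n)} (h : ¬ IsFace Δ (σ ∪ τ)) :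
    extMonomial k σ * extMonomial k τ ∈ nonfaceSpan k Δ :=
  Submodule.span_mono (by rintro _ rfl; exact ⟨_, h, rfl⟩) (extMonomial_mul_mem σ τ)

/-- A union containing a non-face is a non-face, so the span is stable under multiplication by
monomials on either side, and these span E. -/
lemma mul_mem_nonfaceSpan {Δ : PreAbstractSimplicialComplex (Fin n)} (x : Ext k n)
    {y : Ext k n} (hy : y ∈ nonfaceSpan k Δ) : x * y ∈ nonfaceSpan k Δ ∧ y * x ∈ nonfaceSpan k Δ := by
  have hx : x ∈ Submodule.span k (Set.range (extMonomial k (n := n))) := by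
    rw [span_extMonomial_eq_top]; trivial
  induction hy using Submodule.span_induction with
  | zero => rw [mul_zero, zero_mul]; exact ⟨Submodule.zero_mem _, Submodule.zero_mem _⟩
  | add y z _ _ hy hz =>
    rw [mul_add, add_mul]
    exact ⟨Submodule.add_mem _ hy.1 hz.1, Submodule.add_mem _ hy.2 hz.2⟩
  | smul c y _ hy =>
    rw [mul_smul_comm, smul_mul_assoc]
    exact ⟨Submodule.smul_mem _ _ hy.1, Submodule.smul_mem _ _ hy.2⟩
  | mem y hy =>
    obtain ⟨ρ, hρ, rfl⟩ := hy
    induction hx using Submodule.span_induction with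
    | zero => rw [mul_zero, zero_mul]; exact ⟨Submodule.zero_mem _, Submodule.zero_mem _⟩
    | add y z _ _ hy hz =>
      rw [mul_add, add_mul]
      exact ⟨Submodule.add_mem _ hy.1 hz.1, Submodule.add_mem _ hy.2 hz.2⟩
    | smul c y _ hy =>
      rw [mul_smul_comm, smul_mul_assoc]
      exact ⟨Submodule.smul_mem _ _ hy.1, Submodule.smul_mem _ _ hy.2⟩
    | mem y hy =>
      obtain ⟨σ, rfl⟩ := hy
      exact ⟨extMonomial_mul_mem_nonfaceSpan fun h => hρ (h.subset Finset.subset_union_right),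
        extMonomial_mul_mem_nonfaceSpan fun h => hρ (h.subset Finset.subset_union_left)⟩

/-- The ideal `J_Δ` is spanned by the exterior monomials of the non-faces. -/
lemma extIdeal_le_nonfaceSpan {Δ : PreAbstractSimplicialComplex (Fin n)} {x : Ext k n}
    (hx : x ∈ extIdeal k Δ) : x ∈ nonfaceSpan k Δ := by
  rw [extIdeal, TwoSidedIdeal.mem_asIdeal] at hx
  induction hx using TwoSidedIdeal.span_induction with
  | mem x h => exact Submodule.subset_span h
  | zero => exact Submodule.zero_mem _
  | add x y _ _ hx hy => exact Submodule.add_mem _ hx hy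
  | neg x _ hx => exact Submodule.neg_mem _ hx
  | left_absorb a x _ hx => exact (mul_mem_nonfaceSpan a hx).1
  | right_absorb b x _ hx => exact (mul_mem_nonfaceSpan b hx).2

lemma extMonomial_mem_extIdeal {Δ : PreAbstractSimplicialComplex (Fin n)} {σ : Finset (Fin n)}
    (h : ¬ IsFace Δ σ) : extMonomial k σ ∈ extIdeal k Δ := by
  rw [extIdeal, TwoSidedIdeal.mem_asIdeal]
  exact TwoSidedIdeal.subset_span ⟨σ, h, rfl⟩

lemma extBasis_coord_extMonomial (σ τ : Finset (Fin n)) :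
    (extBasis k n).coord σ (extMonomial k τ) = if τ = σ then 1 else 0 := by
  rw [← extBasis_apply, Module.Basis.coord_apply, Module.Basis.repr_self, Finsupp.single_apply]

variable (k)

/-- The coordinate of an element of `A` at a face; zero at the non-faces. -/
def extSRCoord (Δ : PreAbstractSimplicialComplex (Fin n)) (σ : Finset (Fin n)) :
    ExtSR k Δ →ₗ[k] k :=
  open Classical in
  if h : IsFace Δ σ then
    (Submodule.liftQ ((extIdeal k Δ).restrictScalars k) ((extBasis k n).coord σ) (by
      intro x hx
      have hx' := extIdeal_le_nonfaceSpan (k := k) (Δ := Δ) hx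
      refine Submodule.span_le.mpr ?_ hx'
      rintro _ ⟨τ, hτ, rfl⟩
      rw [SetLike.mem_coe, LinearMap.mem_ker, extBasis_coord_extMonomial, if_neg]
      rintro rfl
      exact hτ h)).comp
      (Submodule.Quotient.restrictScalarsEquiv k (extIdeal k Δ)).symm.toLinearMap
  else 0

variable {k}

lemma extSRCoord_mk {Δ : PreAbstractSimplicialComplex (Fin n)} {σ : Finset (Fin n)}
    (h : IsFace Δ σ) (τ : Finset (Fin n)) :
    extSRCoord k Δ σ ((extIdeal k Δ).mkQ (extMonomial k τ)) = if τ = σ then 1 else 0 := by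
  rw [extSRCoord, dif_pos h]
  exact extBasis_coord_extMonomial σ τ

variable (k)

/-- The exterior monomial `e_σ` as an element of `A^i`, `i = #σ`. -/
def extSRMonomial (Δ : PreAbstractSimplicialComplex (Fin n)) {i : ℕ} (σ : Finset (Fin n))
    (h : σ.card = i) : extSRDegree k Δ i :=
  ⟨(extIdeal k Δ).mkQ (extMonomial k σ), extMonomial k σ, h ▸ extMonomial_mem k σ, rfl⟩

/-- The values of a functional on `A^i` at the exterior monomials. -/
def monomialValues (Δ : PreAbstractSimplicialComplex (Fin n)) (i : ℕ) :
    Module.Dual k (extSRDegree k Δ i) →ₗ[k] (Finset (Fin n) → k) :=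
  LinearMap.pi fun σ => if h : σ.card = i then
    Module.Dual.eval k _ (extSRMonomial k Δ σ h) else 0

variable {k}

lemma monomialValues_of_card {Δ : PreAbstractSimplicialComplex (Fin n)} {i : ℕ}
    (f : Module.Dual k (extSRDegree k Δ i)) {σ : Finset (Fin n)} (h : σ.card = i) :
    monomialValues k Δ i f σ = f (extSRMonomial k Δ σ h) := by
  simp [monomialValues, h]

lemma monomialValues_of_card_ne {Δ : PreAbstractSimplicialComplex (Fin n)} {i : ℕ}
    (f : Module.Dual k (extSRDegree k Δ i)) {σ : Finset (Fin n)} (h : σ.card ≠ i) :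
    monomialValues k Δ i f σ = 0 := by
  simp [monomialValues, h]

lemma monomialValues_of_not_isFace {Δ : PreAbstractSimplicialComplex (Fin n)} {i : ℕ}
    (f : Module.Dual k (extSRDegree k Δ i)) {σ : Finset (Fin n)} (h : ¬ IsFace Δ σ) :
    monomialValues k Δ i f σ = 0 := by
  by_cases hc : σ.card = i
  · rw [monomialValues_of_card f hc]
    have : extSRMonomial k Δ σ hc = 0 :=
      Subtype.ext ((Submodule.Quotient.mk_eq_zero _).mpr (extMonomial_mem_extIdeal h))
    rw [this, map_zero]
  · exact monomialValues_of_card_ne f hc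

/-- A^i is the image of the i-th exterior power, which has the monomials of degree i as a basis; a
functional vanishing on them is zero. -/
lemma monomialValues_injective (Δ : PreAbstractSimplicialComplex (Fin n)) (i : ℕ) :
    Function.Injective (monomialValues k Δ i) := by
  rw [← LinearMap.ker_eq_bot, LinearMap.ker_eq_bot']
  intro f hf
  have hzero : f.comp (((extIdeal k Δ).mkQ.restrictScalars k).submoduleMap
      (⋀[k]^i (Fin n → k))) = 0 := by
    refine ((Pi.basisFun k (Fin n)).exteriorPower i).ext fun s => ?_
    have h1 : ((extIdeal k Δ).mkQ.restrictScalars k).submoduleMap (⋀[k]^i (Fin n → k))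
        ((Pi.basisFun k (Fin n)).exteriorPower i s) = extSRMonomial k Δ s.1 s.2 := by
      refine Subtype.ext (congrArg (extIdeal k Δ).mkQ ?_)
      rw [← extBasis_apply, extBasis]
      exact (ExteriorAlgebra.basis_eq_coe_basis _ s).symm
    refine (congrArg f h1).trans ?_
    rw [← monomialValues_of_card f s.2, hf]
    rfl
  refine LinearMap.ext ?_
  rintro ⟨_, x, hx, rfl⟩
  exact LinearMap.congr_fun hzero ⟨x, hx⟩

lemma monomialValues_extSRMul (Δ : PreAbstractSimplicialComplex (Fin n)) (i : ℕ) (j : Fin n)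
    (f : Module.Dual k (extSRDegree k Δ (i + 1))) (τ : Finset (Fin n)) :
    monomialValues k Δ i ((extSRMul k Δ j i).dualMap f) τ =
      if j ∈ τ then 0 else insertSign k j τ * monomialValues k Δ (i + 1) f (insert j τ) := by
  by_cases hc : τ.card = i
  · rw [monomialValues_of_card _ hc, LinearMap.dualMap_apply]
    split_ifs with hj
    · have : extSRMul k Δ j i (extSRMonomial k Δ τ hc) = 0 := by
        refine Subtype.ext ?_
        change (extIdeal k Δ).mkQ (extGen k j * extMonomial k τ) = 0
        rw [extGen_mul_extMonomial, if_pos hj, map_zero]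
      rw [this, map_zero]
    · have hc' : (insert j τ).card = i + 1 := by rw [Finset.card_insert_of_notMem hj, hc]
      have : extSRMul k Δ j i (extSRMonomial k Δ τ hc) =
          insertSign k j τ • extSRMonomial k Δ (insert j τ) hc' := by
        refine Subtype.ext ?_
        change (extIdeal k Δ).mkQ (extGen k j * extMonomial k τ) =
          insertSign k j τ • (extIdeal k Δ).mkQ (extMonomial k (insert j τ))
        rw [extGen_mul_extMonomial, if_neg hj]
        rfl
      rw [this, map_smul, monomialValues_of_card _ hc', smul_eq_mul]
  · rw [monomialValues_of_card_ne _ hc]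
    split_ifs with hj
    · rfl
    · rw [monomialValues_of_card_ne, mul_zero]
      rw [Finset.card_insert_of_notMem hj]
      omega

variable (k) in
/-- The functional on `A^i` dual to the exterior monomial of a face. -/
def dualMonomial (Δ : PreAbstractSimplicialComplex (Fin n)) (i : ℕ) (σ : Finset (Fin n)) :
    Module.Dual k (extSRDegree k Δ i) :=
  (extSRCoord k Δ σ).comp (extSRDegree k Δ i).subtype

lemma monomialValues_dualMonomial {Δ : PreAbstractSimplicialComplex (Fin n)} {i : ℕ}
    {σ : Finset (Fin n)} (h : IsFace Δ σ) (hc : σ.card = i) (τ : Finset (Fin n)) :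
    monomialValues k Δ i (dualMonomial k Δ i σ) τ = if τ = σ then 1 else 0 := by
  by_cases hτ : τ.card = i
  · rw [monomialValues_of_card _ hτ]
    exact extSRCoord_mk h τ
  · rw [monomialValues_of_card_ne _ hτ, if_neg]
    rintro rfl
    exact hτ hc

lemma dualMonomial_mem {Δ : PreAbstractSimplicialComplex (Fin n)} (i : ℕ)
    {σ : Finset (Fin n)} (h : IsFace Δ σ) :
    dualMonomial k Δ i σ ∈ dualMultidegree k Δ i (sqfreeDegree σ) := by
  intro a ha u hu
  change extSRCoord k Δ σ u.1 = 0
  refine (Submodule.span_le (p := LinearMap.ker (extSRCoord k Δ σ))).mpr ?_ hu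
  rintro _ ⟨τ, rfl, rfl⟩
  rw [SetLike.mem_coe, LinearMap.mem_ker, extSRCoord_mk h, if_neg]
  rintro rfl
  exact ha rfl

lemma monomialValues_of_mem_dualMultidegree {Δ : PreAbstractSimplicialComplex (Fin n)} {i : ℕ}
    {a : Fin n →₀ ℕ} {f : Module.Dual k (extSRDegree k Δ i)} (hf : f ∈ dualMultidegree k Δ i a)
    {τ : Finset (Fin n)} (h : sqfreeDegree τ ≠ a) : monomialValues k Δ i f τ = 0 := by
  by_cases hc : τ.card = i
  · rw [monomialValues_of_card _ hc]
    exact hf _ h _ (Submodule.subset_span ⟨τ, rfl, rfl⟩)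
  · exact monomialValues_of_card_ne f hc

lemma monomialValues_extSRDegreeProj {Δ' Δ : PreAbstractSimplicialComplex (Fin n)} (h : Δ' ≤ Δ)
    (i : ℕ) (f : Module.Dual k (extSRDegree k Δ' i)) :
    monomialValues k Δ i ((extSRDegreeProj k h i).dualMap f) = monomialValues k Δ' i f := by
  funext τ
  by_cases hc : τ.card = i
  · rw [monomialValues_of_card _ hc, monomialValues_of_card _ hc]
    rfl
  · rw [monomialValues_of_card_ne _ hc, monomialValues_of_card_ne _ hc]

end Exterior

/-! ### The square-free components of the Koszul modules -/

section KoszulPieces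

variable {k : Type u} [Field k] {n : ℕ}

/-- The coefficient of `x^{U ∖ τ} ⊗ e_τ^*` for `τ ⊆ U`. -/
def koszulCoeff (Δ : PreAbstractSimplicialComplex (Fin n)) (U : Finset (Fin n)) (i : ℕ)
    (τ : Finset (Fin n)) : KoszulChains k Δ i →ₗ[k] k :=
  (TensorProduct.lid k k).toLinearMap.comp
    (TensorProduct.map (MvPolynomial.lcoeff k (sqfreeDegree (U \ τ)))
      ((LinearMap.proj τ).comp (monomialValues k Δ i)))

lemma koszulCoeff_tmul (Δ : PreAbstractSimplicialComplex (Fin n)) (U : Finset (Fin n)) (i : ℕ)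
    (τ : Finset (Fin n)) (s : Poly k n) (f : Module.Dual k (extSRDegree k Δ i)) :
    koszulCoeff Δ U i τ (s ⊗ₜ f) =
      MvPolynomial.coeff (sqfreeDegree (U \ τ)) s * monomialValues k Δ i f τ := rfl

/-- The comparison of `A_i ⊗ S` with the simplicial chains of the restriction of `Δ` to `U`. -/
def koszulToChains (Δ : PreAbstractSimplicialComplex (Fin n)) (U : Finset (Fin n)) (i : ℕ) :
    KoszulChains k Δ i →ₗ[k] Chains k (restrict Δ U) i :=
  (Finsupp.linearEquivFunOnFinite k k (FaceOfCard (restrict Δ U) i)).symm.toLinearMap.comp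
    (LinearMap.pi fun σ => koszulCoeff Δ U i σ.1)

lemma chainExtend_of_forall_ne {Δ : PreAbstractSimplicialComplex (Fin n)} {m : ℕ}
    (x : Chains k Δ m) {τ : Finset (Fin n)} (h : ¬ (IsFace Δ τ ∧ τ.card = m)) :
    chainExtend k Δ m x τ = 0 := by
  induction x using Finsupp.induction_linear with
  | zero => simp
  | add x y hx hy => simp [hx, hy]
  | single σ c =>
    rw [chainExtend_single, Pi.single_apply, if_neg]
    rintro rfl
    exact h σ.2

lemma koszulCoeff_eq_zero {Δ : PreAbstractSimplicialComplex (Fin n)} {U : Finset (Fin n)} {i : ℕ}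
    {τ : Finset (Fin n)} (h : ¬ (IsFace Δ τ ∧ τ.card = i)) (x : KoszulChains k Δ i) :
    koszulCoeff Δ U i τ x = 0 := by
  induction x using TensorProduct.induction_on with
  | zero => simp
  | add x y hx hy => rw [map_add, hx, hy, add_zero]
  | tmul s f =>
    rw [koszulCoeff_tmul]
    by_cases hτ : IsFace Δ τ
    · rw [monomialValues_of_card_ne f fun hc => h ⟨hτ, hc⟩, mul_zero]
    · rw [monomialValues_of_not_isFace f hτ, mul_zero]

/-- Off the faces of Δ with i vertices the coefficient is zero of itself, so only τ ⊆ U has to be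
imposed. -/
lemma chainExtend_koszulToChains (Δ : PreAbstractSimplicialComplex (Fin n)) (U : Finset (Fin n))
    (i : ℕ) (x : KoszulChains k Δ i) (τ : Finset (Fin n)) :
    chainExtend k _ i (koszulToChains Δ U i x) τ = if τ ⊆ U then koszulCoeff Δ U i τ x else 0 := by
  by_cases h : IsFace (restrict Δ U) τ ∧ τ.card = i
  · rw [if_pos (isFace_restrict_iff.mp h.1).2]
    exact chainExtend_apply (koszulToChains Δ U i x) ⟨τ, h⟩
  · rw [chainExtend_of_forall_ne _ h]
    split_ifs with hU
    · rw [koszulCoeff_eq_zero]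
      exact fun hh => h ⟨isFace_restrict_iff.mpr ⟨hh.1, hU⟩, hh.2⟩
    · rfl

lemma koszulDiff_tmul (Δ : PreAbstractSimplicialComplex (Fin n)) (i : ℕ) (s : Poly k n)
    (f : Module.Dual k (extSRDegree k Δ (i + 1))) :
    koszulDiff k Δ i (s ⊗ₜ f) =
      ∑ j, (MvPolynomial.X j * s) ⊗ₜ[k] (extSRMul k Δ j i).dualMap f := by
  simp only [koszulDiff, LinearMap.sum_apply, LinearMap.smul_apply, LinearMap.baseChange_tmul,
    TensorProduct.smul_tmul', smul_eq_mul]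

/-- For j ∉ τ the variable x_j divides x^{U∖τ} exactly when j ∈ U, and the quotient is
x^{U∖(τ∪{j})}. Indices j ∈ τ drop out because e_j e_τ = 0. -/
lemma koszulCoeff_koszulDiff (Δ : PreAbstractSimplicialComplex (Fin n)) (U τ : Finset (Fin n))
    (i : ℕ) (x : KoszulChains k Δ (i + 1)) :
    koszulCoeff Δ U i τ (koszulDiff k Δ i x) =
      ∑ j ∈ τᶜ, insertSign k j τ *
        if j ∈ U then koszulCoeff Δ U (i + 1) (insert j τ) x else 0 := by
  classical
  induction x using TensorProduct.induction_on with
  | zero => simp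
  | add x y hx hy =>
    rw [map_add, map_add, hx, hy, ← Finset.sum_add_distrib]
    refine Finset.sum_congr rfl fun j _ => ?_
    split_ifs
    · rw [map_add, mul_add]
    · simp
  | tmul s f =>
    rw [koszulDiff_tmul, map_sum, ← Finset.sum_add_sum_compl τ]
    have h0 : ∀ j ∈ τ, koszulCoeff Δ U i τ
        ((MvPolynomial.X j * s) ⊗ₜ[k] (extSRMul k Δ j i).dualMap f) = 0 := fun j hj => by
      rw [koszulCoeff_tmul, monomialValues_extSRMul, if_pos hj, mul_zero]
    rw [Finset.sum_eq_zero h0, zero_add]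
    refine Finset.sum_congr rfl fun j hj => ?_
    have hj' : j ∉ τ := by simpa using hj
    rw [koszulCoeff_tmul, monomialValues_extSRMul, if_neg hj', koszulCoeff_tmul,
      MvPolynomial.coeff_X_mul']
    have hsupp : j ∈ (sqfreeDegree (U \ τ)).support ↔ j ∈ U := by
      rw [Finsupp.mem_support_iff, sqfreeDegree_apply]
      simp [hj']
    simp only [hsupp]
    split_ifs with hU
    · have hdeg : sqfreeDegree (U \ τ) - Finsupp.single j 1 = sqfreeDegree (U \ insert j τ) := by
        rw [Finset.sdiff_insert]
        conv_lhs => rw [← Finset.insert_erase (Finset.mem_sdiff.mpr ⟨hU, hj'⟩),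
          sqfreeDegree_insert (Finset.notMem_erase _ _)]
        exact add_tsub_cancel_left _ _
      rw [hdeg]; ring
    · simp

lemma koszulToChains_koszulDiff (Δ : PreAbstractSimplicialComplex (Fin n)) (U : Finset (Fin n))
    (i : ℕ) (x : KoszulChains k Δ (i + 1)) :
    koszulToChains Δ U i (koszulDiff k Δ i x) =
      boundary k (restrict Δ U) i (koszulToChains Δ U (i + 1) x) := by
  apply chainExtend_injective
  funext τ
  rw [chainExtend_boundary, chainExtend_koszulToChains, setDiff_apply]
  simp only [chainExtend_koszulToChains, mul_one, smul_eq_mul, Finset.insert_subset_iff]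
  split_ifs with hτ
  · simp only [hτ, and_true]
    exact koszulCoeff_koszulDiff Δ U τ i x
  · simp [hτ]

lemma chainExtend_chainsMap {Δ' Δ : PreAbstractSimplicialComplex (Fin n)} (h : Δ' ≤ Δ) (m : ℕ)
    (x : Chains k Δ' m) : chainExtend k Δ m (chainsMap k h m x) = chainExtend k Δ' m x := by
  induction x using Finsupp.induction_linear with
  | zero => simp
  | add x y hx hy => simp only [map_add, hx, hy]
  | single σ c =>
    rw [chainsMap, Finsupp.lmapDomain_apply, Finsupp.mapDomain_single, chainExtend_single,
      chainExtend_single]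

lemma koszulToChains_koszulChainsMap {Δ' Δ : PreAbstractSimplicialComplex (Fin n)} (h : Δ' ≤ Δ)
    (U : Finset (Fin n)) (i : ℕ) (x : KoszulChains k Δ' i) :
    koszulToChains Δ U i (koszulChainsMap k h i x) =
      chainsMap k (restrict_mono h U) i (koszulToChains Δ' U i x) := by
  apply chainExtend_injective
  funext τ
  rw [chainExtend_chainsMap, chainExtend_koszulToChains, chainExtend_koszulToChains]
  congr 1
  induction x using TensorProduct.induction_on with
  | zero => simp
  | add x y hx hy => rw [map_add, map_add, map_add, hx, hy]
  | tmul s f =>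
    rw [koszulChainsMap, LinearMap.baseChange_tmul, koszulCoeff_tmul, koszulCoeff_tmul,
      monomialValues_extSRDegreeProj]

variable (k) in
/-- The generator `x^{U ∖ σ} ⊗ e_σ^*` of the component of degree `U` of `A_i ⊗ S`. -/
def koszulGen (Δ : PreAbstractSimplicialComplex (Fin n)) (U : Finset (Fin n)) {i : ℕ}
    (σ : FaceOfCard (restrict Δ U) i) : KoszulChains k Δ i :=
  MvPolynomial.monomial (sqfreeDegree (U \ σ.1)) (1 : k) ⊗ₜ[k] dualMonomial k Δ i σ.1

lemma koszulGen_mem (Δ : PreAbstractSimplicialComplex (Fin n)) (U : Finset (Fin n)) {i : ℕ}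
    (σ : FaceOfCard (restrict Δ U) i) :
    koszulGen k Δ U σ ∈ koszulChainsMultidegree k Δ i (sqfreeDegree U) :=
  Submodule.subset_span ⟨_, _, _, sqfreeDegree_sdiff_add (isFace_restrict_iff.mp σ.2.1).2,
    dualMonomial_mem i (isFace_restrict_iff.mp σ.2.1).1, rfl⟩

lemma koszulToChains_koszulGen (Δ : PreAbstractSimplicialComplex (Fin n)) (U : Finset (Fin n))
    {i : ℕ} (σ : FaceOfCard (restrict Δ U) i) :
    koszulToChains Δ U i (koszulGen k Δ U σ) = Finsupp.single σ 1 := by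
  classical
  apply chainExtend_injective
  funext τ
  rw [chainExtend_koszulToChains, chainExtend_single, koszulGen, koszulCoeff_tmul,
    monomialValues_dualMonomial (isFace_restrict_iff.mp σ.2.1).1 σ.2.2, Pi.single_apply,
    MvPolynomial.coeff_monomial]
  by_cases h : τ = σ.1
  · subst h
    simp [(isFace_restrict_iff.mp σ.2.1).2]
  · simp [h]

/-- A decomposition of a square-free degree into two summands is a partition of U, so a functional
of degree σ is accompanied by x^{U∖σ}. -/
lemma koszulChainsMultidegree_eq_span (Δ : PreAbstractSimplicialComplex (Fin n))
    (U : Finset (Fin n)) (i : ℕ) :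
    koszulChainsMultidegree k Δ i (sqfreeDegree U) =
      Submodule.span k (Set.range (koszulGen k Δ U (i := i))) := by
  apply le_antisymm
  · rw [koszulChainsMultidegree, Submodule.span_le]
    rintro _ ⟨c, a, f, hca, hf, rfl⟩
    have hle : a ≤ sqfreeDegree U := by rw [← hca]; exact le_add_self
    obtain ⟨ha, hsub⟩ := eq_sqfreeDegree_of_le hle
    obtain ⟨σ, rfl⟩ : ∃ σ, a = sqfreeDegree σ := ⟨_, ha⟩
    have hσU : σ ⊆ U := by
      rwa [← sqfreeDegree_injective ha] at hsub
    have hc : c = sqfreeDegree (U \ σ) := by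
      rw [← sqfreeDegree_sdiff_add hσU] at hca
      exact add_right_cancel hca
    -- A functional of degree σ is determined by its value at e_σ, since its values at all other
    -- monomials are zero.
    have hne : ∀ τ, τ ≠ σ → monomialValues k Δ i f τ = 0 := fun τ hτ =>
      monomialValues_of_mem_dualMultidegree hf fun h => hτ (sqfreeDegree_injective h)
    by_cases hσ : IsFace Δ σ ∧ σ.card = i
    · have hfσ : f = monomialValues k Δ i f σ • dualMonomial k Δ i σ := by
        apply monomialValues_injective
        funext τ
        rw [map_smul, Pi.smul_apply, monomialValues_dualMonomial hσ.1 hσ.2, smul_eq_mul]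
        split_ifs with h
        · rw [h, mul_one]
        · rw [hne τ h, mul_zero]
      rw [hfσ, TensorProduct.tmul_smul, hc]
      exact Submodule.smul_mem _ _ (Submodule.subset_span
        ⟨⟨σ, isFace_restrict_iff.mpr ⟨hσ.1, hσU⟩, hσ.2⟩, rfl⟩)
    -- If σ is a non-face or has the wrong cardinality, even the value at e_σ vanishes.
    · have hf0 : f = 0 := by
        apply monomialValues_injective
        funext τ
        rw [map_zero, Pi.zero_apply]
        by_cases h : τ = σ
        · subst h
          by_cases hface : IsFace Δ τ
          · exact monomialValues_of_card_ne f fun hc => hσ ⟨hface, hc⟩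
          · exact monomialValues_of_not_isFace f hface
        · exact hne τ h
      rw [hf0, TensorProduct.tmul_zero]
      exact Submodule.zero_mem _
  · rw [Submodule.span_le]
    rintro _ ⟨σ, rfl⟩
    exact koszulGen_mem Δ U σ

lemma koszulToChains_sum (Δ : PreAbstractSimplicialComplex (Fin n)) (U : Finset (Fin n))
    {i : ℕ} (a : FaceOfCard (restrict Δ U) i → k) (τ : FaceOfCard (restrict Δ U) i) :
    koszulToChains Δ U i (∑ σ, a σ • koszulGen k Δ U σ) τ = a τ := by
  classical
  rw [map_sum]
  simp [koszulToChains_koszulGen, Finsupp.finsetSum_apply, Finsupp.single_apply]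

lemma koszulToChains_injOn (Δ : PreAbstractSimplicialComplex (Fin n)) (U : Finset (Fin n))
    (i : ℕ) (x : KoszulChains k Δ i)
    (hx : x ∈ koszulChainsMultidegree k Δ i (sqfreeDegree U)) (h : koszulToChains Δ U i x = 0) :
    x = 0 := by
  rw [koszulChainsMultidegree_eq_span] at hx
  obtain ⟨a, rfl⟩ := (Submodule.mem_span_range_iff_exists_fun k).mp hx
  refine Finset.sum_eq_zero fun σ _ => ?_
  rw [← koszulToChains_sum Δ U a σ, h, Finsupp.zero_apply, zero_smul]

lemma exists_koszulToChains_eq (Δ : PreAbstractSimplicialComplex (Fin n)) (U : Finset (Fin n))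
    (i : ℕ) (z : Chains k (restrict Δ U) i) :
    ∃ x ∈ koszulChainsMultidegree k Δ i (sqfreeDegree U), koszulToChains Δ U i x = z :=
  ⟨∑ σ, z σ • koszulGen k Δ U σ,
    Submodule.sum_mem _ fun σ _ => Submodule.smul_mem _ _ (koszulGen_mem Δ U σ),
    Finsupp.ext fun τ => koszulToChains_sum Δ U z τ⟩

/-- Multiplication by e_j reaches e_σ only from e_{σ∖{j}}, so its transpose contracts e_σ^* to that
single dual monomial. -/
lemma dualMap_extSRMul_dualMonomial {Δ : PreAbstractSimplicialComplex (Fin n)} {i : ℕ}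
    {σ : Finset (Fin n)} (h : IsFace Δ σ) (hc : σ.card = i + 1) (j : Fin n) :
    (extSRMul k Δ j i).dualMap (dualMonomial k Δ (i + 1) σ) =
      if j ∈ σ then insertSign k j (σ.erase j) • dualMonomial k Δ i (σ.erase j) else 0 := by
  apply monomialValues_injective
  funext τ
  rw [monomialValues_extSRMul, monomialValues_dualMonomial h hc]
  by_cases hj : j ∈ σ
  · rw [if_pos hj, map_smul, Pi.smul_apply,
      monomialValues_dualMonomial (h.subset (Finset.erase_subset _ _))
        (by rw [Finset.card_erase_of_mem hj, hc]; rfl), smul_eq_mul]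
    by_cases hτ : τ = σ.erase j
    · subst hτ
      rw [if_neg (Finset.notMem_erase _ _), Finset.insert_erase hj, if_pos rfl, if_pos rfl]
    · rw [if_neg hτ, mul_zero]
      split_ifs with h1 h2
      · rfl
      · exact absurd (by rw [← h2, Finset.erase_insert h1]) hτ
      · rw [mul_zero]
  · rw [if_neg hj, map_zero, Pi.zero_apply]
    split_ifs with h1 h2
    · rfl
    · exact absurd (h2 ▸ Finset.mem_insert_self _ _) hj
    · rw [mul_zero]

/-- The polynomial factor gains x_j while the dual monomial loses j, so the total degree is
unchanged. -/
lemma koszulDiff_mem (Δ : PreAbstractSimplicialComplex (Fin n)) (U : Finset (Fin n)) (i : ℕ) :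
    ∀ x ∈ koszulChainsMultidegree k Δ (i + 1) (sqfreeDegree U),
      koszulDiff k Δ i x ∈ koszulChainsMultidegree k Δ i (sqfreeDegree U) := by
  intro x hx
  rw [koszulChainsMultidegree_eq_span] at hx
  induction hx using Submodule.span_induction with
  | zero => rw [map_zero]; exact Submodule.zero_mem _
  | add x y _ _ hx hy => rw [map_add]; exact Submodule.add_mem _ hx hy
  | smul c x _ hx =>
    have : koszulDiff k Δ i (c • x) = c • koszulDiff k Δ i x :=
      ((koszulDiff k Δ i).restrictScalars k).map_smul c x
    rw [this]; exact Submodule.smul_mem _ _ hx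
  | mem x hx =>
    obtain ⟨σ, rfl⟩ := hx
    obtain ⟨hσ, hσU⟩ := isFace_restrict_iff.mp σ.2.1
    rw [koszulGen, koszulDiff_tmul]
    refine Submodule.sum_mem _ fun j _ => ?_
    rw [dualMap_extSRMul_dualMonomial hσ σ.2.2]
    split_ifs with hj
    · rw [TensorProduct.tmul_smul, X_mul_monomial]
      refine Submodule.smul_mem _ _ (Submodule.subset_span ⟨_, _, _, ?_,
        dualMonomial_mem i (hσ.subset (Finset.erase_subset _ _)), rfl⟩)
      rw [add_assoc, ← sqfreeDegree_insert (Finset.notMem_erase _ _), Finset.insert_erase hj,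
        sqfreeDegree_sdiff_add hσU]
    · rw [TensorProduct.tmul_zero]
      exact Submodule.zero_mem _

/-- The square-free components of the Koszul modules are reduced homology groups. -/
def koszulModulePieceEquiv (Δ : PreAbstractSimplicialComplex (Fin n)) (U : Finset (Fin n))
    (m : ℕ) : koszulModulePiece k Δ (m + 1) (sqfreeDegree U) ≃ₗ[k]
      ReducedHomology k (restrict Δ U) m :=
  gradedPieceEquiv (koszulDiff k Δ (m + 1)) (cycles (koszulDiff k Δ) (m + 1))
    (koszulChainsMultidegree k Δ (m + 1 + 1) (sqfreeDegree U))
    (koszulChainsMultidegree k Δ (m + 1) (sqfreeDegree U))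
    (boundary k (restrict Δ U) (m + 1)) (cycles (boundary k (restrict Δ U)) (m + 1))
    (koszulToChains Δ U (m + 1 + 1)) (koszulToChains Δ U (m + 1))
    (koszulToChains_koszulDiff Δ U (m + 1)) (koszulDiff_mem Δ U (m + 1))
    (koszulToChains_injOn Δ U (m + 1)) (exists_koszulToChains_eq Δ U (m + 1 + 1))
    (exists_koszulToChains_eq Δ U (m + 1))
    (by
      intro x hx
      have hx' : koszulDiff k Δ m x = 0 := hx
      change boundary k _ m _ = 0
      rw [← koszulToChains_koszulDiff, hx', map_zero])
    (by
      intro x hx hrx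
      -- The cycle condition is reflected because the comparison is injective on the graded piece in
      -- degree `m`.
      refine koszulToChains_injOn Δ U m _ (koszulDiff_mem Δ U m x hx) ?_
      rw [koszulToChains_koszulDiff]
      exact hrx)

lemma koszulModulePieceEquiv_naturality {Δ' Δ : PreAbstractSimplicialComplex (Fin n)}
    (h : Δ' ≤ Δ) (U : Finset (Fin n)) (m : ℕ)
    (w : koszulModulePiece k Δ' (m + 1) (sqfreeDegree U)) :
    koszulModulePieceEquiv (k := k) Δ U m (koszulModulePieceMap k h (m + 1) _ w) =
      reducedHomologyMap k (restrict_mono h U) m (koszulModulePieceEquiv (k := k) Δ' U m w) := by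
  obtain ⟨_, x, hx, rfl⟩ := w
  exact congrArg Submodule.Quotient.mk (Subtype.ext
    (koszulToChains_koszulChainsMap h U (m + 1) x.1))

/-- The square-free components of the Koszul modules, naturally in the complex. -/
theorem exists_koszulModulePieceEquiv {b : Fin n →₀ ℕ} {U : Finset (Fin n)} {i m : ℕ}
    (hb : b = sqfreeDegree U) (hi : i = m + 1) :
    ∃ ε : ∀ Δ : PreAbstractSimplicialComplex (Fin n),
        koszulModulePiece k Δ i b ≃ₗ[k] ReducedHomology k (restrict Δ U) m,
      ∀ (Δ' Δ : PreAbstractSimplicialComplex (Fin n)) (h : Δ' ≤ Δ) (w),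
        ε Δ (koszulModulePieceMap k h i b w) =
          reducedHomologyMap k (restrict_mono h U) m (ε Δ' w) := by
  subst hb hi
  exact ⟨fun Δ => koszulModulePieceEquiv Δ U m, fun Δ' Δ h w =>
    koszulModulePieceEquiv_naturality h U m w⟩

end KoszulPieces

/-! ### Duality of reduced homology and cohomology, and `Tor` in all degrees -/

section Duality

variable {k : Type u} [Field k] {n : ℕ}

/-- Reduced homology is the dual of reduced cohomology. -/
def reducedHomologyEquiv (Δ : PreAbstractSimplicialComplex (Fin n)) (m : ℕ) :
    ReducedHomology k Δ m ≃ₗ[k] Module.Dual k (ReducedCohomology k Δ m) :=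
  LinearEquiv.ofBijective (homologyEval (boundary k Δ) m)
    (homologyEval_bijective (boundary k Δ) m (boundary_boundary Δ m))

/-- The cochain maps are by definition the transposes of the chain maps, so pushing a cycle forward
and pulling a cocycle back give the same pairing. -/
lemma reducedHomologyEquiv_naturality {Δ' Δ : PreAbstractSimplicialComplex (Fin n)}
    (h : Δ' ≤ Δ) (m : ℕ) (z : ReducedHomology k Δ' m) :
    reducedHomologyEquiv Δ m (reducedHomologyMap k h m z) =
      (reducedCohomologyMap k h m).dualMap (reducedHomologyEquiv Δ' m z) := by
  obtain ⟨z, rfl⟩ := Submodule.Quotient.mk_surjective _ z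
  refine LinearMap.ext fun f => ?_
  obtain ⟨f, rfl⟩ := Submodule.Quotient.mk_surjective _ f
  rfl

/-- Hochster's formula, for any resolution and naturally in the complex. -/
theorem exists_torPieceEquiv (F : MultigradedFreeResolution.{u, v} k n) {U : Finset (Fin n)}
    {b : Fin n →₀ ℕ} {q : ℤ} {m : ℕ} (hb : b = sqfreeDegree U)
    (hq : q = (U.card : ℤ) - ((m + 1 : ℕ) : ℤ)) :
    ∃ τ : ∀ Δ : PreAbstractSimplicialComplex (Fin n),
        torPiece F Δ q b ≃ₗ[k] ReducedCohomology k (restrict Δ U) m,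
      ∀ (Δ' Δ : PreAbstractSimplicialComplex (Fin n)) (h : Δ' ≤ Δ) (t),
        τ Δ' (torPieceMap F h q b t) =
          reducedCohomologyMap k (restrict_mono h U) m (τ Δ t) := by
  subst hb
  -- If U is large enough, the Tor index is the natural number p = #U - (m + 1); otherwise it is
  -- negative.
  by_cases hm : m + 1 ≤ U.card
  · obtain ⟨p, hp⟩ := Nat.exists_eq_add_of_le' hm
    obtain rfl : q = (p : ℤ) := by rw [hq, hp]; push_cast; ring
    obtain ⟨τ, hτ⟩ := exists_torNatPieceEquiv F (koszulResolution.{u, v} k n) p (sqfreeDegree U)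
    have hpiece : ∀ Δ, torPiece F Δ (p : ℤ) (sqfreeDegree U) =
        torNatPiece F Δ p (sqfreeDegree U) := fun Δ => if_pos (Int.natCast_nonneg p)
    refine ⟨fun Δ => (LinearEquiv.ofEq _ _ (hpiece Δ)).trans
      ((τ Δ).trans (koszulTorEquiv Δ hp.symm)), fun Δ' Δ h t => ?_⟩
    rw [LinearEquiv.trans_apply, LinearEquiv.trans_apply, LinearEquiv.trans_apply,
      LinearEquiv.trans_apply, ← koszulTorEquiv_naturality, ← hτ]
    rfl
  -- Here Tor is zero by convention, and the cohomology is zero because U has fewer than m + 1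
  -- elements.
  · have hneg : ¬ 0 ≤ q := by omega
    have h1 : ∀ Δ, Subsingleton (torPiece F Δ q (sqfreeDegree U)) := fun Δ => by
      rw [torPiece, if_neg hneg]
      infer_instance
    have h2 : ∀ Δ : PreAbstractSimplicialComplex (Fin n),
        Subsingleton (ReducedCohomology k (restrict Δ U) m) := fun Δ => by
      have := subsingleton_cochains (k := k) Δ (U := U) (m := m + 1) (by omega)
      refine ⟨fun x y => ?_⟩
      obtain ⟨x, rfl⟩ := Submodule.Quotient.mk_surjective _ x
      obtain ⟨y, rfl⟩ := Submodule.Quotient.mk_surjective _ y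
      exact congrArg _ (Subtype.ext (Subsingleton.elim _ _))
    exact ⟨fun Δ => LinearEquiv.ofSubsingleton _ _, fun Δ' Δ h t => Subsingleton.elim _ _⟩

end Duality

/-! ### Square-free multidegrees and their supports -/

lemma eq_sqfreeDegree_support {n : ℕ} {b : Fin n →₀ ℕ} (hb : ∀ j, b j ≤ 1) :
    b = sqfreeDegree b.support := by
  ext j
  rw [sqfreeDegree_apply]
  have := hb j
  split_ifs with h
  · have := Finsupp.mem_support_iff.mp h; omega
  · exact Finsupp.notMem_support_iff.mp h

lemma degree_eq_card_support {n : ℕ} {b : Fin n →₀ ℕ} (hb : ∀ j, b j ≤ 1) :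
    b.degree = b.support.card := by
  rw [Finsupp.degree, Finset.card_eq_sum_ones]
  refine Finset.sum_congr rfl fun j hj => ?_
  have := Finsupp.mem_support_iff.mp hj
  have := hb j
  omega

/-! ### Transport of natural isomorphisms through duals -/

section DualTransport

variable {k : Type*} [Field k] {I : Type*} [LE I] {W T C H : I → Type*}
  [∀ x, AddCommGroup (W x)] [∀ x, Module k (W x)] [∀ x, AddCommGroup (T x)] [∀ x, Module k (T x)]
  [∀ x, AddCommGroup (C x)] [∀ x, Module k (C x)] [∀ x, AddCommGroup (H x)] [∀ x, Module k (H x)]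

/-- Natural isomorphisms `W ≅ H ≅ C^∨` and `T ≅ C` give natural isomorphisms
`W ≅ T^∨ ≅ C^∨ ≅ H`. -/
lemma exists_dual_isomorphisms {w : ∀ {x y : I}, x ≤ y → W x →ₗ[k] W y}
    {t : ∀ {x y : I}, x ≤ y → T y →ₗ[k] T x} {c : ∀ {x y : I}, x ≤ y → C y →ₗ[k] C x}
    {h : ∀ {x y : I}, x ≤ y → H x →ₗ[k] H y}
    (hW : ∃ e : ∀ x, W x ≃ₗ[k] H x, ∀ x y (hxy : x ≤ y) z, e y (w hxy z) = h hxy (e x z))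
    (g : ∀ x, H x ≃ₗ[k] Module.Dual k (C x))
    (hg : ∀ x y (hxy : x ≤ y) z, g y (h hxy z) = (c hxy).dualMap (g x z))
    (hT : ∃ τ : ∀ x, T x ≃ₗ[k] C x, ∀ x y (hxy : x ≤ y) z, τ x (t hxy z) = c hxy (τ y z)) :
    ∃ (α : ∀ x, W x ≃ₗ[k] Module.Dual k (T x))
      (β : ∀ x, Module.Dual k (T x) ≃ₗ[k] Module.Dual k (C x))
      (γ : ∀ x, Module.Dual k (C x) ≃ₗ[k] H x),
      ∀ (x y : I) (hxy : x ≤ y),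
        (∀ z, α y (w hxy z) = (t hxy).dualMap (α x z)) ∧
        (∀ z, β y ((t hxy).dualMap z) = (c hxy).dualMap (β x z)) ∧
        (∀ z, γ y ((c hxy).dualMap z) = h hxy (γ x z)) := by
  obtain ⟨e, he⟩ := hW
  obtain ⟨τ, hτ⟩ := hT
  -- The first map is the composite W ≅ H ≅ C^∨ ≅ T^∨; the other two are the transpose of τ⁻¹ and
  -- the inverse of the duality.
  refine ⟨fun x => (e x).trans ((g x).trans (τ x).dualMap), fun x => (τ x).symm.dualMap,
    fun x => (g x).symm, fun x y hxy => ⟨fun z => ?_, fun z => ?_, fun z => ?_⟩⟩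
  · refine LinearMap.ext fun s => ?_
    change g y (e y (w hxy z)) (τ y s) = g x (e x z) (τ x (t hxy s))
    rw [he, hg, hτ]
    rfl
  -- Naturality of τ passes to its inverse: write `s` as a value of τ and compare after applying τ.
  · refine LinearMap.ext fun s => congrArg z ?_
    obtain ⟨s, rfl⟩ := (τ y).surjective s
    apply (τ x).injective
    change τ x (t hxy ((τ y).symm (τ y s))) = τ x ((τ x).symm (c hxy (τ y s)))
    rw [LinearEquiv.symm_apply_apply, LinearEquiv.apply_symm_apply, hτ]
  · apply (g y).injective
    rw [LinearEquiv.apply_symm_apply, hg, LinearEquiv.apply_symm_apply]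

end DualTransport

end KoszulSC

end

open KoszulSC in
theorem theorem4p1 {k : Type u} [Field k] [CharZero k] {n : ℕ} {i : ℕ} (hi : 1 ≤ i)
    {b : Fin n →₀ ℕ} (hb : ∀ j, b j ≤ 1) :
    Nonempty (MultigradedFreeResolution.{u, v} k n) ∧
    ∀ F : MultigradedFreeResolution.{u, v} k n,
      ∃ (α : ∀ Δ : PreAbstractSimplicialComplex (Fin n),
            koszulModulePiece k Δ i b ≃ₗ[k]
              Module.Dual k (torPiece F Δ ((b.degree : ℤ) - (i : ℤ)) b))
        (β : ∀ Δ : PreAbstractSimplicialComplex (Fin n),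
            Module.Dual k (torPiece F Δ ((b.degree : ℤ) - (i : ℤ)) b) ≃ₗ[k]
              Module.Dual k (ReducedCohomology k (restrict Δ b.support) (i - 1)))
        (γ : ∀ Δ : PreAbstractSimplicialComplex (Fin n),
            Module.Dual k (ReducedCohomology k (restrict Δ b.support) (i - 1)) ≃ₗ[k]
              ReducedHomology k (restrict Δ b.support) (i - 1)),
        ∀ (Δ' Δ : PreAbstractSimplicialComplex (Fin n)) (h : Δ' ≤ Δ),
          (∀ w, α Δ (koszulModulePieceMap k h i b w) =
            (torPieceMap F h ((b.degree : ℤ) - (i : ℤ)) b).dualMap (α Δ' w)) ∧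
          (∀ t, β Δ ((torPieceMap F h ((b.degree : ℤ) - (i : ℤ)) b).dualMap t) =
            (reducedCohomologyMap k (restrict_mono h b.support) (i - 1)).dualMap (β Δ' t)) ∧
          (∀ z, γ Δ ((reducedCohomologyMap k (restrict_mono h b.support) (i - 1)).dualMap z) =
            reducedHomologyMap k (restrict_mono h b.support) (i - 1) (γ Δ' z)) := by
  have hU := eq_sqfreeDegree_support hb
  -- Since i ≥ 1 the truncated subtraction is exact, so dimension i - 1 corresponds to faces with i
  -- vertices.
  have hi' : i = i - 1 + 1 := (Nat.sub_add_cancel hi).symm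
  have hq : (b.degree : ℤ) - (i : ℤ) = (b.support.card : ℤ) - ((i - 1 + 1 : ℕ) : ℤ) := by
    rw [degree_eq_card_support hb, ← hi']
  have hW := exists_koszulModulePieceEquiv (k := k) hU hi'
  refine ⟨⟨koszulResolution k n⟩, fun F => ?_⟩
  have hT := exists_torPieceEquiv F hU hq
  exact exists_dual_isomorphisms (k := k)
    (W := fun Δ => koszulModulePiece k Δ i b)
    (T := fun Δ => torPiece F Δ ((b.degree : ℤ) - (i : ℤ)) b)
    (C := fun Δ => ReducedCohomology k (restrict Δ b.support) (i - 1))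
    (H := fun Δ => ReducedHomology k (restrict Δ b.support) (i - 1))
    (w := fun h => koszulModulePieceMap k h i b)
    (t := fun h => torPieceMap F h ((b.degree : ℤ) - (i : ℤ)) b)
    (c := fun h => reducedCohomologyMap k (restrict_mono h b.support) (i - 1))
    (h := fun h => reducedHomologyMap k (restrict_mono h b.support) (i - 1)) hW
    (fun Δ => reducedHomologyEquiv (restrict Δ b.support) (i - 1))
    (fun Δ' Δ h => reducedHomologyEquiv_naturality (restrict_mono h b.support) (i - 1)) hT
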